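/- **Setting.** Let $\hat\lambda,\nu,\lambda>0$ and let $\rho\in\mathcal S(\mathbb R^2)$ be real valued and radially symmetric ($\rho(x)=\gamma(|x|)$ with $\gamma\in\mathcal S(\mathbb R)$), with $\int\rho=1$ and with $\hat\rho$ supported in the closed unit ball, where $\hat f(p)=\int f(x)e^{-\imath p\cdot x}dx$. For $0<\varepsilon<1$ put $\rho_\varepsilon=\varepsilon^{-2}\rho(\varepsilon^{-1}\cdot)$, $V_\varepsilon=\rho_\varepsilon*\rho_\varepsilon$ and $\kappa_\varepsilon=\hat\lambda/\sqrt{\log(1/\varepsilon)}$. Let $\mathbb P^\varepsilon$ be the law of the curl $\omega^\varepsilon=\nabla^\perp(\rho_\varepsilon*\xi)$ of the mollified two-dimensional Gaussian free field, i.e. of the centred Gaussian field with covariance $\mathbb E[\omega^\varepsilon_i(x)\omega^\varepsilon_j(y)]=\int \frac{\hat V_\varepsilon(p)}{|p|^2}p_i^\perp p_j^\perp e^{\imath p\cdot(x-y)}dp$, where $p^\perp=(p_2,-p_1)$. By the Wiener chaos decomposition $L^2(\mathbb P^\varepsilon)$ is identified with the Fock space of sequences $\psi=(\hat\psi_m)_{m\ge0}$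 of kernels, where $\hat\psi_m:(\mathbb R^2)^m\to\mathbb C$ is symmetric and represents the component of $\psi$ in the $m$-th chaos, with $$\langle\psi,\phi\rangle_\varepsilon=\sum_{m\ge0} m!\int_{\mathbb R^{2m}}\prod_{i=1}^m\frac{\hat V_\varepsilon(p_i)}{|p_i|^2}\,\overline{\hat\psi_m(p_{1:m})}\,\hat\phi_m(p_{1:m})\,dp_{1:m},\qquad \|\psi\|_\varepsilon^2=\langle\psi,\psi\rangle_\varepsilon .$$ Let $\mathcal V^\varepsilon(\sigma)=\kappa_\varepsilon\sigma(0)$; its component $\mathcal V_i^\varepsilon$, $i=1,2$, lies in the first chaos and has the kernel $-\imath\kappa_\varepsilon p_i^\perp$. The generator of the environment seen from the particle is $\mathcal L^\varepsilon=\mathcal L_0+\mathcal A_+^\varepsilon+\mathcal A_-^\varepsilon$, where $\mathcal L_0=\frac{\nu^2}2(D_1^2+D_2^2)$, $\mathcal A_+^\varepsilon+\mathcal A_-^\varepsilon=\mathcal V^\varepsilon\cdot D$ and $D_k$ are the generators of the translations; for $\psi$ in the $m$-th chaos it acts on kernels by $$\widehat{(-\mathcal L_0)\psi}(p_{1:m})=\tfrac{\nu^2}{2}\Big|\sum_{i=1}^m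 p_i\Big|^2\hat\psi(p_{1:m}),$$ $$\widehat{\mathcal A_+^\varepsilon\psi}(p_{1:m+1})=-\frac{\kappa_\varepsilon}{m+1}\sum_{i=1}^{m+1}\Big(p_i\times\sum_{j=1}^{m+1}p_j\Big)\hat\psi(p_{1:m+1\setminus i}),$$ $$\widehat{\mathcal A_-^\varepsilon\psi}(p_{1:m-1})=m\,\kappa_\varepsilon\int_{\mathbb R^2}\frac{\hat V_\varepsilon(q)}{|q|^2}\,\hat\psi(p_{1:m-1},q)\Big(q\times\sum_{k=1}^{m-1}p_k\Big)dq\quad(m\ge1),$$ and $\mathcal A_-^\varepsilon\psi=0$ for $m=0$, where $a\times b=a^\perp\cdot b$. Functions of $-\mathcal L_0$ are the corresponding multiplication operators on kernels. Put $$L^\varepsilon(x)=\frac{\pi\hat\lambda^2}{|\log\varepsilon^2|}\log\Big(1+\frac1{\varepsilon^2x}\Big),\qquad G_1=0,\qquad G_{j+1}(x)=\int_0^x\frac{dy}{1+\frac4{\nu^4}G_j(y)}\quad(j\ge1).$$ For $n\ge1$ and $i=1,2$ define $(b^{\varepsilon,n})_i=\sum_{j=1}^nb^{\varepsilon,n}_{j,i}$,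 with $b^{\varepsilon,n}_{j,i}$ in the $j$-th chaos, by $$b^{\varepsilon,n}_{1,i}=\big[\lambda-\mathcal L_0\big(1+\tfrac4{\nu^4}G_n(L^\varepsilon(\lambda-\mathcal L_0))\big)\big]^{-1}\mathcal V_i^\varepsilon,$$ $$b^{\varepsilon,n}_{j,i}=\big[\lambda-\mathcal L_0\big(1+\tfrac4{\nu^4}G_{n+1-j}(L^\varepsilon(\lambda-\mathcal L_0))\big)\big]^{-1}\mathcal A_+^\varepsilon b^{\varepsilon,n}_{j-1,i}\qquad(2\le j\le n).$$ **Theorem.** For all $0<\varepsilon<1$, $n\ge1$ and $i=1,2$ the functionals $(b^{\varepsilon,n})_i$, $(\lambda-\mathcal L_0)^{1/2}(b^{\varepsilon,n})_i$ and $\mathcal L^\varepsilon(b^{\varepsilon,n})_i$ belong to the Fock space. Moreover, for $i=1,2$, $$\lim_{n\to\infty}\lim_{\varepsilon\to0}\|(b^{\varepsilon,n})_i\|_\varepsilon=0,$$ $$\lim_{n\to\infty}\lim_{\varepsilon\to0}\big\|(\lambda-\mathcal L_0)^{-1/2}\big(\mathcal V_i^\varepsilon-(\lambda-\mathcal L^\varepsilon)(b^{\varepsilon,n})_i\big)\big\|_\varepsilon=0,$$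 $$\lim_{n\to\infty}\lim_{\varepsilon\to0}\big\|(\lambda-\mathcal L_0)^{1/2}(b^{\varepsilon,n})_i\big\|_\varepsilon^2=\frac{c(\nu)^2}{4},\qquad c(\nu)=\sqrt{4\Big(\sqrt{2\pi\hat\lambda^2+\tfrac{\nu^4}4}-\tfrac{\nu^2}2\Big)},$$ $$\lim_{n\to\infty}\lim_{\varepsilon\to0}\big\langle(\lambda-\mathcal L_0)^{1/2}(b^{\varepsilon,n})_1,(\lambda-\mathcal L_0)^{1/2}(b^{\varepsilon,n})_2\big\rangle_\varepsilon=0,$$ where in each case the inner limit ($\varepsilon\downarrow0$) exists for every $n\ge1$. -/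

import Mathlib

open MeasureTheory Filter Topology
open scoped ENNReal Nat SchwartzMap ComplexConjugate

noncomputable section

namespace CurlGFF

/-- The plane, with the Euclidean norm. -/
abbrev Plane := EuclideanSpace ℝ (Fin 2)

/-- `p^⊥ = (p₂, -p₁)`. -/
def perp (p : Plane) (i : Fin 2) : ℝ := if i = 0 then p 1 else -(p 0)

/-- The signed area `a × b = |a| |b| sin θ`; the orientation of the angle is the one for which
`a × b = a^⊥ · b`. -/
def cross (a b : Plane) : ℝ := a 1 * b 0 - a 0 * b 1

/-- Fourier transform `f̂(p) = ∫ f(x) e^{-i p·x} dx`. -/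
def ft (f : Plane → ℝ) (p : Plane) : ℂ :=
  ∫ x, (f x : ℂ) * Complex.exp (-(Complex.I * ((inner ℝ p x : ℝ) : ℂ)))

/-- The assumption on the mollifier `ρ`: a radially symmetric Schwartz function of integral one
whose Fourier transform is supported in the unit ball. -/
structure IsMollifier (ρ : 𝓢(Plane, ℝ)) : Prop where
  radial : ∃ γ : 𝓢(ℝ, ℝ), ∀ x, ρ x = γ ‖x‖
  integral_eq_one : ∫ x, ρ x = 1
  support_ft : Function.support (ft ρ) ⊆ Metric.closedBall 0 1

/-- `ρ_ε = ε⁻² ρ(ε⁻¹ ·)`. -/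
def rhoEps (ρ : Plane → ℝ) (ε : ℝ) (x : Plane) : ℝ := (ε ^ 2)⁻¹ * ρ (ε⁻¹ • x)

/-- `V_ε = ρ_ε * ρ_ε`. -/
def covEps (ρ : Plane → ℝ) (ε : ℝ) (x : Plane) : ℝ :=
  ∫ y, rhoEps ρ ε (x - y) * rhoEps ρ ε y

/-- `V̂_ε`, which is a real function because `ρ` is radial. -/
def covHat (ρ : Plane → ℝ) (ε : ℝ) (p : Plane) : ℝ := (ft (covEps ρ ε) p).re

/-! ### The Fock space

The law `P^ε` of the curl `ω^ε` of the mollified Gaussian free field is Gaussian, with spectral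
density `V̂_ε(p) |p|⁻² p^⊥ ⊗ p^⊥`. An element of the `m`-th homogeneous Wiener chaos of
`L²(P^ε)` is represented by its Fourier kernel, a symmetric function of `m` variables
`p₁, …, p_m` of the plane; the functional `∑ ∫ f_{j₁…j_m}(x) :∏ ω_{j_l}(x_l): dx` has the kernel
`(-i)^m ∑ ∏ (p_k)^⊥_{j_k} f̂_{j₁…j_m}(p)`. This identifies `L²(P^ε)` isometrically with the Fock
space, and all functionals and operators below are given by their action on kernels. -/

/-- Families of Fourier kernels, one for every chaos. -/
abbrev FockVec := (m : ℕ) → (Fin m → Plane) → ℂ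

/-- The measure `m! ∏ V̂_ε(p_i) / |p_i|² dp_1 … dp_m` on the kernels of the `m`-th chaos. -/
def fockMeasure (ρ : Plane → ℝ) (ε : ℝ) (m : ℕ) : Measure (Fin m → Plane) :=
  volume.withDensity fun p => ENNReal.ofReal ((m ! : ℝ) * ∏ i, covHat ρ ε (p i) / ‖p i‖ ^ 2)

/-- The norm `‖ψ‖_ε` of the Fock space; it is `∞` if `ψ` is not square integrable. -/
def fockNorm (ρ : Plane → ℝ) (ε : ℝ) (ψ : FockVec) : ℝ≥0∞ :=
  (∑' m, ∫⁻ p, ‖ψ m p‖ₑ ^ 2 ∂(fockMeasure ρ ε m)) ^ (1 / 2 : ℝ)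

/-- The inner product `⟨ψ, χ⟩_ε` of the Fock space. -/
def fockInner (ρ : Plane → ℝ) (ε : ℝ) (ψ χ : FockVec) : ℂ :=
  ∑' m, ∫ p, conj (ψ m p) * χ m p ∂(fockMeasure ρ ε m)

/-- `ψ` represents an element of the Fock space: its kernels are measurable and symmetric, and
its norm is finite. -/
structure MemFock (ρ : Plane → ℝ) (ε : ℝ) (ψ : FockVec) : Prop where
  aestronglyMeasurable : ∀ m, AEStronglyMeasurable (ψ m) (fockMeasure ρ ε m)
  symmetric : ∀ m, ∀ σ : Equiv.Perm (Fin m), ∀ᵐ p ∂(fockMeasure ρ ε m), ψ m (p ∘ σ) = ψ m p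
  norm_lt_top : fockNorm ρ ε ψ < ∞

/-! ### The generator of the environment process -/

/-- The coupling constant `λ̂ / √(log (1/ε))`. -/
def coupling (lamHat ε : ℝ) : ℝ := lamHat / √(Real.log (1 / ε))

/-- The symbol `(ν²/2) |p₁ + … + p_m|²` of `-𝓛₀`. -/
def symb (ν : ℝ) {m : ℕ} (p : Fin m → Plane) : ℝ := ν ^ 2 / 2 * ‖∑ i, p i‖ ^ 2

/-- The operator `g(-𝓛₀)`, on kernels. -/
def funL0 (ν : ℝ) (g : ℝ → ℝ) (ψ : FockVec) : FockVec :=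
  fun _ p => ((g (symb ν p) : ℝ) : ℂ) * ψ _ p

/-- `𝓛₀`, the symmetric part of the generator. -/
def opL0 (ν : ℝ) (ψ : FockVec) : FockVec := funL0 ν (fun x => -x) ψ

/-- `𝓐₊^ε`, from the `m`-th to the `(m+1)`-st chaos. -/
def creation (lamHat ε : ℝ) {m : ℕ} (ψ : (Fin m → Plane) → ℂ) (p : Fin (m + 1) → Plane) : ℂ :=
  -((1 / ((m : ℝ) + 1) * coupling lamHat ε : ℝ) : ℂ) *
    ∑ i, ((cross (p i) (∑ j, p j) : ℝ) : ℂ) * ψ (fun j => p (i.succAbove j))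

/-- `𝓐₋^ε`, from the `(m+1)`-st to the `m`-th chaos. -/
def annihilation (ρ : Plane → ℝ) (lamHat ε : ℝ) {m : ℕ} (ψ : (Fin (m + 1) → Plane) → ℂ)
    (p : Fin m → Plane) : ℂ :=
  ((((m : ℝ) + 1) * coupling lamHat ε : ℝ) : ℂ) *
    ∫ q : Plane, ((covHat ρ ε q / ‖q‖ ^ 2 : ℝ) : ℂ) *
      ψ (Fin.snoc (α := fun _ => Plane) p q) * ((cross q (∑ k, p k) : ℝ) : ℂ)

/-- `𝓐₊^ε` on the Fock space. -/
def opAplus (lamHat ε : ℝ) (ψ : FockVec) : FockVec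
  | 0 => 0
  | m + 1 => creation lamHat ε (ψ m)

/-- `𝓐₋^ε` on the Fock space. -/
def opAminus (ρ : Plane → ℝ) (lamHat ε : ℝ) (ψ : FockVec) : FockVec :=
  fun m => annihilation ρ lamHat ε (ψ (m + 1))

/-- The generator `𝓛^ε = 𝓛₀ + 𝓐₊^ε + 𝓐₋^ε`. -/
def opL (ρ : Plane → ℝ) (lamHat ν ε : ℝ) (ψ : FockVec) : FockVec :=
  opL0 ν ψ + opAplus lamHat ε ψ + opAminus ρ lamHat ε ψ

/-- The kernel of the `i`-th component of `𝓥^ε(σ) = λ̂ (log (1/ε))^{-1/2} σ(0)`, an element of the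
first chaos. -/
def driftKernel (lamHat ε : ℝ) (i : Fin 2) (p : Plane) : ℂ :=
  ((coupling lamHat ε : ℝ) : ℂ) * (-Complex.I * ((perp p i : ℝ) : ℂ))

/-- `𝓥_i^ε` as an element of the Fock space. -/
def drift (lamHat ε : ℝ) (i : Fin 2) : FockVec
  | 1 => fun p => driftKernel lamHat ε i (p 0)
  | _ => 0

/-! The following facts show that `𝓛₀ = (ν²/2) ∑ D_k²` and that `𝓐₊^ε + 𝓐₋^ε` is `𝓥^ε · D`:
`D_k`, the generator of the translations of the environment, multiplies a kernel by
`-i ∑_j p_{j,k}`, and the product with an element of the first chaos is the sum of the symmetric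
tensor product and of the contraction with it. -/

/-- `D_k` on kernels. -/
def shiftDeriv (k : Fin 2) {m : ℕ} (ψ : (Fin m → Plane) → ℂ) (p : Fin m → Plane) : ℂ :=
  -Complex.I * (((∑ j, p j) k : ℝ) : ℂ) * ψ p

theorem opL0_eq (ν : ℝ) (ψ : FockVec) (m : ℕ) (p : Fin m → Plane) :
    opL0 ν ψ m p = ((ν ^ 2 / 2 : ℝ) : ℂ) * ∑ k, shiftDeriv k (shiftDeriv k (ψ m)) p := by
  have h : ‖∑ i, p i‖ ^ 2 = (∑ i, p i) 0 ^ 2 + (∑ i, p i) 1 ^ 2 := by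
    rw [EuclideanSpace.norm_sq_eq, Fin.sum_univ_two, Real.norm_eq_abs, Real.norm_eq_abs, sq_abs,
      sq_abs]
  simp only [opL0, funL0, symb, shiftDeriv, h, Fin.sum_univ_two]
  push_cast
  linear_combination (-(ν : ℂ) ^ 2 / 2 * (((∑ i, p i) 0 : ℝ) : ℂ) ^ 2 * ψ m p
    - (ν : ℂ) ^ 2 / 2 * (((∑ i, p i) 1 : ℝ) : ℂ) ^ 2 * ψ m p) * Complex.I_sq

theorem creation_eq (lamHat ε : ℝ) {m : ℕ} (ψ : (Fin m → Plane) → ℂ) (p : Fin (m + 1) → Plane) :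
    creation lamHat ε ψ p = ((1 / ((m : ℝ) + 1) : ℝ) : ℂ) *
      ∑ i, ∑ k, driftKernel lamHat ε k (p i) * shiftDeriv k ψ (fun j => p (i.succAbove j)) := by
  have h : ∀ i : Fin (m + 1), ∀ k : Fin 2,
      (∑ j, p j) k = p i k + (∑ j, p (i.succAbove j)) k := by
    intro i k
    rw [Fin.sum_univ_succAbove p i]
    simp
  rw [creation, Finset.mul_sum, Finset.mul_sum]
  refine Finset.sum_congr rfl fun i _ => ?_
  simp only [cross, driftKernel, shiftDeriv, perp, Fin.sum_univ_two, h i, if_true, one_ne_zero, if_false]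
  push_cast
  generalize ψ (fun j => p (i.succAbove j)) = z
  linear_combination (-(1 / ((m : ℂ) + 1)) * (coupling lamHat ε : ℂ) * z *
    ((p i 1 : ℂ) * (((∑ j, p (i.succAbove j)) 0 : ℝ) : ℂ)
      - (p i 0 : ℂ) * (((∑ j, p (i.succAbove j)) 1 : ℝ) : ℂ))) * Complex.I_sq

theorem annihilation_eq (ρ : Plane → ℝ) (lamHat ε : ℝ) {m : ℕ}
    (ψ : (Fin (m + 1) → Plane) → ℂ) (p : Fin m → Plane) :
    annihilation ρ lamHat ε ψ p = (((m : ℝ) + 1 : ℝ) : ℂ) *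
      ∫ q : Plane, ((covHat ρ ε q / ‖q‖ ^ 2 : ℝ) : ℂ) *
        ∑ k, conj (driftKernel lamHat ε k q) *
          shiftDeriv k ψ (Fin.snoc (α := fun _ => Plane) p q) := by
  rw [annihilation, Complex.ofReal_mul, mul_assoc, ← integral_const_mul]
  congr 2
  funext q
  have h : ∀ k : Fin 2, (∑ j, (Fin.snoc (α := fun _ => Plane) p q : Fin (m + 1) → Plane) j) k
      = (∑ j, p j) k + q k := by
    intro k
    rw [Fin.sum_univ_castSucc]
    simp
  simp only [cross, driftKernel, shiftDeriv, perp, Fin.sum_univ_two, h, if_true, one_ne_zero, if_false]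
  simp only [map_mul, map_neg, Complex.conj_ofReal, Complex.conj_I]
  push_cast
  generalize ψ (Fin.snoc (α := fun _ => Plane) p q) = z
  linear_combination ((coupling lamHat ε : ℂ) * ((covHat ρ ε q : ℂ) / (‖q‖ : ℂ) ^ 2) * z *
    ((q 1 : ℂ) * (((∑ j, p j) 0 : ℝ) : ℂ)
      - (q 0 : ℂ) * (((∑ j, p j) 1 : ℝ) : ℂ))) * Complex.I_sq

/-! ### The approximate solutions of the resolvent equation -/

/-- `L^ε(x) = π λ̂² |log ε²|⁻¹ log (1 + 1 / (ε² x))`. -/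
def Leps (lamHat ε x : ℝ) : ℝ :=
  Real.pi * lamHat ^ 2 / |Real.log (ε ^ 2)| * Real.log (1 + 1 / (ε ^ 2 * x))

/-- The functions `G_j`, `j ≥ 1`: `G_1 = 0` and `G_{j+1}(x) = ∫₀ˣ (1 + 4 ν⁻⁴ G_j(y))⁻¹ dy`
(the value at `j = 0` is not used). -/
def Gfun (ν : ℝ) : ℕ → ℝ → ℝ
  | 0 => fun _ => 0
  | 1 => fun _ => 0
  | j + 2 => fun x => ∫ y in (0 : ℝ)..x, 1 / (1 + 4 / ν ^ 4 * Gfun ν (j + 1) y)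

/-- The symbol of `[λ - 𝓛₀ (1 + 4 ν⁻⁴ G_k(L^ε(λ - 𝓛₀)))]⁻¹` as a function of that of `-𝓛₀`. -/
def resSymb (lamHat ν lam ε : ℝ) (k : ℕ) (x : ℝ) : ℝ :=
  1 / (lam + x * (1 + 4 / ν ^ 4 * Gfun ν k (Leps lamHat ε (lam + x))))

/-- The kernel of the component `b_{j,i}^{ε,n}` in the `j`-th chaos, for `1 ≤ j ≤ n`. -/
def bComp (lamHat ν lam ε : ℝ) (n : ℕ) (i : Fin 2) : (j : ℕ) → (Fin j → Plane) → ℂ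
  | 0 => fun _ => 0
  | 1 => fun p => ((resSymb lamHat ν lam ε n (symb ν p) : ℝ) : ℂ) * driftKernel lamHat ε i (p 0)
  | j + 2 => fun p => ((resSymb lamHat ν lam ε (n + 1 - (j + 2)) (symb ν p) : ℝ) : ℂ) *
      creation lamHat ε (bComp lamHat ν lam ε n i (j + 1)) p

/-- `(b^{ε,n})_i = ∑_{j=1}^n b_{j,i}^{ε,n}`. -/
def bApprox (lamHat ν lam ε : ℝ) (n : ℕ) (i : Fin 2) : FockVec :=
  fun j => if j ≤ n then bComp lamHat ν lam ε n i j else 0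

/-- The residual `𝓥_i^ε - (λ - 𝓛^ε) (b^{ε,n})_i`. -/
def residualErr (ρ : Plane → ℝ) (lamHat ν lam ε : ℝ) (n : ℕ) (i : Fin 2) : FockVec :=
  drift lamHat ε i -
    ((lam : ℂ) • bApprox lamHat ν lam ε n i - opL ρ lamHat ν ε (bApprox lamHat ν lam ε n i))

/-- `(λ - 𝓛₀)^{1/2}`. -/
def sqrtRes (ν lam : ℝ) (ψ : FockVec) : FockVec := funL0 ν (fun x => √(lam + x)) ψ

/-- `(λ - 𝓛₀)^{-1/2}`. -/
def invSqrtRes (ν lam : ℝ) (ψ : FockVec) : FockVec := funL0 ν (fun x => 1 / √(lam + x)) ψ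

/-- The effective diffusion coefficient `c(ν)`. -/
def effCoeff (lamHat ν : ℝ) : ℝ :=
  √(4 * (√(2 * Real.pi * lamHat ^ 2 + ν ^ 4 / 4) - ν ^ 2 / 2))

/-- `lim_{n → ∞} lim_{ε → 0} F(ε, n) = L`: the inner limit exists for every `n ≥ 1`, and the inner
limits converge to `L`. -/
def HasIteratedLimit {X : Type} [TopologicalSpace X] (F : ℝ → ℕ → X) (L : X) : Prop :=
  ∃ l : ℕ → X, (∀ n, 1 ≤ n → Tendsto (fun ε => F ε n) (𝓝[>] 0) (𝓝 (l n))) ∧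
    Tendsto l atTop (𝓝 L)

end CurlGFF

end

open CurlGFF

noncomputable section

namespace CurlGFF

section

/-! ### The spectral density -/

/-! Everything rests on the operators `𝓐₋ S 𝓐₊`, where `S` is a function of `-𝓛₀` equal to
`s(L^ε(λ+x))/(λ+x)` up to order `-2` (`IsSymbol`). Contracting the created momentum with itself
gives a multiplication operator in the total momentum `P`, namely `-κ² ∫ V̂_ε(q)|q|⁻² (q×P)² S dq`.
The angular average contributes `|P|²/2`, and `dL^ε` is proportional to `dy/(y(1+ε²y))`, so in the
variable `L^ε` the integral becomes `x (4/ν⁴) ∫₀^{L^ε(λ+x)} s` up to `O(κ²)`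
(`integral_radial_symbol`, `diag_estimate`). Contractions that exchange the new momentum for an old
one carry no logarithm: a Schur test with weight `√|q|` bounds them uniformly in `ε`
(`lintegral_exchange_sq_le`), and the prefactor `κ²` makes them vanish. So `-𝓐₋ S 𝓐₊` is its
limiting symbol up to `O(κ²)`, from the energy space to its dual (`lintegral_defect_le`).

For `s = 1/γ_k` with `γ_k = 1 + (4/ν⁴) G_k` the primitive is `G_{k+1}`, which explains the choice of
resolvents. The residual is then such a defect in the chaoses below `n`, zero in the `n`-th because
`G_1 = 0`, and `𝓐₊ b_n` in the last one (`residualErr_of_lt`, `residualErr_last`,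
`residualErr_top`).

Energies are tested against `(λ+x) h(L^ε(λ+x))` for all bounded Lipschitz `h`. The drift yields
`(ν²/2) h(πλ̂²)`, and each further resolvent and creation replaces `h` by the primitive `(4/ν⁴) ∫
h/γ_k²` (`HasSourceLimit.resolvent`, `HasEnergyLimit.creation`). Iterated primitives decay
factorially, which kills `𝓐₊ b_n` as `n → ∞`. The sum `F_n` over the chaoses obeys `F_{n+1} = 1 +
(4/ν⁴) ∫ F_n/γ_{n+1}²`, while `γ_{k+1} = 1 + (4/ν⁴) ∫ 1/γ_k`; both tend to `γ = √(1+8x/ν⁴)`, the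
solution of `γ' = (4/ν⁴)/γ` with `γ(0) = 1` (`tendsto_orderSum`), and `(ν²/2)(γ(πλ̂²)-1) = c(ν)²/4`.

The plain norm vanishes because a squared resolvent has order `-2` and produces no logarithm. The
mixed inner product is exactly zero: the two components have opposite parity under a reflection
(`bComp_flip`). -/

/-- The profile `ρ̂(p)²` of `V̂_ε`. -/
def specProfile (ρ : Plane → ℝ) (p : Plane) : ℝ := (ft ρ p).re ^ 2

theorem norm_exp_neg_I_mul (t : ℝ) : ‖Complex.exp (-(Complex.I * (t : ℂ)))‖ = 1 := by
  rw [show -(Complex.I * (t : ℂ)) = ((-t : ℝ) : ℂ) * Complex.I by push_cast; ring]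
  exact Complex.norm_exp_ofReal_mul_I _

theorem integrable_mul_character {f : Plane → ℝ} (hf : Integrable f) (p : Plane) :
    Integrable fun x => (f x : ℂ) * Complex.exp (-(Complex.I * ((inner ℝ p x : ℝ) : ℂ))) := by
  refine (hf.ofReal (𝕜 := ℂ)).mul_bdd (c := 1) ?_ ?_
  · exact (by fun_prop : Continuous fun x : Plane =>
      Complex.exp (-(Complex.I * ((inner ℝ p x : ℝ) : ℂ)))).aestronglyMeasurable
  · exact Eventually.of_forall fun x => (norm_exp_neg_I_mul _).le

theorem ft_rhoEps (ρ : Plane → ℝ) {ε : ℝ} (hε : 0 < ε) (p : Plane) :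
    ft (rhoEps ρ ε) p = ft ρ (ε • p) := by
  have h := Measure.integral_comp_smul (volume : Measure Plane)
    (fun x => (ρ x : ℂ) * Complex.exp (-(Complex.I * ((inner ℝ (ε • p) x : ℝ) : ℂ)))) ε⁻¹
  have hd : Module.finrank ℝ Plane = 2 := by simp
  rw [hd, abs_of_pos (by positivity)] at h
  have h2 : ft ρ (ε • p) = ((ε ^ 2)⁻¹ : ℝ) • ∫ x : Plane, (ρ (ε⁻¹ • x) : ℂ) *
      Complex.exp (-(Complex.I * ((inner ℝ (ε • p) (ε⁻¹ • x) : ℝ) : ℂ))) := by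
    rw [h, smul_smul, ft]
    rw [show (ε ^ 2)⁻¹ * ((ε⁻¹ ^ 2)⁻¹) = 1 by field_simp, one_smul]
  rw [h2, ← integral_smul, ft]
  refine integral_congr_ae (Eventually.of_forall fun x => ?_)
  simp only [rhoEps, inner_smul_left, inner_smul_right, Complex.real_smul]
  have : (starRingEnd ℝ) ε * (ε⁻¹ * inner ℝ p x) = inner ℝ p x := by
    simp [hε.ne']
  rw [mul_left_comm] at this
  rw [mul_left_comm, this]
  push_cast; ring

theorem integrable_rhoEps {ρ : Plane → ℝ} (hρ : Integrable ρ) {ε : ℝ} (hε : 0 < ε) :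
    Integrable (rhoEps ρ ε) :=
  (hρ.comp_smul (R := ε⁻¹) (by positivity)).const_mul _

/-- Characters are multiplicative, so multiplying by one commutes with convolution, and the integral
of a convolution is the product of the integrals. -/
theorem ft_covEps {ρ : Plane → ℝ} (hρ : Integrable ρ) {ε : ℝ} (hε : 0 < ε) (p : Plane) :
    ft (covEps ρ ε) p = ft ρ (ε • p) ^ 2 := by
  have hi := integrable_mul_character (integrable_rhoEps hρ hε) p
  have h := integral_convolution (ContinuousLinearMap.mul ℝ ℂ) (μ := volume) (ν := volume) hi hi
  rw [ContinuousLinearMap.mul_apply'] at h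
  have h' : ft (rhoEps ρ ε) p * ft (rhoEps ρ ε) p = ft ρ (ε • p) ^ 2 := by
    rw [ft_rhoEps ρ hε, sq]
  rw [← h', ft, ft, ← h]
  refine integral_congr_ae (Eventually.of_forall fun x => ?_)
  simp only [convolution_def, ContinuousLinearMap.mul_apply', covEps]
  rw [← integral_complex_ofReal, ← integral_mul_const]
  refine integral_congr_ae (Eventually.of_forall fun t => ?_)
  simp only [inner_sub_right]
  push_cast
  rw [show -(Complex.I * ((inner ℝ p x : ℝ) : ℂ)) = -(Complex.I * ((inner ℝ p t : ℝ) : ℂ)) +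
    -(Complex.I * (((inner ℝ p x : ℝ) : ℂ) - ((inner ℝ p t : ℝ) : ℂ))) by ring, Complex.exp_add]
  ring

theorem ft_comp_isometry {ρ : Plane → ℝ} (S : Plane ≃ₗᵢ[ℝ] Plane) (hS : ∀ x, ρ (S x) = ρ x)
    (p : Plane) : ft ρ (S p) = ft ρ p := by
  rw [ft, ← S.measurePreserving.integral_comp S.toHomeomorph.measurableEmbedding]
  simp only [ft, hS, LinearIsometryEquiv.inner_map_map]

theorem ft_im_eq_zero {ρ : Plane → ℝ} (hS : ∀ x, ρ (-x) = ρ x) (p : Plane) :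
    (ft ρ p).im = 0 := by
  rw [← Complex.conj_eq_iff_im, ft, ← integral_conj]
  rw [← integral_neg_eq_self]
  refine integral_congr_ae (Eventually.of_forall fun x => ?_)
  simp [hS, ← Complex.exp_conj]

/-- What is used of the profile of the spectral density. -/
structure IsProfile (v : Plane → ℝ) (C : ℝ) : Prop where
  measurable : Measurable v
  nonneg : ∀ p, 0 ≤ v p
  le : ∀ p, v p ≤ C
  near_zero : ∀ p, |v p - 1| ≤ C * ‖p‖
  support : ∀ p, 1 < ‖p‖ → v p = 0

variable {ρ : 𝓢(Plane, ℝ)}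

theorem IsMollifier.comp_isometry (hρ : IsMollifier ρ) (S : Plane ≃ₗᵢ[ℝ] Plane) (x : Plane) :
    ρ (S x) = ρ x := by
  obtain ⟨γ, hγ⟩ := hρ.radial
  simp [hγ]

theorem IsMollifier.specProfile_comp_isometry (hρ : IsMollifier ρ) (S : Plane ≃ₗᵢ[ℝ] Plane)
    (p : Plane) : specProfile ρ (S p) = specProfile ρ p := by
  rw [specProfile, specProfile, ft_comp_isometry S (hρ.comp_isometry S)]

theorem IsMollifier.covHat_eq (hρ : IsMollifier ρ) {ε : ℝ} (hε : 0 < ε) (p : Plane) :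
    covHat ρ ε p = specProfile ρ (ε • p) := by
  have him := ft_im_eq_zero (ρ := ρ) (fun x => hρ.comp_isometry (LinearIsometryEquiv.neg ℝ) x)
    (ε • p)
  rw [covHat, ft_covEps ρ.integrable hε, specProfile, sq, sq, Complex.mul_re, him]
  ring

theorem norm_ft_le {f : Plane → ℝ} (p : Plane) : ‖ft f p‖ ≤ ∫ x, |f x| := by
  refine (norm_integral_le_integral_norm _).trans_eq ?_
  simp [norm_exp_neg_I_mul]

theorem norm_ft_sub_le (ρ : 𝓢(Plane, ℝ)) (p : Plane) :
    ‖ft ρ p - ft ρ 0‖ ≤ (∫ x, ‖x‖ * |ρ x|) * ‖p‖ := by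
  have hint : Integrable fun x => ‖x‖ * |ρ x| := by
    simpa using ρ.integrable_pow_mul volume 1
  rw [ft, ft, ← integral_sub (integrable_mul_character ρ.integrable p)
    (integrable_mul_character ρ.integrable 0), ← integral_mul_const]
  refine norm_integral_le_of_norm_le (hint.mul_const _) (Eventually.of_forall fun x => ?_)
  rw [← mul_sub, norm_mul, Complex.norm_real, Real.norm_eq_abs, inner_zero_left,
    Complex.ofReal_zero, mul_zero, neg_zero, Complex.exp_zero]
  have h1 : ‖Complex.exp (-(Complex.I * ((inner ℝ p x : ℝ) : ℂ))) - 1‖ ≤ ‖p‖ * ‖x‖ := by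
    rw [show -(Complex.I * ((inner ℝ p x : ℝ) : ℂ)) = Complex.I * ((-inner ℝ p x : ℝ) : ℂ) by
      push_cast; ring]
    refine (Real.norm_exp_I_mul_ofReal_sub_one_le).trans ?_
    rw [norm_neg]
    exact norm_inner_le_norm p x
  calc |ρ x| * _ ≤ |ρ x| * (‖p‖ * ‖x‖) := by gcongr
    _ = _ := by ring

theorem continuous_ft (ρ : 𝓢(Plane, ℝ)) : Continuous (ft ρ) := by
  refine continuous_of_dominated (bound := fun x => |ρ x|) ?_ ?_ ?_ ?_
  · exact fun p => (integrable_mul_character ρ.integrable p).aestronglyMeasurable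
  · exact fun p => Eventually.of_forall fun x => by simp [norm_exp_neg_I_mul]
  · exact ρ.integrable.norm
  · exact Eventually.of_forall fun x => by fun_prop

theorem IsMollifier.isProfile (hρ : IsMollifier ρ) : ∃ C, IsProfile (specProfile ρ) C := by
  set A := ∫ x, |ρ x|
  set B := ∫ x, ‖x‖ * |ρ x|
  have hA : 0 ≤ A := integral_nonneg fun _ => abs_nonneg _
  have hB : 0 ≤ B := integral_nonneg fun _ => by positivity
  have h0 : ft ρ 0 = 1 := by
    simp only [ft, inner_zero_left, Complex.ofReal_zero, mul_zero, neg_zero, Complex.exp_zero,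
      mul_one]
    rw [integral_complex_ofReal, hρ.integral_eq_one, Complex.ofReal_one]
  have hle : ∀ p, |(ft ρ p).re| ≤ A := fun p => (Complex.abs_re_le_norm _).trans (norm_ft_le p)
  -- `A²` bounds `ρ̂²`, and `B (A + 1)` controls `ρ̂² - 1 = (ρ̂ - 1)(ρ̂ + 1)` near the origin; the
  -- sum serves both purposes.
  refine ⟨A ^ 2 + B * (A + 1), ?_, fun p => sq_nonneg _, fun p => ?_, fun p => ?_, fun p hp => ?_⟩
  · exact (Complex.continuous_re.comp (continuous_ft ρ)).measurable.pow_const 2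
  · have := hle p
    have h2 : specProfile ρ p ≤ A ^ 2 := by
      rw [specProfile, ← sq_abs]; gcongr
    have : 0 ≤ B * (A + 1) := by positivity
    linarith
  · have h1 : |(ft ρ p).re - 1| ≤ B * ‖p‖ := by
      refine le_trans ?_ (norm_ft_sub_le ρ p)
      rw [h0]
      simpa using Complex.abs_re_le_norm (ft ρ p - 1)
    have h2 : |(ft ρ p).re + 1| ≤ A + 1 := (abs_add_le _ _).trans (by simpa using hle p)
    have : specProfile ρ p - 1 = ((ft ρ p).re - 1) * ((ft ρ p).re + 1) := by
      rw [specProfile]; ring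
    rw [this, abs_mul]
    calc _ ≤ B * ‖p‖ * (A + 1) := by gcongr
      _ ≤ (A ^ 2 + B * (A + 1)) * ‖p‖ := by nlinarith [norm_nonneg p, sq_nonneg A, mul_nonneg (sq_nonneg A) (norm_nonneg p)]
  · have : ft ρ p = 0 := by
      by_contra h
      have := hρ.support_ft (Function.mem_support.2 h)
      simp at this
      linarith
    simp [specProfile, this]

end

/-! ### Elementary geometry of the plane -/

theorem norm_sq_eq (p : Plane) : ‖p‖ ^ 2 = p 0 ^ 2 + p 1 ^ 2 := by
  rw [EuclideanSpace.norm_sq_eq, Fin.sum_univ_two, Real.norm_eq_abs, Real.norm_eq_abs, sq_abs,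
    sq_abs]

theorem inner_eq (p q : Plane) : inner ℝ p q = p 0 * q 0 + p 1 * q 1 := by
  simp [PiLp.inner_apply, Fin.sum_univ_two, mul_comm]

theorem cross_sq_add_inner_sq (p q : Plane) :
    cross p q ^ 2 + inner ℝ p q ^ 2 = ‖p‖ ^ 2 * ‖q‖ ^ 2 := by
  rw [norm_sq_eq, norm_sq_eq, inner_eq, cross]; ring

theorem cross_sq_le (p q : Plane) : cross p q ^ 2 ≤ ‖p‖ ^ 2 * ‖q‖ ^ 2 := by
  rw [← cross_sq_add_inner_sq]; linarith [sq_nonneg (inner ℝ p q)]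

theorem abs_cross_le (p q : Plane) : |cross p q| ≤ ‖p‖ * ‖q‖ := by
  refine abs_le_of_sq_le_sq ?_ (by positivity)
  rw [mul_pow]; exact cross_sq_le p q

theorem cross_add_left (p q r : Plane) : cross (p + q) r = cross p r + cross q r := by
  simp [cross]; ring

theorem cross_add_right (p q r : Plane) : cross p (q + r) = cross p q + cross p r := by
  simp [cross]; ring

theorem cross_self (p : Plane) : cross p p = 0 := by simp [cross]; ring

theorem cross_smul_right (t : ℝ) (p q : Plane) : cross p (t • q) = t * cross p q := by
  simp [cross]; ring

theorem cross_smul_left (t : ℝ) (p q : Plane) : cross (t • p) q = t * cross p q := by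
  simp [cross]; ring

theorem cross_zero_right (p : Plane) : cross p 0 = 0 := by simp [cross]

theorem cross_zero_left (p : Plane) : cross 0 p = 0 := by simp [cross]

@[fun_prop]
theorem Continuous.cross {X : Type*} [TopologicalSpace X] {f g : X → Plane} (hf : Continuous f)
    (hg : Continuous g) : Continuous fun x => CurlGFF.cross (f x) (g x) := by
  unfold CurlGFF.cross
  fun_prop

@[fun_prop]
theorem Measurable.cross {X : Type*} [MeasurableSpace X] {f g : X → Plane} (hf : Measurable f)
    (hg : Measurable g) : Measurable fun x => CurlGFF.cross (f x) (g x) := by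
  have h : Continuous fun z : Plane × Plane => CurlGFF.cross z.1 z.2 := by fun_prop
  exact h.measurable.comp (hf.prodMk hg)

/-- The isometry of the plane given by a linear map. -/
def planeIsometry (f : Plane →ₗ[ℝ] Plane) (hf : ∀ p, ‖f p‖ = ‖p‖) : Plane ≃ₗᵢ[ℝ] Plane :=
  LinearIsometry.toLinearIsometryEquiv ⟨f, hf⟩ rfl

/-- The rotation by a right angle. -/
def quarterTurn : Plane ≃ₗᵢ[ℝ] Plane :=
  planeIsometry
    { toFun := fun p => !₂[p 1, -p 0]
      map_add' := fun p q => by ext i; fin_cases i <;> simp [add_comm]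
      map_smul' := fun c p => by ext i; fin_cases i <;> simp }
    (fun p => by
      rw [← sq_eq_sq₀ (norm_nonneg _) (norm_nonneg _), norm_sq_eq, norm_sq_eq]
      simp [add_comm])

theorem cross_quarterTurn (p q : Plane) : cross (quarterTurn p) q = -inner ℝ p q := by
  rw [inner_eq]
  simp [cross, quarterTurn, planeIsometry]; ring

/-- The reflection of the first coordinate. -/
def flip : Plane ≃ₗᵢ[ℝ] Plane :=
  planeIsometry
    { toFun := fun p => !₂[-p 0, p 1]
      map_add' := fun p q => by ext i; fin_cases i <;> simp [add_comm]
      map_smul' := fun c p => by ext i; fin_cases i <;> simp }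
    (fun p => by
      rw [← sq_eq_sq₀ (norm_nonneg _) (norm_nonneg _), norm_sq_eq, norm_sq_eq]
      simp)

theorem cross_flip (p q : Plane) : cross (flip p) (flip q) = -cross p q := by
  simp [cross, flip, planeIsometry]; ring

theorem perp_flip_zero (p : Plane) : perp (flip p) 0 = perp p 0 := by
  simp [perp, flip, planeIsometry]

theorem perp_flip_one (p : Plane) : perp (flip p) 1 = -perp p 1 := by
  simp [perp, flip, planeIsometry]

/-! ### Radial integrals -/

theorem integrable_radial_iff (f : ℝ → ℝ) :
    Integrable (fun p : Plane => f ‖p‖) ↔ IntegrableOn (fun r => r * f r) (Set.Ioi 0) := by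
  have hd : Module.finrank ℝ Plane = 2 := by simp
  have := integrable_fun_norm_addHaar (volume : Measure Plane) (f := f)
  rw [hd] at this
  simpa using this

theorem integral_radial (f : ℝ → ℝ) :
    ∫ p : Plane, f ‖p‖ = 2 * Real.pi * ∫ r in Set.Ioi (0 : ℝ), r * f r := by
  have hd : Module.finrank ℝ Plane = 2 := by simp
  have := integral_fun_norm_addHaar (volume : Measure Plane) f
  rw [hd] at this
  have hb : (volume : Measure Plane).real (Metric.ball 0 1) = Real.pi := by
    rw [measureReal_def, EuclideanSpace.volume_ball_fin_two]
    simp [Real.pi_nonneg]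
  rw [this, hb]
  simp [mul_assoc]

/-- An integrable function with a simple pole at the origin. -/
def poleBump (p : Plane) : ℝ := 1 / (‖p‖ * (1 + ‖p‖ ^ 2))

theorem poleBump_nonneg (p : Plane) : 0 ≤ poleBump p := by unfold poleBump; positivity

theorem integrable_poleBump : Integrable poleBump := by
  refine (integrable_radial_iff fun r => 1 / (r * (1 + r ^ 2))).2 ?_
  refine (integrable_inv_one_add_sq.integrableOn (s := Set.Ioi 0)).congr_fun ?_ measurableSet_Ioi
  intro r hr
  have : r ≠ 0 := (Set.mem_Ioi.1 hr).ne'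
  simp only
  field_simp

theorem integrable_inv_sq_affine {a c : ℝ} (ha : 0 < a) (hc : 0 < c) :
    Integrable fun p : Plane => 1 / (a + c * ‖p‖ ^ 2) ^ 2 := by
  refine (integrable_radial_iff fun r => 1 / (a + c * r ^ 2) ^ 2).2 ?_
  have hm : 0 < min a c := lt_min ha hc
  refine Integrable.mono' ((integrable_inv_one_add_sq.integrableOn (s := Set.Ioi 0)).const_mul
    ((min a c ^ 2)⁻¹)) ?_ ?_
  · refine Measurable.aestronglyMeasurable (by fun_prop)
  · refine (ae_restrict_iff' measurableSet_Ioi).2 (Eventually.of_forall fun r hr => ?_)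
    have hr : 0 < r := hr
    have h1 : min a c * (1 + r ^ 2) ≤ a + c * r ^ 2 := by
      nlinarith [min_le_left a c, min_le_right a c, sq_nonneg r]
    rw [Real.norm_of_nonneg (by positivity), ← mul_inv, ← div_eq_mul_one_div, ← one_div]
    rw [div_le_div_iff₀ (by positivity) (by positivity)]
    calc r * (min a c ^ 2 * (1 + r ^ 2)) ≤ (1 + r ^ 2) * (min a c ^ 2 * (1 + r ^ 2)) := by
          gcongr; nlinarith [sq_nonneg (r - 1)]
      _ = (min a c * (1 + r ^ 2)) ^ 2 := by ring
      _ ≤ (a + c * r ^ 2) ^ 2 := by gcongr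
      _ = _ := by ring

/-- An integrable function with a pole of order `3/2` at the origin. -/
def strongPole (p : Plane) : ℝ := 1 / (‖p‖ * √‖p‖ * (1 + ‖p‖))

theorem strongPole_nonneg (p : Plane) : 0 ≤ strongPole p := by unfold strongPole; positivity

theorem integrable_strongPole : Integrable strongPole := by
  refine (integrable_radial_iff fun r => 1 / (r * √r * (1 + r))).2 ?_
  -- In polar coordinates the integrand is `1/(√r (1+r))`, the derivative of `2 arctan √r`.
  have h : IntegrableOn (fun r => 1 / (1 + √r ^ 2) * (1 / (2 * √r))) (Set.Ioi 0) := by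
    refine integrableOn_Ioi_deriv_of_nonneg (g := fun r => Real.arctan √r) (l := Real.pi / 2)
      ?_ ?_ ?_ ?_
    · exact (Real.continuous_arctan.comp Real.continuous_sqrt).continuousWithinAt
    · exact fun r hr => (Real.hasDerivAt_sqrt (Set.mem_Ioi.1 hr).ne').arctan
    · intro r _; positivity
    · exact (Real.tendsto_arctan_atTop.mono_right nhdsWithin_le_nhds).comp Real.tendsto_sqrt_atTop
  refine IntegrableOn.congr_fun (h.const_mul 2) ?_ measurableSet_Ioi
  intro r hr
  have hr : 0 < r := hr
  simp only
  rw [Real.sq_sqrt hr.le]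
  field_simp

theorem integral_comp_smul_plane (f : Plane → ℝ) {t : ℝ} (ht : 0 < t) :
    ∫ q, t ^ 2 * f (t • q) = ∫ q, f q := by
  have hd : Module.finrank ℝ Plane = 2 := by simp
  rw [integral_const_mul, Measure.integral_comp_smul, hd, abs_of_pos (by positivity), smul_eq_mul]
  field_simp

theorem integrable_comp_smul_plane {f : Plane → ℝ} (hf : Integrable f) {t : ℝ} (ht : 0 < t) :
    Integrable fun q => t ^ 2 * f (t • q) :=
  (hf.comp_smul ht.ne').const_mul _

theorem poleBump_scaled {t : ℝ} (ht : 0 < t) (q : Plane) :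
    t⁻¹ ^ 2 * poleBump (t⁻¹ • q) = t / (‖q‖ * (t ^ 2 + ‖q‖ ^ 2)) := by
  rcases eq_or_ne q 0 with rfl | hq
  · simp [poleBump]
  have : 0 < ‖q‖ := norm_pos_iff.2 hq
  rw [poleBump, norm_smul, Real.norm_of_nonneg (by positivity)]
  field_simp

theorem integrable_scaled_poleBump {t : ℝ} (ht : 0 ≤ t) :
    Integrable fun q : Plane => t / (‖q‖ * (t ^ 2 + ‖q‖ ^ 2)) := by
  rcases ht.eq_or_lt with rfl | ht
  · simp
  simp_rw [← poleBump_scaled ht]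
  exact integrable_comp_smul_plane integrable_poleBump (inv_pos.2 ht)

/-- The integrand is the mass-preserving dilation of `poleBump` by `t`, so the bound is uniform in
`t`, which will be the modulus of the total momentum. -/
theorem integral_scaled_poleBump_le {t : ℝ} (ht : 0 ≤ t) :
    ∫ q : Plane, t / (‖q‖ * (t ^ 2 + ‖q‖ ^ 2)) ≤ ∫ q, poleBump q := by
  rcases ht.eq_or_lt with rfl | ht
  · simpa using integral_nonneg fun q => poleBump_nonneg q
  simp_rw [← poleBump_scaled ht]
  rw [integral_comp_smul_plane _ (inv_pos.2 ht)]

/-- A quarter turn exchanges `(q×e)²` with `(q·e)²`, and the two add up to `|q|²`; against a radial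
weight each therefore accounts for one half. -/
theorem integral_cross_sq_mul_radial (g : ℝ → ℝ) {e : Plane} (he : ‖e‖ = 1)
    (hg : Integrable fun q : Plane => ‖q‖ ^ 2 * g ‖q‖) (hgm : Measurable g) :
    ∫ q, cross q e ^ 2 * g ‖q‖ = 1 / 2 * ∫ q : Plane, ‖q‖ ^ 2 * g ‖q‖ := by
  have hi : ∀ u : Plane → ℝ, Continuous u → (∀ q, u q ^ 2 ≤ ‖q‖ ^ 2) →
      Integrable fun q : Plane => u q ^ 2 * g ‖q‖ := by
    intro u hu hle
    refine hg.mono (by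
      have := hu.measurable
      exact Measurable.aestronglyMeasurable (by fun_prop)) (Eventually.of_forall fun q => ?_)
    rw [norm_mul, norm_mul, Real.norm_of_nonneg (sq_nonneg _), Real.norm_of_nonneg (sq_nonneg _)]
    exact mul_le_mul_of_nonneg_right (hle q) (norm_nonneg _)
  have h1 : ∫ q, cross q e ^ 2 * g ‖q‖ = ∫ q : Plane, inner ℝ q e ^ 2 * g ‖q‖ := by
    rw [← quarterTurn.measurePreserving.integral_comp
      quarterTurn.toHomeomorph.measurableEmbedding]
    simp [cross_quarterTurn]
  have hid : ∀ q, cross q e ^ 2 + inner ℝ q e ^ 2 = ‖q‖ ^ 2 := fun q => by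
    rw [cross_sq_add_inner_sq, he]; ring
  have h2 : (∫ q, cross q e ^ 2 * g ‖q‖) + ∫ q : Plane, inner ℝ q e ^ 2 * g ‖q‖ =
      ∫ q : Plane, ‖q‖ ^ 2 * g ‖q‖ := by
    rw [← integral_add]
    · simp_rw [← add_mul, hid]
    · exact hi _ (by fun_prop) fun q => by rw [← hid q]; linarith [sq_nonneg (inner ℝ q e)]
    · exact hi _ (by fun_prop) fun q => by rw [← hid q]; linarith [sq_nonneg (cross q e)]
  linarith

/-! ### Symbols -/

/-- Bounded Lipschitz functions, with a common bound. -/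
structure IsLipBdd (s : ℝ → ℝ) (B : ℝ) : Prop where
  bound : ∀ y, |s y| ≤ B
  lip : ∀ y z, |s y - s z| ≤ B * |y - z|

theorem IsLipBdd.nonneg {s : ℝ → ℝ} {B : ℝ} (h : IsLipBdd s B) : 0 ≤ B :=
  (abs_nonneg _).trans (h.bound 0)

theorem IsLipBdd.continuous {s : ℝ → ℝ} {B : ℝ} (h : IsLipBdd s B) : Continuous s := by
  have : LipschitzWith (Real.toNNReal B) s := LipschitzWith.of_dist_le_mul fun x y => by
    rw [Real.dist_eq, Real.dist_eq, Real.coe_toNNReal _ h.nonneg]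
    exact h.lip x y
  exact this.continuous

/-- The prefactor of `L^ε`. -/
def logScale (lamHat ε : ℝ) : ℝ := Real.pi * lamHat ^ 2 / |Real.log (ε ^ 2)|

theorem Leps_eq (lamHat ε x : ℝ) :
    Leps lamHat ε x = logScale lamHat ε * Real.log (1 + 1 / (ε ^ 2 * x)) := rfl

theorem logScale_nonneg (lamHat ε : ℝ) : 0 ≤ logScale lamHat ε := by
  unfold logScale; positivity

theorem Leps_nonneg (lamHat : ℝ) {ε x : ℝ} (hx : 0 ≤ x) : 0 ≤ Leps lamHat ε x := by
  rw [Leps_eq]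
  refine mul_nonneg (logScale_nonneg _ _) (Real.log_nonneg ?_)
  have : 0 ≤ 1 / (ε ^ 2 * x) := by positivity
  linarith

theorem Leps_anti (lamHat : ℝ) {ε x y : ℝ} (hε : 0 < ε) (hx : 0 < x) (hxy : x ≤ y) :
    Leps lamHat ε y ≤ Leps lamHat ε x := by
  rw [Leps_eq, Leps_eq]
  refine mul_le_mul_of_nonneg_left ?_ (logScale_nonneg _ _)
  have hy := hx.trans_le hxy
  refine Real.log_le_log (by positivity) ?_
  gcongr

/-- By `log u ≤ u - 1`, the variation of `L^ε` is controlled by the relative variation of its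
argument, uniformly in `ε` apart from the prefactor. -/
theorem Leps_sub_le (lamHat : ℝ) {ε x y : ℝ} (hε : 0 < ε) (hx : 0 < x) (hxy : x ≤ y) :
    Leps lamHat ε x - Leps lamHat ε y ≤ logScale lamHat ε * ((y - x) / x) := by
  rw [Leps_eq, Leps_eq, ← mul_sub]
  refine mul_le_mul_of_nonneg_left ?_ (logScale_nonneg _ _)
  have hy := hx.trans_le hxy
  rw [← Real.log_div (by positivity) (by positivity)]
  refine (Real.log_le_sub_one_of_pos (by positivity)).trans ?_
  rw [div_sub_one (by positivity), div_le_div_iff₀ (by positivity) hx]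
  have : (1 + 1 / (ε ^ 2 * x) - (1 + 1 / (ε ^ 2 * y))) * x = (y - x) * (1 / (ε ^ 2 * y)) := by
    field_simp; ring
  rw [this]
  gcongr
  linarith

theorem hasDerivAt_Leps (lamHat : ℝ) {ε x : ℝ} (hε : 0 < ε) (hx : 0 < x) :
    HasDerivAt (Leps lamHat ε) (-(logScale lamHat ε / (x * (1 + ε ^ 2 * x)))) x := by
  have h1 : HasDerivAt (fun y => 1 + 1 / (ε ^ 2 * y)) (-(1 / (ε ^ 2 * x ^ 2))) x := by
    have := ((hasDerivAt_inv hx.ne').const_mul ((ε ^ 2)⁻¹)).const_add 1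
    refine (this.congr_deriv (by field_simp)).congr_of_eventuallyEq
      (Eventually.of_forall fun y => ?_)
    simp [mul_comm]
  have h2 := (h1.log (by positivity)).const_mul (logScale lamHat ε)
  refine (h2.congr_deriv ?_).congr_of_eventuallyEq (Eventually.of_forall fun y => Leps_eq _ _ _)
  field_simp
  ring

theorem tendsto_Leps_atTop (lamHat : ℝ) {ε : ℝ} (hε : 0 < ε) :
    Tendsto (Leps lamHat ε) atTop (𝓝 0) := by
  have h1 : Tendsto (fun y : ℝ => 1 + 1 / (ε ^ 2 * y)) atTop (𝓝 (1 + 0)) :=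
    ((tendsto_const_nhds (x := (1 : ℝ))).div_atTop
      (tendsto_id.const_mul_atTop (by positivity : 0 < ε ^ 2))).const_add 1
  have h2 := (h1.log (by norm_num)).const_mul (logScale lamHat ε)
  rw [add_zero, Real.log_one, mul_zero] at h2
  exact h2

theorem measurable_Leps (lamHat ε : ℝ) : Measurable (Leps lamHat ε) := by
  unfold Leps
  fun_prop

/-- This is the role of the restriction `ε ≤ 1/2` in the estimates: it gives the uniform bound
`logScale ≤ πλ̂²`. -/
theorem one_le_abs_log_sq {ε : ℝ} (hε : 0 < ε) (hε2 : ε ≤ 1 / 2) : 1 ≤ |Real.log (ε ^ 2)| := by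
  have h1 : Real.log (ε ^ 2) ≤ -1 := by
    have h2 : Real.log (ε ^ 2) ≤ Real.log ((1 / 2) ^ 2) :=
      Real.log_le_log (by positivity) (by gcongr)
    have h3 : Real.log ((1 / 2 : ℝ) ^ 2) = -(2 * Real.log 2) := by
      rw [Real.log_pow, one_div, Real.log_inv]; push_cast; ring
    have := Real.log_two_gt_d9
    linarith
  rw [abs_of_nonpos (by linarith)]
  linarith

theorem coupling_sq {lamHat ε : ℝ} (hε : 0 < ε) (hε1 : ε < 1) :
    coupling lamHat ε ^ 2 = 2 / Real.pi * logScale lamHat ε := by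
  have h : Real.log ε < 0 := Real.log_neg hε hε1
  rw [coupling, logScale, div_pow, Real.sq_sqrt, Real.log_pow, one_div, Real.log_inv, abs_of_neg]
  · have := Real.pi_ne_zero
    push_cast
    field_simp
  · push_cast; linarith
  · rw [one_div, Real.log_inv]; linarith

/-- The symbol `S` is close to `s(L^ε(λ + x)) / (λ + x)`. -/
structure IsSymbol (lamHat lam ε : ℝ) (S s : ℝ → ℝ) (B : ℝ) : Prop where
  measurable : Measurable S
  lipBdd : IsLipBdd s B
  close : ∀ x, 0 ≤ x → |S x - s (Leps lamHat ε (lam + x)) / (lam + x)| ≤ B / (lam + x) ^ 2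

theorem IsSymbol.abs_le {lamHat lam ε : ℝ} {S s : ℝ → ℝ} {B : ℝ} (h : IsSymbol lamHat lam ε S s B)
    (hlam : 0 < lam) {x : ℝ} (hx : 0 ≤ x) : |S x| ≤ B * (1 + 1 / lam) / (lam + x) := by
  have hB := h.lipBdd.nonneg
  have h1 := h.close x hx
  have h2 : |s (Leps lamHat ε (lam + x)) / (lam + x)| ≤ B / (lam + x) := by
    rw [abs_div, abs_of_pos (by positivity : 0 < lam + x)]
    gcongr
    exact h.lipBdd.bound _
  have h3 : B / (lam + x) ^ 2 ≤ B / (lam + x) * (1 / lam) := by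
    rw [div_mul_div_comm, mul_one, sq]
    gcongr
    linarith
  have h4 := abs_sub_abs_le_abs_sub (S x) (s (Leps lamHat ε (lam + x)) / (lam + x))
  calc |S x| ≤ B / (lam + x) + B / (lam + x) * (1 / lam) := by linarith
    _ = _ := by ring

/-- Both `1/y` and, by `Leps_sub_le`, `s(L^ε(y))` react only to the relative change of `y`; the
logarithm costs no more than the factor `1 + K`. -/
theorem abs_symbol_sub_le {lamHat ε : ℝ} {s : ℝ → ℝ} {B : ℝ} (h : IsLipBdd s B) (hε : 0 < ε)
    {K : ℝ} (hK : logScale lamHat ε ≤ K) {y z : ℝ} (hy : 0 < y) (hz : 0 < z) :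
    |s (Leps lamHat ε y) / y - s (Leps lamHat ε z) / z| ≤ B * (1 + K) * |y - z| / (y * z) := by
  wlog hyz : y ≤ z generalizing y z
  · have := this hz hy (le_of_not_ge hyz)
    rwa [abs_sub_comm, abs_sub_comm z y, mul_comm z y] at this
  have hB := h.nonneg
  have e : s (Leps lamHat ε y) / y - s (Leps lamHat ε z) / z =
      s (Leps lamHat ε y) * ((z - y) / (y * z)) +
        (s (Leps lamHat ε y) - s (Leps lamHat ε z)) / z := by field_simp; ring
  have h1 : |s (Leps lamHat ε y) * ((z - y) / (y * z))| ≤ B * ((z - y) / (y * z)) := by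
    rw [abs_mul, abs_of_nonneg (div_nonneg (sub_nonneg.2 hyz) (by positivity))]
    exact mul_le_mul_of_nonneg_right (h.bound _) (div_nonneg (sub_nonneg.2 hyz) (by positivity))
  have h2 : |(s (Leps lamHat ε y) - s (Leps lamHat ε z)) / z| ≤ B * (K * ((z - y) / y)) / z := by
    rw [abs_div, abs_of_pos hz]
    gcongr
    refine (h.lip _ _).trans (mul_le_mul_of_nonneg_left ?_ hB)
    rw [abs_of_nonneg (sub_nonneg.2 (Leps_anti lamHat hε hy hyz))]
    exact (Leps_sub_le lamHat hε hy hyz).trans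
      (mul_le_mul_of_nonneg_right hK (div_nonneg (sub_nonneg.2 hyz) hy.le))
  rw [e, abs_sub_comm y z, abs_of_nonneg (sub_nonneg.2 hyz)]
  refine (abs_add_le _ _).trans ((add_le_add h1 h2).trans_eq ?_)
  field_simp

/-! ### The diagonal part of `𝓐₋ S 𝓐₊` -/

/-- The radial integral behind the recursion of the functions `G_j`. -/
theorem integral_radial_symbol {lamHat ε : ℝ} (hlamHat : 0 < lamHat) {s : ℝ → ℝ} {B : ℝ}
    (h : IsLipBdd s B) (hε : 0 < ε) (hε1 : ε < 1) {c y₀ : ℝ} (hc : 0 < c) (hy₀ : 0 < y₀) :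
    Integrable (fun q : Plane => s (Leps lamHat ε (y₀ + c * ‖q‖ ^ 2)) / (y₀ + c * ‖q‖ ^ 2) /
        (1 + ε ^ 2 * (y₀ + c * ‖q‖ ^ 2))) ∧
    coupling lamHat ε ^ 2 * (1 / 2 * ∫ q : Plane, s (Leps lamHat ε (y₀ + c * ‖q‖ ^ 2)) /
        (y₀ + c * ‖q‖ ^ 2) / (1 + ε ^ 2 * (y₀ + c * ‖q‖ ^ 2))) =
      1 / c * ∫ y in (0 : ℝ)..Leps lamHat ε y₀, s y := by
  have hB := h.nonneg
  have hint : Integrable (fun q : Plane => s (Leps lamHat ε (y₀ + c * ‖q‖ ^ 2)) /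
      (y₀ + c * ‖q‖ ^ 2) / (1 + ε ^ 2 * (y₀ + c * ‖q‖ ^ 2))) := by
    refine ((integrable_inv_sq_affine hy₀ hc).const_mul (B / ε ^ 2)).mono' ?_
      (Eventually.of_forall fun q => ?_)
    · have := h.continuous.measurable
      have := measurable_Leps lamHat ε
      exact Measurable.aestronglyMeasurable (by fun_prop)
    · have hy : 0 < y₀ + c * ‖q‖ ^ 2 := by positivity
      set y := y₀ + c * ‖q‖ ^ 2
      rw [Real.norm_eq_abs, abs_div, abs_div, abs_of_pos hy,
        abs_of_pos (by positivity : 0 < 1 + ε ^ 2 * y), div_div, div_mul_div_comm, mul_one]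
      exact div_le_div₀ hB (h.bound _) (by positivity) (by nlinarith)
  refine ⟨hint, ?_⟩
  have hls : 0 < logScale lamHat ε := by
    have : Real.log (ε ^ 2) ≠ 0 := by
      rw [Real.log_pow]
      have := Real.log_neg hε hε1
      push_cast
      nlinarith
    unfold logScale
    have := Real.pi_pos
    positivity
  set f : ℝ → ℝ := fun r => s (Leps lamHat ε (y₀ + c * r ^ 2)) / (y₀ + c * r ^ 2) /
    (1 + ε ^ 2 * (y₀ + c * r ^ 2)) with hf
  have hint' := (integrable_radial_iff f).1 hint
  set H : ℝ → ℝ := fun x => ∫ y in (0 : ℝ)..x, s y with hH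
  have hHd : ∀ x, HasDerivAt H (s x) x := fun x =>
    intervalIntegral.integral_hasDerivAt_right (h.continuous.intervalIntegrable _ _)
      (h.continuous.stronglyMeasurableAtFilter _ _) h.continuous.continuousAt
  -- The cutoff `1/(1 + ε² y)` is exactly the one that makes the radial integrand a derivative of `H
  -- ∘ L^ε`; since `L^ε` vanishes at infinity, only the endpoint `r = 0` contributes.
  have hderiv : ∀ r : ℝ, HasDerivAt (fun r => H (Leps lamHat ε (y₀ + c * r ^ 2)))
      (-(2 * c * logScale lamHat ε) * (r * f r)) r := by
    intro r
    have hy : 0 < y₀ + c * r ^ 2 := by positivity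
    have h1 : HasDerivAt (fun r : ℝ => y₀ + c * r ^ 2) (c * (2 * r)) r := by
      simpa using ((hasDerivAt_pow 2 r).const_mul c).const_add y₀
    have h2 := (hHd _).comp r ((hasDerivAt_Leps lamHat hε hy).comp r h1)
    refine h2.congr_deriv ?_
    simp only [hf, Function.comp_apply]
    field_simp
  have hlim : Tendsto (fun r : ℝ => H (Leps lamHat ε (y₀ + c * r ^ 2))) atTop (𝓝 0) := by
    have h1 : Tendsto (fun r : ℝ => y₀ + c * r ^ 2) atTop atTop :=
      tendsto_atTop_add_const_left _ _ ((tendsto_pow_atTop two_ne_zero).const_mul_atTop hc)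
    have h2 := ((hHd 0).continuousAt.tendsto.comp (tendsto_Leps_atTop lamHat hε)).comp h1
    rw [show H 0 = 0 from intervalIntegral.integral_same] at h2
    exact h2
  have hftc := integral_Ioi_of_hasDerivAt_of_tendsto' (a := 0) (fun r _ => hderiv r)
    (hint'.const_mul _) hlim
  rw [integral_const_mul] at hftc
  rw [integral_radial f, coupling_sq hε hε1]
  have hpi := Real.pi_ne_zero
  have h0 : H (Leps lamHat ε (y₀ + c * 0 ^ 2)) = ∫ y in (0 : ℝ)..Leps lamHat ε y₀, s y := by
    simp [hH]
  rw [h0] at hftc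
  set I := ∫ r in Set.Ioi (0 : ℝ), r * f r
  have : (∫ y in (0 : ℝ)..Leps lamHat ε y₀, s y) = 2 * c * logScale lamHat ε * I := by linarith
  rw [this]
  field_simp

/-- Replacing the cutoff `v(ε q)` by `1 / (1 + ε² y)`. -/
theorem abs_cutoff_sub_le {v : Plane → ℝ} {C₀ : ℝ} (hv : IsProfile v C₀) {ε c y : ℝ} (hε : 0 < ε)
    (hc : 0 < c) {q : Plane} (hq : q ≠ 0) (hy : c * ‖q‖ ^ 2 ≤ y) :
    |v (ε • q) - 1 / (1 + ε ^ 2 * y)| / y ≤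
      (2 * C₀ / c + 2 + 2 / c ^ 2) * (ε ^ 2 * poleBump (ε • q)) := by
  have hr : 0 < ‖q‖ := norm_pos_iff.2 hq
  have hy0 : 0 < y := lt_of_lt_of_le (by positivity) hy
  have hC₀ : 0 ≤ C₀ := (hv.nonneg 0).trans (hv.le 0)
  set u := ε * ‖q‖ with hu
  have hu0 : 0 < u := by positivity
  have hnorm : ‖ε • q‖ = u := by rw [norm_smul, Real.norm_of_nonneg hε.le]
  have hyu : c * u ^ 2 ≤ ε ^ 2 * y := by
    rw [hu, mul_pow]; nlinarith [mul_le_mul_of_nonneg_left hy (sq_nonneg ε)]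
  have hpb : poleBump (ε • q) = 1 / (u * (1 + u ^ 2)) := by rw [poleBump, hnorm]
  have hpb0 := poleBump_nonneg (ε • q)
  rw [div_le_iff₀ hy0]
  have key : ∀ D, 0 ≤ D → |v (ε • q) - 1 / (1 + ε ^ 2 * y)| ≤ D * (ε ^ 2 * y) *
      poleBump (ε • q) → D ≤ 2 * C₀ / c + 2 + 2 / c ^ 2 →
      |v (ε • q) - 1 / (1 + ε ^ 2 * y)| ≤
        (2 * C₀ / c + 2 + 2 / c ^ 2) * (ε ^ 2 * poleBump (ε • q)) * y := by
    intro D _ h1 h2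
    refine h1.trans ?_
    calc _ = D * (ε ^ 2 * poleBump (ε • q) * y) := by ring
      _ ≤ (2 * C₀ / c + 2 + 2 / c ^ 2) * (ε ^ 2 * poleBump (ε • q) * y) := by gcongr
      _ = _ := by ring
  set z := ε ^ 2 * y with hz
  have hz0 : 0 < z := by positivity
  -- For `ε|q| ≤ 1` both cutoffs are close to `1`; beyond that `v` vanishes and only the decay of
  -- `1/(1 + z)` is needed.
  rcases le_or_gt u 1 with hu1 | hu1
  · refine key (2 * C₀ / c + 2) (by positivity) ?_ (by
      have : 0 ≤ 2 / c ^ 2 := by positivity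
      linarith)
    have h1 : |v (ε • q) - 1| ≤ C₀ * u := hnorm ▸ hv.near_zero (ε • q)
    have h2 : |1 - 1 / (1 + z)| ≤ z := by
      rw [abs_of_nonneg (by rw [sub_nonneg, div_le_one (by positivity)]; linarith)]
      rw [one_sub_div (by positivity), div_le_iff₀ (by positivity)]
      nlinarith
    have h3 : |v (ε • q) - 1 / (1 + z)| ≤ C₀ * u + z := by
      have := abs_sub_le (v (ε • q)) 1 (1 / (1 + z))
      linarith
    have h4 : 1 / (2 * u) ≤ poleBump (ε • q) := by
      rw [hpb]
      refine one_div_le_one_div_of_le (by positivity) ?_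
      nlinarith
    refine h3.trans ?_
    have h5 : C₀ * u ≤ 2 * C₀ / c * z * (1 / (2 * u)) := by
      have : 2 * C₀ / c * (c * u ^ 2) * (1 / (2 * u)) = C₀ * u := by field_simp
      rw [← this]
      gcongr
    have h6 : z ≤ 2 * z * (1 / (2 * u)) := by
      have : 1 ≤ 1 / u := by rw [le_div_iff₀ hu0]; linarith
      calc z ≤ z * (1 / u) := by nlinarith
        _ = _ := by field_simp
    calc C₀ * u + z ≤ 2 * C₀ / c * z * (1 / (2 * u)) + 2 * z * (1 / (2 * u)) := add_le_add h5 h6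
      _ = (2 * C₀ / c + 2) * z * (1 / (2 * u)) := by ring
      _ ≤ _ := by gcongr
  · refine key (2 / c ^ 2) (by positivity) ?_ (by
      have : 0 ≤ 2 * C₀ / c := by positivity
      linarith)
    rw [hv.support _ (by rw [hnorm]; exact hu1), zero_sub, abs_neg, abs_of_pos (by positivity), hpb,
      div_mul_eq_mul_div, div_mul_div_comm, mul_one, div_le_div_iff₀ (by positivity) (by positivity)]
    have h1 : c ^ 2 * u ^ 4 ≤ z ^ 2 := by
      calc c ^ 2 * u ^ 4 = (c * u ^ 2) ^ 2 := by ring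
        _ ≤ z ^ 2 := by gcongr
    have h2 : u * (1 + u ^ 2) ≤ 2 * u ^ 4 := by nlinarith [mul_pos hu0 hu0, pow_pos hu0 3]
    calc 1 * (c ^ 2 * (u * (1 + u ^ 2))) ≤ c ^ 2 * (2 * u ^ 4) := by rw [one_mul]; gcongr
      _ ≤ 2 * z ^ 2 := by linarith
      _ ≤ 2 * z * (1 + z) := by nlinarith

/-- Three replacements, one error term each: `S` by its leading part, `|te + q|²` by `t² + |q|²`,
and the cutoff `v(εq)` by `1/(1 + ε² y)`. The integral of each error over `q` is bounded uniformly
in `ε` and `t`. -/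
theorem diag_pointwise {v : Plane → ℝ} {C₀ : ℝ} (hv : IsProfile v C₀) {lamHat lam ε c K B : ℝ}
    (hlam : 0 < lam) (hε : 0 < ε) (hc : 0 < c) (hK : logScale lamHat ε ≤ K) {S s : ℝ → ℝ}
    (hS : IsSymbol lamHat lam ε S s B) {e : Plane} (he : ‖e‖ = 1) {t : ℝ} (ht : 0 ≤ t)
    (q : Plane) :
    |v (ε • q) / ‖q‖ ^ 2 * cross q e ^ 2 * S (c * ‖t • e + q‖ ^ 2) -
      cross q e ^ 2 * (1 / ‖q‖ ^ 2 * (s (Leps lamHat ε (lam + c * t ^ 2 + c * ‖q‖ ^ 2)) /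
        (lam + c * t ^ 2 + c * ‖q‖ ^ 2) / (1 + ε ^ 2 * (lam + c * t ^ 2 + c * ‖q‖ ^ 2))))| ≤
    C₀ * B * (1 / (lam + c * ‖t • e + q‖ ^ 2) ^ 2) +
      C₀ * (B * (1 + K)) * (2 / c) * (t / (‖q‖ * (t ^ 2 + ‖q‖ ^ 2))) +
      B * (2 * C₀ / c + 2 + 2 / c ^ 2) * (ε ^ 2 * poleBump (ε • q)) := by
  have hC₀ : 0 ≤ C₀ := (hv.nonneg 0).trans (hv.le 0)
  have hB := hS.lipBdd.nonneg
  have hK0 : 0 ≤ K := (logScale_nonneg _ _).trans hK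
  have hpb0 := poleBump_nonneg (ε • q)
  rcases eq_or_ne q 0 with rfl | hq
  · rw [cross_zero_left]
    simp only [ne_eq, OfNat.ofNat_ne_zero, not_false_eq_true, zero_pow, mul_zero, zero_mul,
      sub_zero, abs_zero]
    positivity
  have hr : 0 < ‖q‖ := norm_pos_iff.2 hq
  set r := ‖q‖ with hrdef
  set m := ‖t • e + q‖ with hm
  set X := cross q e ^ 2 / r ^ 2 with hX
  have hX0 : 0 ≤ X := by positivity
  have hX1 : X ≤ 1 := by
    rw [hX, div_le_one (by positivity)]
    simpa [he] using cross_sq_le q e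
  -- Since `q×e = (te + q)×e`, the angular factor is also small when `te + q` is; this compensates
  -- the singularity of `1/y'` there without using `λ`.
  have hXm : X ≤ m ^ 2 / r ^ 2 := by
    refine div_le_div_of_nonneg_right ?_ (by positivity)
    have : cross q e = cross (t • e + q) e := by
      rw [cross_add_left, cross_smul_left, cross_self]; ring
    rw [this]
    simpa [he] using cross_sq_le (t • e + q) e
  set y' := lam + c * m ^ 2 with hy'
  set y := lam + c * t ^ 2 + c * r ^ 2 with hy
  have hy'0 : 0 < y' := by positivity
  have hy0 : 0 < y := by positivity
  set F : ℝ → ℝ := fun y => s (Leps lamHat ε y) / y with hF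
  have hV0 := hv.nonneg (ε • q)
  have hV := hv.le (ε • q)
  set V := v (ε • q) with hVdef
  have hdecomp : V / r ^ 2 * cross q e ^ 2 * S (c * m ^ 2) - cross q e ^ 2 * (1 / r ^ 2 *
      (s (Leps lamHat ε y) / y / (1 + ε ^ 2 * y))) =
      X * V * (S (c * m ^ 2) - F y') + X * V * (F y' - F y) +
        X * (F y * (V - 1 / (1 + ε ^ 2 * y))) := by
    simp only [hX, hF]
    field_simp
    ring
  rw [hdecomp]
  have h1 : |X * V * (S (c * m ^ 2) - F y')| ≤ C₀ * B * (1 / y' ^ 2) := by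
    rw [abs_mul, abs_of_nonneg (mul_nonneg hX0 hV0)]
    have := hS.close (c * m ^ 2) (by positivity)
    calc X * V * |S (c * m ^ 2) - F y'| ≤ 1 * C₀ * (B / y' ^ 2) := by gcongr
      _ = _ := by ring
  have h2 : |X * V * (F y' - F y)| ≤ C₀ * (B * (1 + K)) * (2 / c) * (t / (r * (t ^ 2 + r ^ 2))) := by
    rw [abs_mul, abs_of_nonneg (mul_nonneg hX0 hV0)]
    have h3 : |F y' - F y| ≤ B * (1 + K) * |y' - y| / (y' * y) :=
      abs_symbol_sub_le hS.lipBdd hε hK hy'0 hy0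
    have h4 : |y' - y| ≤ 2 * c * t * r := by
      have : m ^ 2 = t ^ 2 + 2 * t * inner ℝ e q + r ^ 2 := by
        rw [hm, norm_add_sq_real, norm_smul, he, inner_smul_left, Real.norm_of_nonneg ht]
        simp; ring
      have h5 : y' - y = 2 * c * t * inner ℝ e q := by rw [hy', hy, this]; ring
      rw [h5, abs_mul, abs_of_nonneg (by positivity)]
      gcongr
      simpa [he] using abs_real_inner_le_norm e q
    have h5 : X / y' ≤ 1 / (c * r ^ 2) := by
      rw [div_le_div_iff₀ hy'0 (by positivity)]
      rw [le_div_iff₀ (by positivity)] at hXm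
      nlinarith
    have h6 : 1 / y ≤ 1 / (c * (t ^ 2 + r ^ 2)) := by
      apply one_div_le_one_div_of_le (by positivity); rw [hy]; linarith
    calc X * V * |F y' - F y| ≤ X * C₀ * (B * (1 + K) * (2 * c * t * r) / (y' * y)) := by
          gcongr
          exact h3.trans (by gcongr)
      _ = C₀ * (B * (1 + K)) * (2 * c * t * r) * (X / y' * (1 / y)) := by field_simp
      _ ≤ C₀ * (B * (1 + K)) * (2 * c * t * r) * (1 / (c * r ^ 2) * (1 / (c * (t ^ 2 + r ^ 2)))) := by
          gcongr
      _ = _ := by field_simp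
  have h3 : |X * (F y * (V - 1 / (1 + ε ^ 2 * y)))| ≤
      B * (2 * C₀ / c + 2 + 2 / c ^ 2) * (ε ^ 2 * poleBump (ε • q)) := by
    rw [abs_mul, abs_mul, abs_of_nonneg hX0]
    have hFy : |F y| ≤ B / y := by
      simp only [hF]
      rw [abs_div, abs_of_pos hy0]
      gcongr
      exact hS.lipBdd.bound _
    have hcut := abs_cutoff_sub_le hv hε hc hq (y := y) (by
      have : 0 ≤ c * t ^ 2 := by positivity
      linarith)
    calc X * (|F y| * |V - 1 / (1 + ε ^ 2 * y)|) ≤ 1 * (B / y * |V - 1 / (1 + ε ^ 2 * y)|) := by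
          gcongr
      _ = B * (|V - 1 / (1 + ε ^ 2 * y)| / y) := by ring
      _ ≤ B * ((2 * C₀ / c + 2 + 2 / c ^ 2) * (ε ^ 2 * poleBump (ε • q))) := by gcongr
      _ = _ := by ring
  exact (abs_add_three _ _ _).trans (add_le_add (add_le_add h1 h2) h3)

/-- The diagonal part of `𝓐₋ S 𝓐₊` is, up to a bounded multiple of the squared coupling, a function
of `L^ε`. -/
theorem diag_estimate {v : Plane → ℝ} {C₀ : ℝ} (hv : IsProfile v C₀) {lamHat lam c B : ℝ}
    (hlamHat : 0 < lamHat) (hlam : 0 < lam) (hc : 0 < c) : ∃ C, 0 ≤ C ∧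
    ∀ ε, 0 < ε → ε ≤ 1 / 2 → ∀ S s, IsSymbol lamHat lam ε S s B → ∀ e : Plane, ‖e‖ = 1 → ∀ t, 0 ≤ t →
    |coupling lamHat ε ^ 2 *
        (∫ q : Plane, v (ε • q) / ‖q‖ ^ 2 * cross q e ^ 2 * S (c * ‖t • e + q‖ ^ 2)) -
      1 / c * ∫ y in (0 : ℝ)..Leps lamHat ε (lam + c * t ^ 2), s y| ≤
        C * coupling lamHat ε ^ 2 := by
  have hC₀ : 0 ≤ C₀ := (hv.nonneg 0).trans (hv.le 0)
  set K := Real.pi * lamHat ^ 2 with hK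
  have hK0 : 0 ≤ K := by positivity
  set D₁ := C₀ * B
  set D₂ := C₀ * (B * (1 + K)) * (2 / c)
  set D₃ := B * (2 * C₀ / c + 2 + 2 / c ^ 2)
  set I₁ := ∫ q : Plane, 1 / (lam + c * ‖q‖ ^ 2) ^ 2
  set I₂ := ∫ q, poleBump q
  have hI₁ : 0 ≤ I₁ := integral_nonneg fun q => by positivity
  have hI₂ : 0 ≤ I₂ := integral_nonneg fun q => poleBump_nonneg q
  -- Absolute values, because the sign of `B` is known only once a symbol is given.
  refine ⟨|D₁| * I₁ + |D₂| * I₂ + |D₃| * I₂, by positivity, ?_⟩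
  intro ε hε hε2 S s hS e he t ht
  have hB := hS.lipBdd.nonneg
  have hε1 : ε < 1 := by linarith
  have hKε : logScale lamHat ε ≤ K := div_le_self hK0 (one_le_abs_log_sq hε hε2)
  have hy₀ : 0 < lam + c * t ^ 2 := by positivity
  obtain ⟨hint, heq⟩ := integral_radial_symbol hlamHat hS.lipBdd hε hε1 hc hy₀
  set T₁ : Plane → ℝ := fun q => v (ε • q) / ‖q‖ ^ 2 * cross q e ^ 2 * S (c * ‖t • e + q‖ ^ 2)
    with hT₁
  set g : ℝ → ℝ := fun r => 1 / r ^ 2 * (s (Leps lamHat ε (lam + c * t ^ 2 + c * r ^ 2)) /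
    (lam + c * t ^ 2 + c * r ^ 2) / (1 + ε ^ 2 * (lam + c * t ^ 2 + c * r ^ 2))) with hg
  have hgm : Measurable g := by
    have := hS.lipBdd.continuous.measurable
    have := measurable_Leps lamHat ε
    fun_prop
  have hgae : (fun q : Plane => ‖q‖ ^ 2 * g ‖q‖) =ᵐ[volume] fun q =>
      s (Leps lamHat ε (lam + c * t ^ 2 + c * ‖q‖ ^ 2)) /
        (lam + c * t ^ 2 + c * ‖q‖ ^ 2) / (1 + ε ^ 2 * (lam + c * t ^ 2 + c * ‖q‖ ^ 2)) := by
    filter_upwards [Measure.ae_ne volume (0 : Plane)] with q hq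
    have : ‖q‖ ≠ 0 := norm_ne_zero_iff.2 hq
    simp only [hg]
    rw [← mul_assoc, mul_one_div, div_self (by positivity), one_mul]
  have hgi : Integrable fun q : Plane => ‖q‖ ^ 2 * g ‖q‖ := hint.congr hgae.symm
  have hrad := integral_cross_sq_mul_radial g he hgi hgm
  rw [integral_congr_ae hgae] at hrad
  rw [← heq, ← hrad, ← mul_sub, abs_mul, abs_of_nonneg (sq_nonneg (coupling lamHat ε)), mul_comm]
  refine mul_le_mul_of_nonneg_right ?_ (sq_nonneg _)
  have hpt := fun q => diag_pointwise hv hlam hε hc hKε hS he ht q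
  have hT₂i : Integrable fun q => cross q e ^ 2 * g ‖q‖ := by
    refine hgi.mono (Measurable.aestronglyMeasurable (by fun_prop))
      (Eventually.of_forall fun q => ?_)
    rw [norm_mul (cross q e ^ 2) (g ‖q‖), norm_mul (‖q‖ ^ 2) (g ‖q‖),
      Real.norm_of_nonneg (sq_nonneg _), Real.norm_of_nonneg (sq_nonneg _)]
    exact mul_le_mul_of_nonneg_right (by simpa [he] using cross_sq_le q e) (norm_nonneg _)
  have hT₁m : Measurable T₁ := by
    have := hS.measurable
    have := hv.measurable
    fun_prop
  have hE₁ : Integrable fun q => 1 / (lam + c * ‖t • e + q‖ ^ 2) ^ 2 :=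
    (integrable_inv_sq_affine hlam hc).comp_add_left (t • e)
  have hE₂ := integrable_scaled_poleBump ht
  have hE₃ := integrable_comp_smul_plane integrable_poleBump hε
  have hE := ((hE₁.const_mul D₁).add (hE₂.const_mul D₂)).add (hE₃.const_mul D₃)
  have hTi : Integrable fun q => T₁ q - cross q e ^ 2 * g ‖q‖ :=
    hE.mono' (by fun_prop) (Eventually.of_forall fun q => hpt q)
  have hT₁i : Integrable T₁ := by
    refine (hTi.add hT₂i).congr (Eventually.of_forall fun q => ?_)
    simp
  rw [← integral_sub hT₁i hT₂i]
  refine (norm_integral_le_of_norm_le (f := fun q => T₁ q - cross q e ^ 2 * g ‖q‖) hE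
    (Eventually.of_forall fun q => hpt q)).trans ?_
  rw [integral_add' ((hE₁.const_mul D₁).add (hE₂.const_mul D₂)) (hE₃.const_mul D₃),
    integral_add' (hE₁.const_mul D₁) (hE₂.const_mul D₂), integral_const_mul, integral_const_mul,
    integral_const_mul, integral_comp_smul_plane _ hε,
    integral_add_left_eq_self (fun q : Plane => 1 / (lam + c * ‖q‖ ^ 2) ^ 2) (t • e)]
  have := integral_scaled_poleBump_le ht
  have hD₂ : 0 ≤ D₂ := by positivity
  exact add_le_add (add_le_add (mul_le_mul_of_nonneg_right (le_abs_self _) hI₁)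
    (mul_le_mul (le_abs_self _) this (integral_nonneg fun q => by positivity) (abs_nonneg _)))
    (mul_le_mul_of_nonneg_right (le_abs_self _) hI₂)

/-! ### Symmetric functions of several variables -/

/-- Symmetric functions of `m` variables. -/
def IsSymm {X Y : Type*} {m : ℕ} (ψ : (Fin m → X) → Y) : Prop :=
  ∀ (σ : Equiv.Perm (Fin m)) (p : Fin m → X), ψ (p ∘ σ) = ψ p

section Symm

variable {X Y : Type*} {m : ℕ}

theorem IsSymm.insertNth {ψ : (Fin (m + 1) → X) → Y} (h : IsSymm ψ) (i : Fin (m + 1)) (q : X)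
    (p : Fin m → X) :
    ψ (i.insertNth (α := fun _ => X) q p) = ψ (Fin.snoc (α := fun _ => X) p q) := by
  rw [← h ((finSuccEquiv' i).trans finSuccEquivLast.symm) (Fin.snoc p q)]
  congr 1
  funext j
  rcases Fin.eq_self_or_eq_succAbove i j with rfl | ⟨j, rfl⟩
  · simp
  · simp

theorem IsSymm.snoc_comp {ψ : (Fin (m + 1) → X) → Y} (h : IsSymm ψ) (σ : Equiv.Perm (Fin m))
    (q : X) (p : Fin m → X) :
    ψ (Fin.snoc (α := fun _ => X) (p ∘ σ) q) = ψ (Fin.snoc (α := fun _ => X) p q) := by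
  rw [← h (finSuccEquivLast.trans ((Equiv.optionCongr σ).trans finSuccEquivLast.symm)) (Fin.snoc p q)]
  congr 1
  funext j
  refine Fin.lastCases ?_ (fun j => ?_) j
  · simp
  · simp

/-- Both sides list the same variables, those with index different from `σ i`; `τ` is the induced
reordering. -/
theorem IsSymm.comp_succAbove {ψ : (Fin m → X) → Y} (h : IsSymm ψ) (σ : Equiv.Perm (Fin (m + 1)))
    (i : Fin (m + 1)) (x : Fin (m + 1) → X) :
    ψ (fun j => x (σ (i.succAbove j))) = ψ (fun j => x ((σ i).succAbove j)) := by
  set τ : Equiv.Perm (Fin m) := ((finSuccAboveEquiv i).trans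
    (σ.subtypeEquiv (p := fun a => a ≠ i) (q := fun a => a ≠ σ i) fun a => by simp)).trans
      (finSuccAboveEquiv (σ i)).symm with hτ
  rw [← h τ (fun j => x ((σ i).succAbove j))]
  congr 1
  funext j
  have : (σ i).succAbove (τ j) = σ (i.succAbove j) := by
    have h2 : (finSuccAboveEquiv (σ i)) (τ j) =
        σ.subtypeEquiv (p := fun a => a ≠ i) (q := fun a => a ≠ σ i) (fun a => by simp)
          ((finSuccAboveEquiv i) j) := by
      rw [hτ]; simp
    exact congrArg Subtype.val h2
  simp only [Function.comp_apply, this]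

/-- Dropping `p i` from `(p, q)` leaves `q` as its substitute, up to a reordering obtained by
swapping `i` with the last index. -/
theorem IsSymm.snoc_castSucc_succAbove {ψ : (Fin m → X) → Y} (h : IsSymm ψ) (i : Fin m) (q : X)
    (p : Fin m → X) :
    ψ (fun j => Fin.snoc (α := fun _ => X) p q (i.castSucc.succAbove j)) =
      ψ (Function.update p i q) := by
  have := h.comp_succAbove (Equiv.swap i.castSucc (Fin.last m)) (Fin.last m)
    (Fin.snoc (α := fun _ => X) p q)
  rw [Equiv.swap_apply_right] at this
  rw [← this]
  congr 1
  funext j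
  rw [Fin.succAbove_last]
  rcases eq_or_ne j i with rfl | hj
  · simp
  · rw [Equiv.swap_apply_of_ne_of_ne (by simpa using hj) (Fin.castSucc_lt_last j).ne]
    simp [hj]

end Symm

theorem sum_snoc {m : ℕ} (p : Fin m → Plane) (q : Plane) :
    ∑ j, Fin.snoc (α := fun _ => Plane) p q j = ∑ j, p j + q := by
  rw [Fin.sum_univ_castSucc]; simp

/-- Separates the term in which the momentum `q`, to be contracted later, is the created one (it
gives the diagonal part) from those in which `q` has taken the place of some `p i` (the exchanges).
-/
theorem creation_snoc (lamHat ε : ℝ) {m : ℕ} {ψ : (Fin m → Plane) → ℂ} (h : IsSymm ψ)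
    (p : Fin m → Plane) (q : Plane) :
    creation lamHat ε ψ (Fin.snoc (α := fun _ => Plane) p q) =
      -((1 / ((m : ℝ) + 1) * coupling lamHat ε : ℝ) : ℂ) *
        (((cross q (∑ j, p j) : ℝ) : ℂ) * ψ p +
          ∑ i, ((cross (p i) (∑ j, p j + q) : ℝ) : ℂ) * ψ (Function.update p i q)) := by
  rw [creation, sum_snoc, Fin.sum_univ_castSucc]
  simp only [h.snoc_castSucc_succAbove, Fin.snoc_castSucc, Fin.snoc_last, Fin.succAbove_last,
    cross_add_right q, cross_self, add_zero]
  rw [add_comm (Finset.sum _ _)]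

theorem IsSymm.creation {lamHat ε : ℝ} {m : ℕ} {ψ : (Fin m → Plane) → ℂ} (h : IsSymm ψ) :
    IsSymm (creation lamHat ε ψ) := by
  intro σ p
  simp only [CurlGFF.creation, Function.comp_apply]
  rw [Equiv.sum_comp σ p]
  congr 1
  rw [← Equiv.sum_comp σ (fun i => ((cross (p i) (∑ j, p j) : ℝ) : ℂ) *
    ψ (fun j => p (i.succAbove j)))]
  exact Finset.sum_congr rfl fun i _ => by rw [h.comp_succAbove σ i p]

theorem symb_comp (ν : ℝ) {m : ℕ} (σ : Equiv.Perm (Fin m)) (p : Fin m → Plane) :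
    symb ν (p ∘ σ) = symb ν p := by
  simp only [symb, Function.comp_apply]
  rw [Equiv.sum_comp σ p]

/-! ### The measure on the modes -/

section Pi

variable {X : Type*} [MeasurableSpace X]

theorem lintegral_pi_prod (μ : Measure X) [SigmaFinite μ] (m : ℕ) (f : Fin m → X → ℝ≥0∞)
    (hf : ∀ i, Measurable (f i)) :
    ∫⁻ p, ∏ i, f i (p i) ∂(Measure.pi fun _ : Fin m => μ) = ∏ i, ∫⁻ x, f i x ∂μ := by
  induction m with
  | zero => simp
  | succ m ih =>
    rw [← ((measurePreserving_piFinSuccAbove (fun _ : Fin (m + 1) => μ) 0).symm).lintegral_comp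
      (by fun_prop), Fin.prod_univ_succ, ← ih _ fun i => hf _]
    have hm : Measurable fun x : Fin m → X => ∏ i : Fin m, f i.succ (x i) := by
      have := fun i => hf i
      fun_prop
    rw [← lintegral_prod_mul (hf 0).aemeasurable hm.aemeasurable]
    refine lintegral_congr fun x => ?_
    simp [Fin.prod_univ_succ, MeasurableEquiv.piFinSuccAbove_symm_apply]

theorem pi_withDensity (μ : Measure X) [SigmaFinite μ] (m : ℕ) {f : X → ℝ≥0∞}
    (hf : Measurable f) [SigmaFinite (μ.withDensity f)] :
    Measure.pi (fun _ : Fin m => μ.withDensity f) =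
      (Measure.pi fun _ : Fin m => μ).withDensity fun p => ∏ i, f (p i) := by
  refine Measure.pi_eq fun s hs => ?_
  rw [withDensity_apply _ (MeasurableSet.univ_pi hs), ← lintegral_indicator (MeasurableSet.univ_pi hs)]
  have : ∀ p : Fin m → X, (Set.univ.pi s).indicator (fun p => ∏ i, f (p i)) p =
      ∏ i, (s i).indicator f (p i) := by
    intro p
    by_cases hp : p ∈ Set.univ.pi s
    · rw [Set.indicator_of_mem hp]
      exact Finset.prod_congr rfl fun i _ => (Set.indicator_of_mem (hp i trivial) _).symm
    · rw [Set.indicator_of_notMem hp]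
      simp only [Set.mem_pi, Set.mem_univ, true_imp_iff, not_forall] at hp
      obtain ⟨i, hi⟩ := hp
      exact (Finset.prod_eq_zero (Finset.mem_univ i) (Set.indicator_of_notMem hi _)).symm
  simp_rw [this]
  rw [lintegral_pi_prod μ m _ fun i => hf.indicator (hs i)]
  exact Finset.prod_congr rfl fun i _ => by
    rw [lintegral_indicator (hs i), withDensity_apply _ (hs i)]

end Pi

/-- The density `V̂_ε(q) / |q|²`. -/
def modeWeight (v : Plane → ℝ) (ε : ℝ) (q : Plane) : ℝ := v (ε • q) / ‖q‖ ^ 2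

/-- The measure `V̂_ε(q) / |q|² dq`. -/
def modeMeasure (v : Plane → ℝ) (ε : ℝ) : Measure Plane :=
  volume.withDensity fun q => ENNReal.ofReal (modeWeight v ε q)

instance (v : Plane → ℝ) (ε : ℝ) : SigmaFinite (modeMeasure v ε) := by
  unfold modeMeasure; infer_instance

/-- The measure `∏ V̂_ε(p_i) / |p_i|² dp`. -/
def modesMeasure (v : Plane → ℝ) (ε : ℝ) (m : ℕ) : Measure (Fin m → Plane) :=
  Measure.pi fun _ => modeMeasure v ε

instance (v : Plane → ℝ) (ε : ℝ) (m : ℕ) : SigmaFinite (modesMeasure v ε m) := by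
  unfold modesMeasure; infer_instance

section Profile

variable {v : Plane → ℝ} {C₀ : ℝ}

theorem IsProfile.const_nonneg (hv : IsProfile v C₀) : 0 ≤ C₀ := (hv.nonneg 0).trans (hv.le 0)

theorem IsProfile.modeWeight_nonneg (hv : IsProfile v C₀) (ε : ℝ) (q : Plane) :
    0 ≤ modeWeight v ε q := div_nonneg (hv.nonneg _) (by positivity)

theorem IsProfile.measurable_modeWeight (hv : IsProfile v C₀) (ε : ℝ) :
    Measurable (modeWeight v ε) := by
  have := hv.measurable
  unfold modeWeight
  fun_prop

theorem IsProfile.modeWeight_mul_le (hv : IsProfile v C₀) (ε : ℝ) (q : Plane) :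
    modeWeight v ε q * ‖q‖ ^ 2 ≤ v (ε • q) := by
  rcases eq_or_ne q 0 with rfl | hq
  · simpa [modeWeight] using hv.nonneg 0
  · have : ‖q‖ ≠ 0 := norm_ne_zero_iff.2 hq
    rw [modeWeight, div_mul_cancel₀ _ (by positivity)]

theorem IsProfile.modeWeight_mul_le_const (hv : IsProfile v C₀) (ε : ℝ) (q : Plane) :
    modeWeight v ε q * ‖q‖ ^ 2 ≤ C₀ := (hv.modeWeight_mul_le ε q).trans (hv.le _)

theorem integral_modeMeasure (hv : IsProfile v C₀) (ε : ℝ) {E : Type*} [NormedAddCommGroup E]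
    [NormedSpace ℝ E] (f : Plane → E) :
    ∫ q, f q ∂(modeMeasure v ε) = ∫ q, modeWeight v ε q • f q := by
  rw [modeMeasure, integral_withDensity_eq_integral_toReal_smul
    (hv.measurable_modeWeight ε).ennreal_ofReal (by simp)]
  simp [ENNReal.toReal_ofReal (hv.modeWeight_nonneg ε _)]

theorem integrable_modeMeasure (hv : IsProfile v C₀) (ε : ℝ) {E : Type*} [NormedAddCommGroup E]
    [NormedSpace ℝ E] (f : Plane → E) :
    Integrable f (modeMeasure v ε) ↔ Integrable fun q => modeWeight v ε q • f q := by
  rw [modeMeasure, integrable_withDensity_iff_integrable_smul'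
    (hv.measurable_modeWeight ε).ennreal_ofReal (by simp)]
  simp [ENNReal.toReal_ofReal (hv.modeWeight_nonneg ε _)]

/-- The density factorises, so up to `m!` the measure is a product and Fubini applies in each
momentum separately. -/
theorem fockMeasure_eq {ρ : 𝓢(Plane, ℝ)} (hρ : IsMollifier ρ) {ε : ℝ} (hε : 0 < ε) (m : ℕ) :
    fockMeasure ρ ε m = ENNReal.ofReal (m ! : ℝ) • modesMeasure (specProfile ρ) ε m := by
  obtain ⟨C₀, hv⟩ := hρ.isProfile
  have hw := (hv.measurable_modeWeight ε).ennreal_ofReal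
  have hm : Measurable fun p : Fin m → Plane =>
      ∏ i, ENNReal.ofReal (modeWeight (specProfile ρ) ε (p i)) :=
    Finset.measurable_prod _ fun i _ => hw.comp (measurable_pi_apply i)
  have : SigmaFinite (volume.withDensity fun q : Plane =>
      ENNReal.ofReal (modeWeight (specProfile ρ) ε q)) := by infer_instance
  rw [modesMeasure, modeMeasure, pi_withDensity volume m hw, ← withDensity_smul _ hm,
    fockMeasure]
  congr 1
  funext p
  rw [ENNReal.ofReal_mul (by positivity), ENNReal.ofReal_prod_of_nonneg]
  · simp [modeWeight, hρ.covHat_eq hε]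
  · intro i _
    rw [hρ.covHat_eq hε]
    exact hv.modeWeight_nonneg ε (p i)

/-- The factor `|q|²` removes the pole of the density, and the density lives on the ball of radius
`1/ε`, so polynomial growth is harmless. -/
theorem integrable_modeMeasure_growth (hv : IsProfile v C₀) {ε : ℝ} (hε : 0 < ε) (l : ℕ) :
    Integrable (fun q : Plane => ‖q‖ ^ 2 * (1 + ‖q‖) ^ l) (modeMeasure v ε) := by
  rw [integrable_modeMeasure hv]
  have hfin : volume (Metric.closedBall (0 : Plane) ε⁻¹) < ∞ := measure_closedBall_lt_top
  have hind : Integrable ((Metric.closedBall (0 : Plane) ε⁻¹).indicator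
      fun _ => C₀ * (1 + ε⁻¹) ^ l) :=
    (integrable_indicator_iff Metric.isClosed_closedBall.measurableSet).2
      (integrableOn_const hfin.ne)
  refine hind.mono' ?_ (Eventually.of_forall fun q => ?_)
  · have := hv.measurable_modeWeight ε
    exact Measurable.aestronglyMeasurable (by fun_prop)
  · have h0 := hv.modeWeight_nonneg ε q
    have hC := hv.const_nonneg
    rw [smul_eq_mul, Real.norm_of_nonneg (by positivity), ← mul_assoc]
    by_cases hq : q ∈ Metric.closedBall (0 : Plane) ε⁻¹
    · rw [Set.indicator_of_mem hq]
      gcongr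
      · exact hv.modeWeight_mul_le_const ε q
      · simpa using hq
    · rw [Set.indicator_of_notMem hq]
      have : 1 < ‖ε • q‖ := by
        rw [norm_smul, Real.norm_of_nonneg hε.le]
        have : ε⁻¹ < ‖q‖ := by simpa using hq
        rwa [inv_lt_iff_one_lt_mul₀' hε] at this
      rw [modeWeight, hv.support _ this]
      simp

end Profile

/-! ### Kernels of controlled growth -/

/-- Measurable symmetric kernels which vanish to first order where a momentum does, and grow at
most polynomially. -/
structure IsKernel (k : ℕ) {m : ℕ} (ψ : (Fin m → Plane) → ℂ) : Prop where
  measurable : Measurable ψ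
  symm : IsSymm ψ
  growth : ∃ C, 0 ≤ C ∧ ∀ p, ‖ψ p‖ ≤ C * ∏ i, ‖p i‖ * (1 + ‖p i‖) ^ k

/-- Turns growth in the total momentum into factorised growth, the only form that `IsKernel` admits.
-/
theorem one_add_norm_sum_le_prod {m : ℕ} (p : Fin m → Plane) :
    1 + ‖∑ i, p i‖ ≤ ∏ i, (1 + ‖p i‖) := by
  have h : ∀ s : Finset (Fin m), 1 + ∑ i ∈ s, ‖p i‖ ≤ ∏ i ∈ s, (1 + ‖p i‖) := by
    intro s
    induction s using Finset.induction_on with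
    | empty => simp
    | insert a s ha ih =>
      rw [Finset.sum_insert ha, Finset.prod_insert ha]
      have h1 : 0 ≤ ∑ i ∈ s, ‖p i‖ := Finset.sum_nonneg fun i _ => norm_nonneg _
      nlinarith [norm_nonneg (p a), mul_le_mul_of_nonneg_left ih (norm_nonneg (p a)),
        mul_nonneg (norm_nonneg (p a)) h1]
  have := norm_sum_le Finset.univ p
  linarith [h Finset.univ]

theorem IsKernel.mono {k l m : ℕ} {ψ : (Fin m → Plane) → ℂ} (h : IsKernel k ψ) (hkl : k ≤ l) :
    IsKernel l ψ := by
  obtain ⟨C, hC, hg⟩ := h.growth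
  refine ⟨h.measurable, h.symm, C, hC, fun p => (hg p).trans ?_⟩
  gcongr
  linarith [norm_nonneg (p ‹_›)]

theorem measurable_symb (ν : ℝ) (m : ℕ) : Measurable fun p : Fin m → Plane => symb ν p := by
  unfold symb
  fun_prop

theorem symb_nonneg (ν : ℝ) {m : ℕ} (p : Fin m → Plane) : 0 ≤ symb ν p := by
  unfold symb; positivity

theorem IsKernel.smul_symb {k m : ℕ} {ψ : (Fin m → Plane) → ℂ} (h : IsKernel k ψ) {ν : ℝ}
    {T : ℝ → ℝ} (hT : Measurable T) {l : ℕ} {D : ℝ}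
    (hD : ∀ x, 0 ≤ x → |T (ν ^ 2 / 2 * x ^ 2)| ≤ D * (1 + x) ^ l) :
    IsKernel (k + l) fun p => ((T (symb ν p) : ℝ) : ℂ) * ψ p := by
  obtain ⟨C, hC, hg⟩ := h.growth
  have hD0 : 0 ≤ D := by simpa using (abs_nonneg _).trans (hD 0 le_rfl)
  refine ⟨?_, fun σ p => ?_, D * C, by positivity, fun p => ?_⟩
  · have := h.measurable
    have := measurable_symb ν m
    fun_prop
  · rw [symb_comp, h.symm σ p]
  · have h2 := one_add_norm_sum_le_prod p
    rw [norm_mul, Complex.norm_real, Real.norm_eq_abs]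
    calc _ ≤ D * (1 + ‖∑ i, p i‖) ^ l * (C * ∏ i, ‖p i‖ * (1 + ‖p i‖) ^ k) := by
          gcongr
          · exact hD _ (norm_nonneg _)
          · exact hg p
      _ ≤ D * (∏ i, (1 + ‖p i‖)) ^ l * (C * ∏ i, ‖p i‖ * (1 + ‖p i‖) ^ k) := by
          gcongr
      _ = D * C * ∏ i, ‖p i‖ * (1 + ‖p i‖) ^ (k + l) := by
          simp only [Finset.prod_mul_distrib, pow_add, Finset.prod_pow]
          ring

theorem prod_succAbove_growth {m : ℕ} (k : ℕ) (p : Fin (m + 1) → Plane) (i : Fin (m + 1)) :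
    (‖p i‖ * (1 + ‖p i‖) ^ k) * ∏ j, ‖p (i.succAbove j)‖ * (1 + ‖p (i.succAbove j)‖) ^ k =
      ∏ j, ‖p j‖ * (1 + ‖p j‖) ^ k :=
  (Fin.prod_univ_succAbove (fun j => ‖p j‖ * (1 + ‖p j‖) ^ k) i).symm

theorem measurable_creation (lamHat ε : ℝ) {m : ℕ} {ψ : (Fin m → Plane) → ℂ} (h : Measurable ψ) :
    Measurable (creation lamHat ε ψ) := by
  have h1 : ∀ i : Fin (m + 1), Measurable fun p : Fin (m + 1) → Plane =>
      ψ (fun j => p (i.succAbove j)) := fun i => h.comp (by fun_prop)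
  have h2 : ∀ i : Fin (m + 1), Measurable fun p : Fin (m + 1) → Plane =>
      ((cross (p i) (∑ j, p j) : ℝ) : ℂ) := fun i => by fun_prop
  exact (Finset.measurable_fun_sum _ fun i _ => (h2 i).mul (h1 i)).const_mul _

/-- The cross product supplies the factor `|p i|` that is missing because `ψ` does not depend on `p
i`; the price is one factor of the total momentum. -/
theorem norm_creation_term_le {m k : ℕ} {ψ : (Fin m → Plane) → ℂ} {C : ℝ}
    (hg : ∀ p, ‖ψ p‖ ≤ C * ∏ i, ‖p i‖ * (1 + ‖p i‖) ^ k) (p : Fin (m + 1) → Plane)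
    (i : Fin (m + 1)) :
    ‖((cross (p i) (∑ j, p j) : ℝ) : ℂ) * ψ (fun j => p (i.succAbove j))‖ ≤
      ‖∑ j, p j‖ * (C * ∏ i, ‖p i‖ * (1 + ‖p i‖) ^ k) := by
  have h1 : (1 : ℝ) ≤ (1 + ‖p i‖) ^ k := one_le_pow₀ (by linarith [norm_nonneg (p i)])
  have h0 : 0 ≤ C * ∏ j, ‖p (i.succAbove j)‖ * (1 + ‖p (i.succAbove j)‖) ^ k :=
    (norm_nonneg _).trans (hg _)
  rw [norm_mul, Complex.norm_real, Real.norm_eq_abs, ← prod_succAbove_growth k p i]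
  calc _ ≤ ‖p i‖ * ‖∑ j, p j‖ *
        (C * ∏ j, ‖p (i.succAbove j)‖ * (1 + ‖p (i.succAbove j)‖) ^ k) := by
          gcongr
          · exact abs_cross_le _ _
          · exact hg _
    _ ≤ (‖p i‖ * (1 + ‖p i‖) ^ k) * ‖∑ j, p j‖ *
        (C * ∏ j, ‖p (i.succAbove j)‖ * (1 + ‖p (i.succAbove j)‖) ^ k) := by
          gcongr
          exact le_mul_of_one_le_right (norm_nonneg _) h1
    _ = _ := by ring

theorem sum_mul_growth_le {m : ℕ} (k : ℕ) {C : ℝ} (hC : 0 ≤ C) (p : Fin m → Plane) :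
    ‖∑ j, p j‖ * (C * ∏ i, ‖p i‖ * (1 + ‖p i‖) ^ k) ≤
      C * ∏ i, ‖p i‖ * (1 + ‖p i‖) ^ (k + 1) := by
  have h2 := one_add_norm_sum_le_prod p
  calc _ ≤ (∏ i, (1 + ‖p i‖)) * (C * ∏ i, ‖p i‖ * (1 + ‖p i‖) ^ k) := by
        gcongr
        linarith
    _ = _ := by
        simp only [Finset.prod_mul_distrib, pow_succ]
        ring

theorem norm_creation_le (lamHat ε : ℝ) {m k : ℕ} {ψ : (Fin m → Plane) → ℂ} {C : ℝ}
    (hg : ∀ p, ‖ψ p‖ ≤ C * ∏ i, ‖p i‖ * (1 + ‖p i‖) ^ k) (p : Fin (m + 1) → Plane) :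
    ‖creation lamHat ε ψ p‖ ≤
      |coupling lamHat ε| * (‖∑ j, p j‖ * (C * ∏ i, ‖p i‖ * (1 + ‖p i‖) ^ k)) := by
  rw [creation, norm_mul, norm_neg, Complex.norm_real, Real.norm_eq_abs, abs_mul,
    abs_of_pos (by positivity : (0 : ℝ) < 1 / ((m : ℝ) + 1))]
  calc _ ≤ 1 / ((m : ℝ) + 1) * |coupling lamHat ε| *
        ∑ _i : Fin (m + 1), ‖∑ j, p j‖ * (C * ∏ i, ‖p i‖ * (1 + ‖p i‖) ^ k) := by
          gcongr
          exact (norm_sum_le _ _).trans (Finset.sum_le_sum fun i _ => norm_creation_term_le hg p i)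
    _ = _ := by
          rw [Finset.sum_const, Finset.card_univ, Fintype.card_fin, nsmul_eq_mul]
          push_cast
          field_simp

theorem IsKernel.creation {k m : ℕ} {ψ : (Fin m → Plane) → ℂ} (h : IsKernel k ψ) (lamHat ε : ℝ) :
    IsKernel (k + 1) (creation lamHat ε ψ) := by
  obtain ⟨C, hC, hg⟩ := h.growth
  refine ⟨measurable_creation _ _ h.measurable, h.symm.creation, |coupling lamHat ε| * C,
    by positivity, fun p => (norm_creation_le lamHat ε hg p).trans ?_⟩
  rw [mul_assoc]
  exact mul_le_mul_of_nonneg_left (sum_mul_growth_le k hC p) (abs_nonneg _)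

/-- The resolvent absorbs the factor of the total momentum lost in `𝓐₊`, so the growth exponent does
not increase. This keeps all components of `b` in `IsKernel 0`. -/
theorem IsKernel.resolvent_creation {k m : ℕ} {ψ : (Fin m → Plane) → ℂ} (h : IsKernel k ψ)
    (lamHat ε : ℝ) {ν : ℝ} {T : ℝ → ℝ} (hT : Measurable T) {D : ℝ}
    (hD : ∀ x, 0 ≤ x → |T (ν ^ 2 / 2 * x ^ 2)| * x ≤ D) :
    IsKernel k fun p => ((T (symb ν p) : ℝ) : ℂ) * CurlGFF.creation lamHat ε ψ p := by
  obtain ⟨C, hC, hg⟩ := h.growth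
  have hD0 : 0 ≤ D := by simpa using hD 0 le_rfl
  refine ⟨?_, fun σ p => ?_, |coupling lamHat ε| * D * C, by positivity, fun p => ?_⟩
  · have := measurable_creation lamHat ε h.measurable
    have := measurable_symb ν (m + 1)
    fun_prop
  · rw [symb_comp, h.symm.creation σ p]
  · rw [norm_mul, Complex.norm_real, Real.norm_eq_abs]
    calc _ ≤ |T (symb ν p)| *
          (|coupling lamHat ε| * (‖∑ j, p j‖ * (C * ∏ i, ‖p i‖ * (1 + ‖p i‖) ^ k))) := by
            gcongr
            exact norm_creation_le lamHat ε hg p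
      _ = |coupling lamHat ε| * (|T (symb ν p)| * ‖∑ j, p j‖) *
            (C * ∏ i, ‖p i‖ * (1 + ‖p i‖) ^ k) := by ring
      _ ≤ |coupling lamHat ε| * D * (C * ∏ i, ‖p i‖ * (1 + ‖p i‖) ^ k) := by
            gcongr
            exact hD _ (norm_nonneg _)
      _ = _ := by ring

theorem IsKernel.add {k m : ℕ} {ψ χ : (Fin m → Plane) → ℂ} (h : IsKernel k ψ) (h' : IsKernel k χ) :
    IsKernel k fun p => ψ p + χ p := by
  obtain ⟨C, hC, hg⟩ := h.growth
  obtain ⟨C', hC', hg'⟩ := h'.growth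
  refine ⟨h.measurable.add h'.measurable, fun σ p => by rw [h.symm, h'.symm], C + C',
    by positivity, fun p => ?_⟩
  rw [add_mul]
  exact (norm_add_le _ _).trans (add_le_add (hg p) (hg' p))

theorem IsKernel.zero (k m : ℕ) : IsKernel k (0 : (Fin m → Plane) → ℂ) :=
  ⟨measurable_zero, fun _ _ => rfl, 0, le_rfl, fun p => by simp⟩

/-! ### The annihilation operator and adjointness -/

section Profile

variable {v : Plane → ℝ} {C₀ : ℝ}

/-- The annihilation operator for a spectral profile. -/
def annih (v : Plane → ℝ) (lamHat ε : ℝ) {m : ℕ} (ψ : (Fin (m + 1) → Plane) → ℂ)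
    (p : Fin m → Plane) : ℂ :=
  ((((m : ℝ) + 1) * coupling lamHat ε : ℝ) : ℂ) *
    ∫ q : Plane, ((modeWeight v ε q : ℝ) : ℂ) *
      ψ (Fin.snoc (α := fun _ => Plane) p q) * ((cross q (∑ k, p k) : ℝ) : ℂ)

theorem annihilation_eq_annih {ρ : 𝓢(Plane, ℝ)} (hρ : IsMollifier ρ) (lamHat : ℝ) {ε : ℝ}
    (hε : 0 < ε) {m : ℕ} (ψ : (Fin (m + 1) → Plane) → ℂ) :
    annihilation ρ lamHat ε ψ = annih (specProfile ρ) lamHat ε ψ := by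
  funext p
  simp only [annihilation, annih, modeWeight, hρ.covHat_eq hε]

theorem prod_snoc_growth {m : ℕ} (k : ℕ) (p : Fin m → Plane) (q : Plane) :
    ∏ i, ‖(Fin.snoc (α := fun _ => Plane) p q : Fin (m + 1) → Plane) i‖ *
        (1 + ‖(Fin.snoc (α := fun _ => Plane) p q : Fin (m + 1) → Plane) i‖) ^ k =
      (∏ i, ‖p i‖ * (1 + ‖p i‖) ^ k) * (‖q‖ * (1 + ‖q‖) ^ k) := by
  rw [Fin.prod_univ_castSucc]; simp

theorem measurable_snoc (m : ℕ) : Measurable fun z : (Fin m → Plane) × Plane =>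
    (Fin.snoc (α := fun _ => Plane) z.1 z.2 : Fin (m + 1) → Plane) := by
  refine measurable_pi_lambda _ fun j => ?_
  refine Fin.lastCases ?_ (fun j => ?_) j
  · simpa using measurable_snd
  · simpa [Function.comp_def] using (measurable_pi_apply j).comp measurable_fst

theorem IsKernel.annih {k m : ℕ} {ψ : (Fin (m + 1) → Plane) → ℂ} (h : IsKernel k ψ)
    (hv : IsProfile v C₀) (lamHat : ℝ) {ε : ℝ} (hε : 0 < ε) :
    IsKernel (k + 1) (annih v lamHat ε ψ) := by
  obtain ⟨C, hC, hg⟩ := h.growth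
  have hint := (integrable_modeMeasure hv ε _).1 (integrable_modeMeasure_growth hv hε k)
  set I := ∫ q : Plane, modeWeight v ε q • (‖q‖ ^ 2 * (1 + ‖q‖) ^ k) with hI
  have hI0 : 0 ≤ I := integral_nonneg fun q =>
    mul_nonneg (hv.modeWeight_nonneg ε q) (by positivity)
  refine ⟨?_, fun σ p => ?_, |((m : ℝ) + 1) * coupling lamHat ε| * (C * I), by positivity,
    fun p => ?_⟩
  · have h1 := hv.measurable_modeWeight ε
    have h2 := h.measurable.comp (measurable_snoc m)
    have h3 : Measurable fun z : (Fin m → Plane) × Plane => ((modeWeight v ε z.2 : ℝ) : ℂ) *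
      ψ (Fin.snoc (α := fun _ => Plane) z.1 z.2) * ((cross z.2 (∑ k, z.1 k) : ℝ) : ℂ) :=
      ((by fun_prop : Measurable fun z : (Fin m → Plane) × Plane =>
        ((modeWeight v ε z.2 : ℝ) : ℂ)).mul h2).mul (by fun_prop)
    exact (h3.stronglyMeasurable.integral_prod_right' (ν := volume)).measurable.const_mul _
  · simp only [CurlGFF.annih, h.symm.snoc_comp, Function.comp_apply]
    rw [Equiv.sum_comp σ p]
  · rw [CurlGFF.annih, norm_mul, Complex.norm_real, Real.norm_eq_abs, mul_assoc]
    gcongr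
    have h2 := one_add_norm_sum_le_prod p
    refine (norm_integral_le_of_norm_le (hint.const_mul (C * ∏ i, ‖p i‖ * (1 + ‖p i‖) ^ (k + 1)))
      (Eventually.of_forall fun q => ?_)).trans_eq ?_
    · have hw := hv.modeWeight_nonneg ε q
      rw [norm_mul, norm_mul, Complex.norm_real, Complex.norm_real, Real.norm_eq_abs,
        Real.norm_eq_abs, abs_of_nonneg hw]
      calc _ ≤ modeWeight v ε q * (C * ((∏ i, ‖p i‖ * (1 + ‖p i‖) ^ k) *
            (‖q‖ * (1 + ‖q‖) ^ k))) * (‖q‖ * ∏ i, (1 + ‖p i‖)) := by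
              gcongr
              · rw [← prod_snoc_growth]; exact hg _
              · refine (abs_cross_le _ _).trans ?_
                gcongr
                linarith
        _ = _ := by
              simp only [Finset.prod_mul_distrib, pow_succ, smul_eq_mul]
              ring
    · rw [integral_const_mul, ← hI]; ring

theorem integrable_modesMeasure_growth (hv : IsProfile v C₀) {ε : ℝ} (hε : 0 < ε) (m l : ℕ) :
    Integrable (fun p : Fin m → Plane => ∏ i, ‖p i‖ ^ 2 * (1 + ‖p i‖) ^ l)
      (modesMeasure v ε m) :=
  Integrable.fintype_prod (f := fun _ q => ‖q‖ ^ 2 * (1 + ‖q‖) ^ l)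
    fun _ => integrable_modeMeasure_growth hv hε l

theorem integrable_mul_of_growth {k l m : ℕ} {ψ χ : (Fin m → Plane) → ℂ} {C C' : ℝ}
    (hψ : Measurable ψ) (hχ : Measurable χ) (hC : 0 ≤ C)
    (hg : ∀ p, ‖ψ p‖ ≤ C * ∏ i, ‖p i‖ * (1 + ‖p i‖) ^ k)
    (hg' : ∀ p, ‖χ p‖ ≤ C' * ∏ i, ‖p i‖ * (1 + ‖p i‖) ^ l) (hv : IsProfile v C₀) {ε : ℝ}
    (hε : 0 < ε) : Integrable (fun p => conj (ψ p) * χ p) (modesMeasure v ε m) := by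
  refine ((integrable_modesMeasure_growth hv hε m (k + l)).const_mul (C * C')).mono' ?_
    (Eventually.of_forall fun p => ?_)
  · exact ((Complex.continuous_conj.measurable.comp hψ).mul hχ).aestronglyMeasurable
  · rw [norm_mul, RCLike.norm_conj]
    calc _ ≤ (C * ∏ i, ‖p i‖ * (1 + ‖p i‖) ^ k) * (C' * ∏ i, ‖p i‖ * (1 + ‖p i‖) ^ l) := by
          gcongr
          · exact hg p
          · exact hg' p
      _ = _ := by
          simp only [Finset.prod_mul_distrib, pow_add, sq]
          ring

theorem IsKernel.integrable_mul {k l m : ℕ} {ψ χ : (Fin m → Plane) → ℂ} (h : IsKernel k ψ)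
    (h' : IsKernel l χ) (hv : IsProfile v C₀) {ε : ℝ} (hε : 0 < ε) :
    Integrable (fun p => conj (ψ p) * χ p) (modesMeasure v ε m) := by
  obtain ⟨C, hC, hg⟩ := h.growth
  obtain ⟨C', -, hg'⟩ := h'.growth
  exact integrable_mul_of_growth h.measurable h'.measurable hC hg hg' hv hε

theorem IsKernel.integrable_sq {k m : ℕ} {ψ : (Fin m → Plane) → ℂ} (h : IsKernel k ψ)
    (hv : IsProfile v C₀) {ε : ℝ} (hε : 0 < ε) :
    Integrable (fun p => ‖ψ p‖ ^ 2) (modesMeasure v ε m) := by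
  refine (h.integrable_mul h hv hε).norm.congr (Eventually.of_forall fun p => ?_)
  simp [sq]

/-- `𝓐₋` is minus the adjoint of `𝓐₊`. -/
theorem creation_adjoint {k l m : ℕ} {ψ : (Fin m → Plane) → ℂ} {F : (Fin (m + 1) → Plane) → ℂ}
    (h : IsKernel k ψ) (hF : IsKernel l F) (hv : IsProfile v C₀) (lamHat : ℝ) {ε : ℝ}
    (hε : 0 < ε) :
    ((m : ℂ) + 1) * ∫ p, conj (creation lamHat ε ψ p) * F p ∂(modesMeasure v ε (m + 1)) =
      -∫ p, conj (ψ p) * annih v lamHat ε F p ∂(modesMeasure v ε m) := by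
  obtain ⟨C, hC, hg⟩ := h.growth
  obtain ⟨C', -, hg'⟩ := hF.growth
  set μ := modeMeasure v ε
  set G : Fin (m + 1) → (Fin (m + 1) → Plane) → ℂ := fun i p =>
    conj (((cross (p i) (∑ j, p j) : ℝ) : ℂ) * ψ (fun j => p (i.succAbove j))) * F p with hG
  have hGi : ∀ i, Integrable (G i) (modesMeasure v ε (m + 1)) := fun i => by
    refine integrable_mul_of_growth (k := k + 1) ?_ hF.measurable hC (fun p => ?_) hg' hv hε
    · exact Measurable.mul (by fun_prop) (h.measurable.comp (by fun_prop))
    · exact (norm_creation_term_le hg p i).trans (sum_mul_growth_le k hC p)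
  -- Once the `i`-th variable is singled out as `z.1`, symmetry of `F` makes every `G i` the same
  -- function `J`; the `m + 1` equal integrals cancel the `1/(m+1)` of `𝓐₊`.
  set J : Plane × (Fin m → Plane) → ℂ := fun z =>
    conj (ψ z.2) * (F (Fin.snoc (α := fun _ => Plane) z.2 z.1) *
      ((cross z.1 (∑ j, z.2 j) : ℝ) : ℂ)) with hJ
  have hmp := fun i : Fin (m + 1) => (measurePreserving_piFinSuccAbove (fun _ => μ) i).symm
  have hGJ : ∀ i z, G i ((MeasurableEquiv.piFinSuccAbove (fun _ => Plane) i).symm z) = J z := by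
    intro i z
    have hins : (MeasurableEquiv.piFinSuccAbove (fun _ => Plane) i).symm z =
        i.insertNth (α := fun _ => Plane) z.1 z.2 := rfl
    simp only [hG, hJ, hins, Fin.insertNth_apply_same, Fin.insertNth_apply_succAbove,
      hF.symm.insertNth, Fin.sum_univ_succAbove _ i, cross_add_right, cross_self, zero_add,
      map_mul, Complex.conj_ofReal]
    ring
  have hGint : ∀ i, ∫ p, G i p ∂(modesMeasure v ε (m + 1)) =
      ∫ z, J z ∂(μ.prod (modesMeasure v ε m)) := fun i => by
    rw [modesMeasure, ← (hmp i).integral_comp']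
    exact integral_congr_ae (Eventually.of_forall fun z => hGJ i z)
  have hJi : Integrable J (μ.prod (modesMeasure v ε m)) := by
    refine (((hmp 0).integrable_comp_emb (MeasurableEquiv.measurableEmbedding _)).2
      (hGi 0)).congr (Eventually.of_forall fun z => hGJ 0 z)
  have hcre : ∀ p, conj (creation lamHat ε ψ p) * F p =
      -((1 / ((m : ℝ) + 1) * coupling lamHat ε : ℝ) : ℂ) * ∑ i, G i p := by
    intro p
    simp only [creation, hG, map_mul, map_neg, Complex.conj_ofReal, map_sum, Finset.mul_sum,
      Finset.sum_mul]
    exact Finset.sum_congr rfl fun i _ => by ring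
  have hann : ∀ p, conj (ψ p) * annih v lamHat ε F p =
      ((((m : ℝ) + 1) * coupling lamHat ε : ℝ) : ℂ) * ∫ q, J (q, p) ∂μ := by
    intro p
    rw [annih, integral_modeMeasure hv, mul_left_comm, ← integral_const_mul]
    congr 1
    refine integral_congr_ae (Eventually.of_forall fun q => ?_)
    simp only [hJ, Complex.real_smul]
    ring
  simp_rw [hcre, hann]
  rw [integral_const_mul, integral_const_mul, integral_finsetSum _ fun i _ => hGi i,
    ← integral_prod_symm _ hJi]
  simp only [hGint]
  rw [Finset.sum_const, Finset.card_univ, Fintype.card_fin, nsmul_eq_mul]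
  have : (m : ℂ) + 1 ≠ 0 := by exact_mod_cast Nat.succ_ne_zero m
  push_cast
  field_simp

end Profile

section

/-! ### The Schur test -/

theorem lintegral_mul_sq_le {X : Type*} [MeasurableSpace X] (μ : Measure X) {f g : X → ℝ≥0∞}
    (hf : AEMeasurable f μ) (hg : AEMeasurable g μ) :
    (∫⁻ x, f x * g x ∂μ) ^ 2 ≤ (∫⁻ x, f x ^ 2 ∂μ) * ∫⁻ x, g x ^ 2 ∂μ := by
  have h := ENNReal.lintegral_mul_le_Lp_mul_Lq μ Real.HolderConjugate.two_two hf hg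
  simp only [Pi.mul_apply, ENNReal.rpow_two] at h
  refine (pow_le_pow_left' h 2).trans_eq ?_
  rw [mul_pow, ← ENNReal.rpow_two, ← ENNReal.rpow_two, ← ENNReal.rpow_mul, ← ENNReal.rpow_mul]
  norm_num

/-- Write `K g = (K w)^{1/2} (K g²/w)^{1/2}` and apply Cauchy–Schwarz; the first factor is bounded
by `h1`, and after Tonelli the second by `h2`. The weight may vanish only on a null set. -/
theorem schur_test {X : Type*} [MeasurableSpace X] (μ : Measure X) [SFinite μ]
    {K : X → X → ℝ≥0∞} (hK : Measurable (Function.uncurry K)) {w : X → ℝ≥0∞} (hw : Measurable w)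
    (hw0 : ∀ᵐ x ∂μ, w x ≠ 0) (hwt : ∀ x, w x ≠ ∞) {C : ℝ≥0∞}
    (h1 : ∀ x, ∫⁻ y, K x y * w y ∂μ ≤ C * w x) (h2 : ∀ y, ∫⁻ x, K x y * w x ∂μ ≤ C * w y)
    {g : X → ℝ≥0∞} (hg : Measurable g) :
    ∫⁻ x, (∫⁻ y, K x y * g y ∂μ) ^ 2 ∂μ ≤ C ^ 2 * ∫⁻ x, g x ^ 2 ∂μ := by
  have hKx : ∀ x, Measurable (K x) := fun x => hK.of_uncurry_left
  have hsq : ∀ a : ℝ≥0∞, (a ^ (1 / 2 : ℝ)) ^ 2 = a := fun a => by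
    rw [← ENNReal.rpow_two, ← ENNReal.rpow_mul]; norm_num
  have hcs : ∀ x, (∫⁻ y, K x y * g y ∂μ) ^ 2 ≤
      C * w x * ∫⁻ y, K x y * (g y ^ 2 * (w y)⁻¹) ∂μ := by
    intro x
    have e : ∫⁻ y, K x y * g y ∂μ = ∫⁻ y, (K x y * w y) ^ (1 / 2 : ℝ) *
        (K x y * (g y ^ 2 * (w y)⁻¹)) ^ (1 / 2 : ℝ) ∂μ := by
      refine lintegral_congr_ae ?_
      filter_upwards [hw0] with y hy
      rw [← ENNReal.mul_rpow_of_nonneg _ _ (by norm_num)]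
      have : K x y * w y * (K x y * (g y ^ 2 * (w y)⁻¹)) =
          (K x y * g y) ^ 2 * (w y * (w y)⁻¹) := by ring
      rw [this, ENNReal.mul_inv_cancel hy (hwt y), mul_one, ← ENNReal.rpow_two,
        ← ENNReal.rpow_mul]
      norm_num
    rw [e]
    refine (lintegral_mul_sq_le μ ?_ ?_).trans ?_
    · exact (((hKx x).mul hw).pow_const _).aemeasurable
    · exact (((hKx x).mul ((hg.pow_const _).mul hw.inv)).pow_const _).aemeasurable
    · simp_rw [hsq]
      gcongr
      exact h1 x
  calc ∫⁻ x, (∫⁻ y, K x y * g y ∂μ) ^ 2 ∂μ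
      ≤ ∫⁻ x, ∫⁻ y, C * (g y ^ 2 * (w y)⁻¹) * (K x y * w x) ∂μ ∂μ := by
        refine lintegral_mono fun x => (hcs x).trans_eq ?_
        have hm : Measurable fun y => K x y * (g y ^ 2 * (w y)⁻¹) :=
          (hKx x).mul ((hg.pow_const 2).mul hw.inv)
        rw [← lintegral_const_mul _ hm]
        exact lintegral_congr fun y => by ring
    _ = ∫⁻ y, ∫⁻ x, C * (g y ^ 2 * (w y)⁻¹) * (K x y * w x) ∂μ ∂μ := by
        refine lintegral_lintegral_swap (Measurable.aemeasurable ?_)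
        have := hw.inv
        exact ((((hg.pow_const 2).mul hw.inv).comp measurable_snd).const_mul C).mul
          (hK.mul (hw.comp measurable_fst))
    _ ≤ ∫⁻ y, C ^ 2 * g y ^ 2 ∂μ := by
        refine lintegral_mono_ae ?_
        filter_upwards [hw0] with y hy
        have hm : Measurable fun x => K x y * w x := hK.of_uncurry_right.mul hw
        rw [lintegral_const_mul _ hm]
        calc _ ≤ C * (g y ^ 2 * (w y)⁻¹) * (C * w y) := by gcongr; exact h2 y
          _ = C ^ 2 * g y ^ 2 * (w y * (w y)⁻¹) := by ring
          _ = _ := by rw [ENNReal.mul_inv_cancel hy (hwt y), mul_one]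
    _ = _ := lintegral_const_mul _ (hg.pow_const _)

/-! ### The off-diagonal kernel -/

/-- The kernel dominating the exchange of a momentum `a` for `q`, at total momentum `T`. -/
def exchangeKernel (a q T : Plane) : ℝ := min ‖a‖ ‖T‖ * min ‖q‖ ‖T‖ / ‖T‖ ^ 2

theorem exchangeKernel_nonneg (a q T : Plane) : 0 ≤ exchangeKernel a q T := by
  unfold exchangeKernel; positivity

theorem exchangeKernel_comm (a q T : Plane) : exchangeKernel a q T = exchangeKernel q a T := by
  unfold exchangeKernel; ring

@[fun_prop]
theorem Measurable.exchangeKernel {X : Type*} [MeasurableSpace X] {f g h : X → Plane}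
    (hf : Measurable f) (hg : Measurable g) (hh : Measurable h) :
    Measurable fun x => CurlGFF.exchangeKernel (f x) (g x) (h x) := by
  unfold CurlGFF.exchangeKernel
  fun_prop

variable {v : Plane → ℝ} {C₀ : ℝ}

/-- The kernel is at most `2|a|/(|a|+|b+q|)`. Replacing `|b+q|` by `|q|`, or `|q|` by `|b+q|`,
according to which is smaller, leaves a pole of order `3/2` at `q = 0` or at `q = -b`, both of width
`|a|`. -/
theorem exchangeKernel_weight_le (hv : IsProfile v C₀) (ε : ℝ) {a : Plane} (ha : a ≠ 0)
    (b : Plane) {q : Plane} (hq : q ≠ 0) :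
    modeWeight v ε q * (exchangeKernel a q (b + q) * √‖q‖) ≤ 2 * C₀ * √‖a‖ *
      (‖a‖⁻¹ ^ 2 * strongPole (‖a‖⁻¹ • q) + ‖a‖⁻¹ ^ 2 * strongPole (‖a‖⁻¹ • (b + q))) := by
  have hC := hv.const_nonneg
  have hA : 0 < ‖a‖ := norm_pos_iff.2 ha
  have hr : 0 < ‖q‖ := norm_pos_iff.2 hq
  have hs1 := strongPole_nonneg (‖a‖⁻¹ • q)
  have hs2 := strongPole_nonneg (‖a‖⁻¹ • (b + q))
  rcases eq_or_ne (b + q) 0 with hT0 | hT0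
  · have hk0 : exchangeKernel a q (b + q) = 0 := by rw [exchangeKernel, hT0]; simp
    rw [hk0, zero_mul, mul_zero]
    positivity
  have hT : 0 < ‖b + q‖ := norm_pos_iff.2 hT0
  have hsp : ∀ z : Plane, z ≠ 0 → ‖a‖⁻¹ ^ 2 * strongPole (‖a‖⁻¹ • z) =
      √‖a‖ * (1 / (‖z‖ * √‖z‖ * (‖a‖ + ‖z‖))) := by
    intro z hz
    have hz : 0 < ‖z‖ := norm_pos_iff.2 hz
    have h1 : ‖‖a‖⁻¹ • z‖ = ‖z‖ / ‖a‖ := by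
      rw [norm_smul, norm_inv, norm_norm]; field_simp
    have h2 : √(‖z‖ / ‖a‖) = √‖z‖ / √‖a‖ := Real.sqrt_div hz.le _
    have h3 : √‖a‖ ^ 2 = ‖a‖ := Real.sq_sqrt hA.le
    have h4 : 0 < √‖a‖ := Real.sqrt_pos.2 hA
    have h5 : 0 < √‖z‖ := Real.sqrt_pos.2 hz
    rw [strongPole, h1, h2]
    field_simp
  rw [hsp q hq, hsp _ hT0]
  set A := ‖a‖
  set r := ‖q‖
  set t := ‖b + q‖
  have hsr : 0 < √r := Real.sqrt_pos.2 hr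
  have hst : 0 < √t := Real.sqrt_pos.2 hT
  have hk : exchangeKernel a q (b + q) ≤ 2 * A / (A + t) := by
    have h1 : min r t / t ≤ 1 := by rw [div_le_one hT]; exact min_le_right _ _
    have h2 : min A t / t ≤ 2 * A / (A + t) := by
      rw [div_le_div_iff₀ hT (by positivity)]
      rcases le_total A t with h | h
      · rw [min_eq_left h]; nlinarith
      · rw [min_eq_right h]; nlinarith
    calc exchangeKernel a q (b + q) = min A t / t * (min r t / t) := by
          change min A t * min r t / t ^ 2 = _
          ring
      _ ≤ min A t / t * 1 := by gcongr
      _ ≤ _ := by rw [mul_one]; exact h2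
  have hw : modeWeight v ε q ≤ C₀ / r ^ 2 := by
    rw [le_div_iff₀ (by positivity)]; exact hv.modeWeight_mul_le_const ε q
  have hkey : √r / r ^ 2 * (1 / (A + t)) ≤
      1 / (r * √r * (A + r)) + 1 / (t * √t * (A + t)) := by
    have e : √r / r ^ 2 = 1 / (r * √r) := by
      have := Real.sq_sqrt hr.le
      field_simp
      linarith
    rw [e, one_div_mul_one_div]
    rcases le_total r t with h | h
    · have : 1 / (r * √r * (A + t)) ≤ 1 / (r * √r * (A + r)) := by gcongr
      have : 0 ≤ 1 / (t * √t * (A + t)) := by positivity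
      linarith
    · have : 1 / (r * √r * (A + t)) ≤ 1 / (t * √t * (A + t)) := by gcongr
      have : 0 ≤ 1 / (r * √r * (A + r)) := by positivity
      linarith
  have hsA : √A * √A = A := Real.mul_self_sqrt hA.le
  calc _ ≤ C₀ / r ^ 2 * (2 * A / (A + t) * √r) := by
        gcongr
        exact mul_nonneg (exchangeKernel_nonneg _ _ _) hsr.le
    _ = 2 * C₀ * A * (√r / r ^ 2 * (1 / (A + t))) := by ring
    _ ≤ 2 * C₀ * A * (1 / (r * √r * (A + r)) + 1 / (t * √t * (A + t))) := by gcongr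
    _ = _ := by
        calc _ = 2 * C₀ * (√A * √A) * (1 / (r * √r * (A + r)) + 1 / (t * √t * (A + t))) := by
              rw [hsA]
          _ = _ := by ring

/-- The hypothesis of the Schur test for the weight `√|q|`: dilation by `|a|` yields `√|a|` times a
constant independent of `ε`, `a` and `b`. Without the weight the integral would diverge
logarithmically. -/
theorem lintegral_exchangeKernel_le (hv : IsProfile v C₀) (ε : ℝ) (a b : Plane) :
    ∫⁻ q, ENNReal.ofReal (exchangeKernel a q (b + q)) * ENNReal.ofReal √‖q‖ ∂(modeMeasure v ε) ≤
      ENNReal.ofReal (4 * C₀ * ∫ q, strongPole q) * ENNReal.ofReal √‖a‖ := by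
  have hC := hv.const_nonneg
  have hI : 0 ≤ ∫ q, strongPole q := integral_nonneg fun q => strongPole_nonneg q
  rcases eq_or_ne a 0 with rfl | ha
  · simp [exchangeKernel]
  have hA : 0 < ‖a‖ := norm_pos_iff.2 ha
  have hm := hv.measurable_modeWeight ε
  rw [modeMeasure, lintegral_withDensity_eq_lintegral_mul _ hm.ennreal_ofReal (by fun_prop)]
  set R : Plane → ℝ := fun q => 2 * C₀ * √‖a‖ *
      (‖a‖⁻¹ ^ 2 * strongPole (‖a‖⁻¹ • q) + ‖a‖⁻¹ ^ 2 * strongPole (‖a‖⁻¹ • (b + q))) with hR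
  have hi1 := integrable_comp_smul_plane integrable_strongPole (inv_pos.2 hA)
  have hi2 : Integrable fun q => ‖a‖⁻¹ ^ 2 * strongPole (‖a‖⁻¹ • (b + q)) :=
    hi1.comp_add_left b
  have hRi : Integrable R := (hi1.add hi2).const_mul _
  have hR0 : ∀ q, 0 ≤ R q := fun q => by
    have h1 := strongPole_nonneg (‖a‖⁻¹ • q)
    have h2 := strongPole_nonneg (‖a‖⁻¹ • (b + q))
    positivity
  calc _ ≤ ∫⁻ q, ENNReal.ofReal (R q) := by
        refine lintegral_mono_ae ?_
        filter_upwards [Measure.ae_ne volume (0 : Plane)] with q hq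
        rw [Pi.mul_apply, ← ENNReal.ofReal_mul (exchangeKernel_nonneg _ _ _),
          ← ENNReal.ofReal_mul (hv.modeWeight_nonneg ε q)]
        exact ENNReal.ofReal_le_ofReal (exchangeKernel_weight_le hv ε ha b hq)
    _ = ENNReal.ofReal (∫ q, R q) :=
        (ofReal_integral_eq_lintegral_ofReal hRi (Eventually.of_forall hR0)).symm
    _ = _ := by
        rw [← ENNReal.ofReal_mul (by positivity)]
        congr 1
        rw [hR, integral_const_mul, integral_add hi1 hi2,
          integral_add_left_eq_self (fun q => ‖a‖⁻¹ ^ 2 * strongPole (‖a‖⁻¹ • q)) b,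
          integral_comp_smul_plane _ (inv_pos.2 hA)]
        ring

/-- The exchange of one momentum is bounded in `L²`, uniformly in the cutoff. -/
theorem lintegral_exchange_sq_le (hv : IsProfile v C₀) (ε : ℝ) {m : ℕ} (i : Fin m)
    {f : (Fin m → Plane) → ℝ≥0∞} (hf : Measurable f) :
    ∫⁻ p, (∫⁻ q, ENNReal.ofReal (exchangeKernel (p i) q (∑ j, p j + q)) *
        f (Function.update p i q) ∂(modeMeasure v ε)) ^ 2 ∂(modesMeasure v ε m) ≤
      ENNReal.ofReal (4 * C₀ * ∫ q, strongPole q) ^ 2 * ∫⁻ p, f p ^ 2 ∂(modesMeasure v ε m) := by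
  set C := ENNReal.ofReal (4 * C₀ * ∫ q, strongPole q)
  rw [← lintegral_const_mul _ (hf.pow_const 2), modesMeasure]
  have hup : Measurable fun z : (Fin m → Plane) × Plane => Function.update z.1 i z.2 :=
    measurable_update'
  have hjoint : Measurable fun z : (Fin m → Plane) × Plane =>
      ENNReal.ofReal (exchangeKernel (z.1 i) z.2 (∑ j, z.1 j + z.2)) *
        f (Function.update z.1 i z.2) := by
    refine Measurable.mul (Measurable.ennreal_ofReal ?_) (hf.comp hup)
    fun_prop
  -- All momenta but the `i`-th are frozen; `r` is their sum, and it enters only as a shift, to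
  -- which the Schur bound is insensitive.
  refine lintegral_le_of_lmarginal_le {i} ?_ ?_ ?_
  · exact (hjoint.lintegral_prod_right' (ν := modeMeasure v ε)).pow_const 2
  · exact (hf.pow_const 2).const_mul _
  intro p
  rw [lmarginal_singleton, lmarginal_singleton]
  have hup1 : Measurable (Function.update p i) := measurable_update p
  have hm : Measurable fun a => f (Function.update p i a) ^ 2 := (hf.comp hup1).pow_const 2
  beta_reduce
  rw [lintegral_const_mul _ hm]
  set r : Plane := ∑ j ∈ Finset.univ \ {i}, p j
  have hsum : ∀ a, ∑ j, Function.update p i a j = a + r := fun a =>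
    Finset.sum_update_of_mem (Finset.mem_univ i) p a
  simp only [hsum, Function.update_self, Function.update_idem]
  refine schur_test (modeMeasure v ε)
    (K := fun a q => ENNReal.ofReal (exchangeKernel a q (a + r + q)))
    (w := fun q => ENNReal.ofReal √‖q‖) ?_ (by fun_prop) ?_ (fun _ => ENNReal.ofReal_ne_top)
    ?_ ?_ (hf.comp hup1)
  · exact Measurable.ennreal_ofReal (by fun_prop)
  · refine (withDensity_absolutelyContinuous _ _).ae_le ?_
    filter_upwards [Measure.ae_ne volume (0 : Plane)] with q hq
    simpa using hq
  · exact fun a => lintegral_exchangeKernel_le hv ε a (a + r)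
  · intro q
    have := lintegral_exchangeKernel_le hv ε q (r + q)
    refine le_trans (le_of_eq (lintegral_congr fun a => ?_)) this
    rw [exchangeKernel_comm, add_comm (r + q), add_assoc]

end

section

/-! ### The operator `𝓐₋ S 𝓐₊` -/

variable {v : Plane → ℝ} {C₀ : ℝ}

theorem symb_eq (ν : ℝ) {m : ℕ} (p : Fin m → Plane) : symb ν p = ν ^ 2 / 2 * ‖∑ i, p i‖ ^ 2 := rfl

theorem IsSymbol.abs_mul_le {lamHat lam ε : ℝ} {S s : ℝ → ℝ} {B : ℝ}
    (h : IsSymbol lamHat lam ε S s B) (hlam : 0 < lam) {c : ℝ} (hc : 0 < c) {x : ℝ} (hx : 0 ≤ x) :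
    |S (c * x ^ 2)| * x ≤ B * (1 + 1 / lam) * (1 / lam + 1 / c) := by
  have hB := h.lipBdd.nonneg
  have h1 := h.abs_le hlam (x := c * x ^ 2) (by positivity)
  have h2 : x ≤ (1 / lam + 1 / c) * (lam + c * x ^ 2) := by
    have e : (1 / lam + 1 / c) * (lam + c * x ^ 2) = 1 + x ^ 2 + lam / c + c * x ^ 2 / lam := by
      field_simp; ring
    rw [e]
    have : 0 ≤ lam / c := by positivity
    have : 0 ≤ c * x ^ 2 / lam := by positivity
    nlinarith [sq_nonneg (x - 1)]
  calc _ ≤ B * (1 + 1 / lam) / (lam + c * x ^ 2) * ((1 / lam + 1 / c) * (lam + c * x ^ 2)) := by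
        gcongr
    _ = _ := by field_simp

theorem prod_norm_update {m : ℕ} (p : Fin m → Plane) (i : Fin m) (q : Plane) :
    ∏ j, ‖Function.update p i q j‖ = ‖q‖ * ∏ j ∈ Finset.univ.erase i, ‖p j‖ := by
  rw [← Finset.mul_prod_erase _ _ (Finset.mem_univ i), Function.update_self]
  congr 1
  exact Finset.prod_congr rfl fun j hj => by
    rw [Function.update_of_ne (Finset.ne_of_mem_erase hj)]

/-- Splitting of `𝓐₋ S 𝓐₊` into its diagonal and off-diagonal parts. -/
theorem annih_creation_eq (hv : IsProfile v C₀) {lamHat ν lam ε : ℝ} (hlam : 0 < lam) (hε : 0 < ε)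
    {S s : ℝ → ℝ} {B : ℝ} (hS : IsSymbol lamHat lam ε S s B) {m : ℕ} {ψ : (Fin m → Plane) → ℂ}
    (h : IsKernel 0 ψ) (p : Fin m → Plane) :
    annih v lamHat ε (fun p => ((S (symb ν p) : ℝ) : ℂ) * creation lamHat ε ψ p) p =
      -((coupling lamHat ε ^ 2 : ℝ) : ℂ) *
        (((∫ q : Plane, modeWeight v ε q * cross q (∑ j, p j) ^ 2 *
            S (ν ^ 2 / 2 * ‖∑ j, p j + q‖ ^ 2) : ℝ) : ℂ) * ψ p +
          ∑ i, ∫ q, ((S (ν ^ 2 / 2 * ‖∑ j, p j + q‖ ^ 2) * cross q (∑ j, p j) *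
            cross (p i) (∑ j, p j + q) : ℝ) : ℂ) * ψ (Function.update p i q)
              ∂(modeMeasure v ε)) := by
  obtain ⟨C, hC, hg⟩ := h.growth
  set P := ∑ j, p j with hP
  have hB := hS.lipBdd.nonneg
  set D := B * (1 + 1 / lam) / lam
  have hD : 0 ≤ D := by positivity
  have hSD : ∀ q : Plane, |S (ν ^ 2 / 2 * ‖P + q‖ ^ 2)| ≤ D := fun q => by
    refine (hS.abs_le hlam (by positivity)).trans ?_
    have : 0 ≤ ν ^ 2 / 2 * ‖P + q‖ ^ 2 := by positivity
    exact div_le_div_of_nonneg_left (by positivity) hlam (by linarith)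
  have hSm := hS.measurable
  have hd : Integrable fun q : Plane => modeWeight v ε q * cross q P ^ 2 *
      S (ν ^ 2 / 2 * ‖P + q‖ ^ 2) := by
    have h0 := (integrable_modeMeasure hv ε _).1 (integrable_modeMeasure_growth hv hε 0)
    refine (h0.mul_const (‖P‖ ^ 2 * D)).mono' ?_ (Eventually.of_forall fun q => ?_)
    · have := hv.measurable_modeWeight ε
      exact Measurable.aestronglyMeasurable (by fun_prop)
    · have hw := hv.modeWeight_nonneg ε q
      rw [Real.norm_eq_abs, abs_mul, abs_mul, abs_of_nonneg hw, abs_of_nonneg (sq_nonneg _)]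
      calc _ ≤ modeWeight v ε q * (‖q‖ ^ 2 * ‖P‖ ^ 2) * D := by
            gcongr
            · exact cross_sq_le q P
            · exact hSD q
        _ = _ := by simp; ring
  have ho : ∀ i, Integrable (fun q => ((S (ν ^ 2 / 2 * ‖P + q‖ ^ 2) * cross q P *
      cross (p i) (P + q) : ℝ) : ℂ) * ψ (Function.update p i q)) (modeMeasure v ε) := by
    intro i
    have h1 := integrable_modeMeasure_growth hv hε 1
    set A := ∏ j ∈ Finset.univ.erase i, ‖p j‖
    have hA : 0 ≤ A := Finset.prod_nonneg fun j _ => norm_nonneg _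
    refine (h1.mul_const (D * ‖P‖ * (‖p i‖ * (1 + ‖P‖)) * (C * A))).mono' ?_
      (Eventually.of_forall fun q => ?_)
    · exact Measurable.aestronglyMeasurable
        ((by fun_prop : Measurable fun q => ((S (ν ^ 2 / 2 * ‖P + q‖ ^ 2) * cross q P *
          cross (p i) (P + q) : ℝ) : ℂ)).mul (h.measurable.comp (measurable_update p)))
    · have h2 := hg (Function.update p i q)
      simp only [pow_zero, mul_one] at h2
      rw [prod_norm_update] at h2
      have h3 : ‖P + q‖ ≤ (1 + ‖P‖) * (1 + ‖q‖) := by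
        have := norm_add_le P q
        nlinarith [norm_nonneg P, norm_nonneg q, mul_nonneg (norm_nonneg P) (norm_nonneg q)]
      rw [norm_mul, Complex.norm_real, Real.norm_eq_abs, abs_mul, abs_mul]
      calc _ ≤ D * (‖q‖ * ‖P‖) * (‖p i‖ * ((1 + ‖P‖) * (1 + ‖q‖))) * (C * (‖q‖ * A)) := by
            gcongr
            · exact hSD q
            · exact abs_cross_le q P
            · exact (abs_cross_le _ _).trans (by gcongr)
        _ = _ := by ring
  have ho' := fun i => (integrable_modeMeasure hv ε _).1 (ho i)
  have hd' : Integrable fun q : Plane => ((modeWeight v ε q * cross q P ^ 2 *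
      S (ν ^ 2 / 2 * ‖P + q‖ ^ 2) : ℝ) : ℂ) * ψ p := hd.ofReal.mul_const _
  have hsum := integrable_finsetSum Finset.univ fun i _ => ho' i
  rw [annih, ← integral_complex_ofReal, ← integral_mul_const]
  simp only [integral_modeMeasure hv]
  rw [← integral_finsetSum _ fun i _ => ho' i, ← integral_add hd' hsum,
    ← integral_const_mul, ← integral_const_mul]
  refine integral_congr_ae (Eventually.of_forall fun q => ?_)
  have hm : (m : ℂ) + 1 ≠ 0 := by exact_mod_cast Nat.succ_ne_zero m
  simp only [creation_snoc lamHat ε h.symm, symb_eq, sum_snoc, ← hP, Complex.real_smul]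
  push_cast
  simp only [mul_add, add_mul, Finset.mul_sum, Finset.sum_mul]
  congr 1
  · field_simp
    ring
  · refine Finset.sum_congr rfl fun i _ => ?_
    field_simp
    ring

/-- With `T = P + q` one has `q×P = T×P` and `a×T = a×(T-a) = T×(T-a)`. Taking the better form of
each extracts `|P|` and `|T-a|`, the total momenta after and before the exchange, and leaves the
minima of `exchangeKernel`; `S` supplies `|T|⁻²`. -/
theorem abs_exchange_le {lamHat lam ε c : ℝ} (hlam : 0 < lam) (hc : 0 < c) {S s : ℝ → ℝ} {B : ℝ}
    (hS : IsSymbol lamHat lam ε S s B) (a q P : Plane) :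
    |S (c * ‖P + q‖ ^ 2) * cross q P * cross a (P + q)| ≤
      B * (1 + 1 / lam) / c * ‖P‖ * (exchangeKernel a q (P + q) * ‖P + q - a‖) := by
  have hB := hS.lipBdd.nonneg
  set T := P + q with hT
  rcases eq_or_ne T 0 with hT0 | hT0
  · rw [hT0, cross_zero_right, mul_zero, abs_zero]
    have := exchangeKernel_nonneg a q 0
    positivity
  have hTp : 0 < ‖T‖ := norm_pos_iff.2 hT0
  have h1 : |cross q P| ≤ min ‖q‖ ‖T‖ * ‖P‖ := by
    have e : cross q P = cross T P := by rw [hT, cross_add_left, cross_self, zero_add]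
    rcases min_choice ‖q‖ ‖T‖ with h | h
    · rw [h]; exact abs_cross_le q P
    · rw [h, e]; exact abs_cross_le T P
  have h2 : |cross a T| ≤ min ‖a‖ ‖T‖ * ‖T - a‖ := by
    have e1 : cross a T = cross a (T - a) := by
      simp [cross]; ring
    have e2 : cross a T = cross T (T - a) := by
      simp [cross]; ring
    rcases min_choice ‖a‖ ‖T‖ with h | h
    · rw [h, e1]; exact abs_cross_le _ _
    · rw [h, e2]; exact abs_cross_le _ _
  have h3 : |S (c * ‖T‖ ^ 2)| ≤ B * (1 + 1 / lam) / (c * ‖T‖ ^ 2) := by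
    refine (hS.abs_le hlam (by positivity)).trans ?_
    exact div_le_div_of_nonneg_left (by positivity) (by positivity) (by linarith)
  rw [abs_mul, abs_mul]
  calc _ ≤ B * (1 + 1 / lam) / (c * ‖T‖ ^ 2) * (min ‖q‖ ‖T‖ * ‖P‖) * (min ‖a‖ ‖T‖ * ‖T - a‖) := by
        gcongr
    _ = _ := by rw [exchangeKernel]; field_simp

theorem ENNReal_add_sq_le (a b : ℝ≥0∞) : (a + b) ^ 2 ≤ 2 * (a ^ 2 + b ^ 2) := by
  have := ENNReal.rpow_add_le_mul_rpow_add_rpow a b (p := 2) (by norm_num)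
  norm_num at this
  exact this

theorem ENNReal_sum_sq_le {ι : Type*} (s : Finset ι) (f : ι → ℝ≥0∞) :
    (∑ i ∈ s, f i) ^ 2 ≤ s.card * ∑ i ∈ s, f i ^ 2 := by
  have := ENNReal.rpow_sum_le_const_mul_sum_rpow s f (p := 2) (by norm_num)
  norm_num at this
  exact this

/-- The diagonal estimate for the direction of `P`, multiplied by `|P|²`; with `c = ν²/2` the factor
`|P|²/c` is `c|P|² · 4/ν⁴`. -/
theorem diag_estimate_vec (hv : IsProfile v C₀) {lamHat ν lam B : ℝ}
    (hlamHat : 0 < lamHat) (hlam : 0 < lam) (hν : 0 < ν) : ∃ C, 0 ≤ C ∧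
    ∀ ε, 0 < ε → ε ≤ 1 / 2 → ∀ S s, IsSymbol lamHat lam ε S s B → ∀ P : Plane,
    |coupling lamHat ε ^ 2 * (∫ q : Plane, modeWeight v ε q * cross q P ^ 2 *
        S (ν ^ 2 / 2 * ‖P + q‖ ^ 2)) -
      ν ^ 2 / 2 * ‖P‖ ^ 2 * (4 / ν ^ 4 *
        ∫ y in (0 : ℝ)..Leps lamHat ε (lam + ν ^ 2 / 2 * ‖P‖ ^ 2), s y)| ≤
        C * coupling lamHat ε ^ 2 * ‖P‖ ^ 2 := by
  obtain ⟨C, hC, hest⟩ := diag_estimate hv (B := B) hlamHat hlam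
    (by positivity : 0 < ν ^ 2 / 2)
  refine ⟨C, hC, fun ε hε hε2 S s hS P => ?_⟩
  rcases eq_or_ne P 0 with rfl | hP
  · simp [cross_zero_right]
  have hPn : 0 < ‖P‖ := norm_pos_iff.2 hP
  have := hest ε hε hε2 S s hS (‖P‖⁻¹ • P) (by rw [norm_smul, norm_inv, norm_norm,
    inv_mul_cancel₀ hPn.ne']) ‖P‖ hPn.le
  rw [smul_smul, mul_inv_cancel₀ hPn.ne', one_smul] at this
  have e : (∫ q : Plane, modeWeight v ε q * cross q P ^ 2 * S (ν ^ 2 / 2 * ‖P + q‖ ^ 2)) =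
      ‖P‖ ^ 2 * ∫ q : Plane, v (ε • q) / ‖q‖ ^ 2 * cross q (‖P‖⁻¹ • P) ^ 2 *
        S (ν ^ 2 / 2 * ‖P + q‖ ^ 2) := by
    rw [← integral_const_mul]
    refine integral_congr_ae (Eventually.of_forall fun q => ?_)
    simp only [modeWeight, cross_smul_right]
    field_simp
  rw [e]
  set I := ∫ q : Plane, v (ε • q) / ‖q‖ ^ 2 * cross q (‖P‖⁻¹ • P) ^ 2 *
        S (ν ^ 2 / 2 * ‖P + q‖ ^ 2)
  set H := ∫ y in (0 : ℝ)..Leps lamHat ε (lam + ν ^ 2 / 2 * ‖P‖ ^ 2), s y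
  have e2 : coupling lamHat ε ^ 2 * (‖P‖ ^ 2 * I) - ν ^ 2 / 2 * ‖P‖ ^ 2 * (4 / ν ^ 4 * H) =
      ‖P‖ ^ 2 * (coupling lamHat ε ^ 2 * I - 1 / (ν ^ 2 / 2) * H) := by
    field_simp; ring
  rw [e2, abs_mul, abs_of_nonneg (sq_nonneg ‖P‖), mul_comm]
  gcongr

/-- The difference between `𝓐₋ S 𝓐₊` and its limit. -/
def defect (v : Plane → ℝ) (lamHat ν lam ε : ℝ) (S s : ℝ → ℝ) {m : ℕ} (ψ : (Fin m → Plane) → ℂ)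
    (p : Fin m → Plane) : ℂ :=
  annih v lamHat ε (fun p => ((S (symb ν p) : ℝ) : ℂ) * creation lamHat ε ψ p) p +
    ((symb ν p * (4 / ν ^ 4 * ∫ y in (0 : ℝ)..Leps lamHat ε (lam + symb ν p), s y) : ℝ) : ℂ) * ψ p

/-- The defect has norm `O(κ²)` from the energy space to its dual. Diagonal and exchange errors both
carry one factor of total momentum outside, paid by `1/(λ+x)`, and one next to `ψ`, paid by its
energy. -/
theorem lintegral_defect_le (hv : IsProfile v C₀) {lamHat ν lam : ℝ} (B : ℝ)
    (hlamHat : 0 < lamHat) (hν : 0 < ν) (hlam : 0 < lam) (m : ℕ) : ∃ C, 0 ≤ C ∧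
    ∀ ε, 0 < ε → ε ≤ 1 / 2 → ∀ S s, IsSymbol lamHat lam ε S s B →
    ∀ ψ : (Fin m → Plane) → ℂ, IsKernel 0 ψ →
    ∫⁻ p, ENNReal.ofReal (1 / (lam + symb ν p) * ‖defect v lamHat ν lam ε S s ψ p‖ ^ 2)
        ∂(modesMeasure v ε m) ≤
      ENNReal.ofReal (C * coupling lamHat ε ^ 4) *
        ∫⁻ p, ENNReal.ofReal ((lam + symb ν p) * ‖ψ p‖ ^ 2) ∂(modesMeasure v ε m) := by
  obtain ⟨C₁, hC₁, hdiag⟩ := diag_estimate_vec hv (B := B) hlamHat hlam hν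
  have hC₀ := hv.const_nonneg
  have hI : 0 ≤ ∫ q, strongPole q := integral_nonneg fun q => strongPole_nonneg q
  set c := ν ^ 2 / 2 with hc
  have hc0 : 0 < c := by positivity
  set C₂ := |B * (1 + 1 / lam) / c|
  set C₃ := 4 * C₀ * ∫ q, strongPole q
  set C₄ := max C₁ C₂
  have hC₄ : 0 ≤ C₄ := hC₁.trans (le_max_left _ _)
  -- The two factors `1/c` trade total momenta for energies; `2` and the first `m` come from
  -- squaring sums, `m C₃²` from `m` Schur bounds.
  refine ⟨C₄ ^ 2 / c * (2 * (1 + m * (m * C₃ ^ 2))) / c, by positivity, ?_⟩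
  intro ε hε hε2 S s hS ψ hψ
  set κ := coupling lamHat ε
  set f : (Fin m → Plane) → ℝ := fun p => ‖∑ j, p j‖ * ‖ψ p‖ with hf
  have hf0 : ∀ p, 0 ≤ f p := fun p => by positivity
  have hfm : Measurable f := by
    have := hψ.measurable
    fun_prop
  set N : Fin m → (Fin m → Plane) → ℝ≥0∞ := fun i p =>
    ∫⁻ q, ENNReal.ofReal (exchangeKernel (p i) q (∑ j, p j + q)) *
      ENNReal.ofReal (f (Function.update p i q)) ∂(modeMeasure v ε) with hN
  have hNm : ∀ i, Measurable (N i) := fun i => by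
    have h1 : Measurable fun z : (Fin m → Plane) × Plane =>
        ENNReal.ofReal (exchangeKernel (z.1 i) z.2 (∑ j, z.1 j + z.2)) *
          ENNReal.ofReal (f (Function.update z.1 i z.2)) := by
      refine Measurable.mul (Measurable.ennreal_ofReal (by fun_prop)) ?_
      exact (hfm.comp (measurable_update' (a := i))).ennreal_ofReal
    exact h1.lintegral_prod_right' (ν := modeMeasure v ε)
  have hpt : ∀ p, ‖defect v lamHat ν lam ε S s ψ p‖ₑ ≤
      ENNReal.ofReal (C₄ * κ ^ 2 * ‖∑ j, p j‖) * (ENNReal.ofReal (f p) + ∑ i, N i p) := by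
    intro p
    set P := ∑ j, p j with hP
    set I := ∫ q : Plane, modeWeight v ε q * cross q P ^ 2 * S (c * ‖P + q‖ ^ 2)
    set H := ∫ y in (0 : ℝ)..Leps lamHat ε (lam + c * ‖P‖ ^ 2), s y
    set O : Fin m → ℂ := fun i => ∫ q, ((S (c * ‖P + q‖ ^ 2) * cross q P *
            cross (p i) (P + q) : ℝ) : ℂ) * ψ (Function.update p i q) ∂(modeMeasure v ε) with hO
    have e : defect v lamHat ν lam ε S s ψ p =
        -((κ ^ 2 * I - c * ‖P‖ ^ 2 * (4 / ν ^ 4 * H) : ℝ) : ℂ) * ψ p -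
          ((κ ^ 2 : ℝ) : ℂ) * ∑ i, O i := by
      rw [defect, annih_creation_eq hv hlam hε hS hψ p]
      simp only [symb_eq, ← hP, ← hc]
      change -((κ ^ 2 : ℝ) : ℂ) * ((I : ℂ) * ψ p + ∑ i, O i) +
        ((c * ‖P‖ ^ 2 * (4 / ν ^ 4 * H) : ℝ) : ℂ) * ψ p = _
      generalize ∑ i, O i = z
      push_cast
      ring
    have h1 : ‖-((κ ^ 2 * I - c * ‖P‖ ^ 2 * (4 / ν ^ 4 * H) : ℝ) : ℂ) * ψ p‖ₑ ≤
        ENNReal.ofReal (C₄ * κ ^ 2 * ‖P‖) * ENNReal.ofReal (f p) := by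
      rw [← ofReal_norm, ← ENNReal.ofReal_mul (by positivity)]
      refine ENNReal.ofReal_le_ofReal ?_
      rw [norm_mul, norm_neg, Complex.norm_real, Real.norm_eq_abs]
      calc _ ≤ C₁ * κ ^ 2 * ‖P‖ ^ 2 * ‖ψ p‖ := by gcongr; exact hdiag ε hε hε2 S s hS P
        _ ≤ C₄ * κ ^ 2 * ‖P‖ ^ 2 * ‖ψ p‖ := by gcongr; exact le_max_left _ _
        _ = _ := by rw [hf]; ring
    have h2 : ∀ i, ‖((κ ^ 2 : ℝ) : ℂ) * O i‖ₑ ≤ ENNReal.ofReal (C₄ * κ ^ 2 * ‖P‖) * N i p := by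
      intro i
      rw [hO, ← integral_const_mul]
      refine (enorm_integral_le_lintegral_enorm _).trans ?_
      rw [hN, ← lintegral_const_mul]
      · refine lintegral_mono fun q => ?_
        rw [← ENNReal.ofReal_mul (exchangeKernel_nonneg _ _ _), ← ofReal_norm,
          ← ENNReal.ofReal_mul (by positivity)]
        refine ENNReal.ofReal_le_ofReal ?_
        have hsum : ∑ j, Function.update p i q j = P + q - p i := by
          rw [Finset.sum_update_of_mem (Finset.mem_univ i), hP,
            ← Finset.sum_sdiff (Finset.subset_univ {i}), Finset.sum_singleton]
          abel
        have hfu : f (Function.update p i q) = ‖P + q - p i‖ * ‖ψ (Function.update p i q)‖ := by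
          rw [hf]; simp only [hsum]
        rw [norm_mul, norm_mul, Complex.norm_real, Complex.norm_real, Real.norm_eq_abs,
          Real.norm_eq_abs, abs_of_nonneg (sq_nonneg κ), hfu]
        have hk := exchangeKernel_nonneg (p i) q (P + q)
        have h3 : |S (c * ‖P + q‖ ^ 2) * cross q P * cross (p i) (P + q)| ≤
            C₄ * ‖P‖ * (exchangeKernel (p i) q (P + q) * ‖P + q - p i‖) := by
          refine (abs_exchange_le hlam hc0 hS (p i) q P).trans ?_
          gcongr
          exact (le_abs_self _).trans (le_max_right _ _)
        calc _ ≤ κ ^ 2 * (C₄ * ‖P‖ * (exchangeKernel (p i) q (P + q) * ‖P + q - p i‖) *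
              ‖ψ (Function.update p i q)‖) := by gcongr
          _ = _ := by ring
      · refine Measurable.mul (Measurable.ennreal_ofReal (by fun_prop)) ?_
        exact (hfm.comp (measurable_update p)).ennreal_ofReal
    rw [e, mul_add, Finset.mul_sum]
    refine enorm_sub_le.trans (add_le_add h1 ?_)
    rw [Finset.mul_sum]
    exact (enorm_sum_le _ _).trans (Finset.sum_le_sum fun i _ => h2 i)
  have hpt2 : ∀ p, ENNReal.ofReal (1 / (lam + symb ν p) * ‖defect v lamHat ν lam ε S s ψ p‖ ^ 2) ≤
      ENNReal.ofReal (C₄ ^ 2 * κ ^ 4 / c) * (2 * (ENNReal.ofReal (f p) ^ 2 +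
        m * ∑ i, N i p ^ 2)) := by
    intro p
    have hs := symb_nonneg ν p
    have hs' : c * ‖∑ j, p j‖ ^ 2 = symb ν p := rfl
    rw [ENNReal.ofReal_mul (by positivity), ENNReal.ofReal_pow (norm_nonneg _),
      ofReal_norm]
    calc _ ≤ ENNReal.ofReal (1 / (lam + symb ν p)) * (ENNReal.ofReal (C₄ * κ ^ 2 * ‖∑ j, p j‖) *
          (ENNReal.ofReal (f p) + ∑ i, N i p)) ^ 2 := by gcongr; exact hpt p
      _ = ENNReal.ofReal (1 / (lam + symb ν p) * (C₄ * κ ^ 2 * ‖∑ j, p j‖) ^ 2) *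
          (ENNReal.ofReal (f p) + ∑ i, N i p) ^ 2 := by
            rw [mul_pow, ENNReal.ofReal_mul (p := 1 / (lam + symb ν p)) (by positivity),
              ENNReal.ofReal_pow (by positivity)]
            ring
      _ ≤ _ := by
            gcongr
            · rw [div_mul_eq_mul_div, one_mul, div_le_div_iff₀ (by positivity) hc0]
              calc (C₄ * κ ^ 2 * ‖∑ j, p j‖) ^ 2 * c = C₄ ^ 2 * κ ^ 4 * (c * ‖∑ j, p j‖ ^ 2) := by
                    ring
                _ ≤ C₄ ^ 2 * κ ^ 4 * (lam + symb ν p) := by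
                    rw [hs']
                    gcongr
                    linarith
            · refine (ENNReal_add_sq_le _ _).trans ?_
              gcongr
              simpa using ENNReal_sum_sq_le Finset.univ (fun i => N i p)
  set π := modesMeasure v ε m with hπ
  set J := ∫⁻ p, ENNReal.ofReal (f p) ^ 2 ∂π with hJ
  have hN2 : ∀ i, ∫⁻ p, N i p ^ 2 ∂π ≤ ENNReal.ofReal C₃ ^ 2 * J := fun i =>
    lintegral_exchange_sq_le hv ε i hfm.ennreal_ofReal
  have hJle : J ≤ ENNReal.ofReal (1 / c) *
      ∫⁻ p, ENNReal.ofReal ((lam + symb ν p) * ‖ψ p‖ ^ 2) ∂π := by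
    rw [hJ, ← lintegral_const_mul _ (Measurable.ennreal_ofReal (by
      have := hψ.measurable
      have := measurable_symb ν m
      fun_prop))]
    refine lintegral_mono fun p => ?_
    rw [← ENNReal.ofReal_pow (hf0 p), ← ENNReal.ofReal_mul (by positivity)]
    refine ENNReal.ofReal_le_ofReal ?_
    have hs' : c * ‖∑ j, p j‖ ^ 2 = symb ν p := rfl
    rw [← hs', hf, mul_pow]
    calc _ = 1 / c * (c * ‖∑ j, p j‖ ^ 2 * ‖ψ p‖ ^ 2) := by field_simp
      _ ≤ _ := by gcongr; linarith
  calc _ ≤ ∫⁻ p, ENNReal.ofReal (C₄ ^ 2 * κ ^ 4 / c) * (2 * (ENNReal.ofReal (f p) ^ 2 +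
        m * ∑ i, N i p ^ 2)) ∂π := lintegral_mono hpt2
    _ = ENNReal.ofReal (C₄ ^ 2 * κ ^ 4 / c) * (2 * (J + m * ∑ i, ∫⁻ p, N i p ^ 2 ∂π)) := by
        have hm1 : Measurable fun p => ENNReal.ofReal (f p) ^ 2 := hfm.ennreal_ofReal.pow_const 2
        have hm2 : Measurable fun p => ∑ i, N i p ^ 2 :=
          Finset.measurable_fun_sum _ fun i _ => (hNm i).pow_const 2
        have hm3 : Measurable fun p => ENNReal.ofReal (f p) ^ 2 + m * ∑ i, N i p ^ 2 :=
          hm1.add (hm2.const_mul _)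
        rw [lintegral_const_mul _ (hm3.const_mul _),
          lintegral_const_mul _ hm3, lintegral_add_left hm1,
          lintegral_const_mul _ hm2, lintegral_finsetSum _ fun i _ => (hNm i).pow_const 2]
    _ ≤ ENNReal.ofReal (C₄ ^ 2 * κ ^ 4 / c) *
        (2 * (J + m * ∑ _i : Fin m, ENNReal.ofReal C₃ ^ 2 * J)) := by
        gcongr with i
        exact hN2 i
    _ = ENNReal.ofReal (C₄ ^ 2 / c * (2 * (1 + m * (m * C₃ ^ 2))) * κ ^ 4) * J := by
        rw [Finset.sum_const, Finset.card_univ, Fintype.card_fin, nsmul_eq_mul,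
          ← ENNReal.ofReal_pow (by positivity)]
        have e : C₄ ^ 2 / c * (2 * (1 + m * (m * C₃ ^ 2))) * κ ^ 4 =
          C₄ ^ 2 * κ ^ 4 / c * (2 * (1 + m * (m * C₃ ^ 2))) := by ring
        rw [e, ENNReal.ofReal_mul (p := C₄ ^ 2 * κ ^ 4 / c) (by positivity),
          ENNReal.ofReal_mul (p := 2) (by norm_num),
          ENNReal.ofReal_add (by norm_num) (by positivity), ENNReal.ofReal_mul (by positivity),
          ENNReal.ofReal_mul (by positivity), ENNReal.ofReal_one, ENNReal.ofReal_natCast,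
          ENNReal.ofReal_ofNat]
        ring
    _ ≤ ENNReal.ofReal (C₄ ^ 2 / c * (2 * (1 + m * (m * C₃ ^ 2))) * κ ^ 4) *
        (ENNReal.ofReal (1 / c) *
          ∫⁻ p, ENNReal.ofReal ((lam + symb ν p) * ‖ψ p‖ ^ 2) ∂π) := by gcongr
    _ = _ := by
        rw [← mul_assoc, ← ENNReal.ofReal_mul (by positivity)]
        congr 2
        ring

end

section

variable {v : Plane → ℝ} {C₀ : ℝ}

/-! ### Energies -/

theorem IsKernel.integrable_energy {k m : ℕ} {ψ : (Fin m → Plane) → ℂ} (h : IsKernel k ψ)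
    (hv : IsProfile v C₀) {ε : ℝ} (hε : 0 < ε) {ν : ℝ} {T : ℝ → ℝ} (hT : Measurable T) {l : ℕ}
    {D : ℝ} (hD : ∀ x, 0 ≤ x → |T (ν ^ 2 / 2 * x ^ 2)| ≤ D * (1 + x) ^ l) :
    Integrable (fun p => T (symb ν p) * ‖ψ p‖ ^ 2) (modesMeasure v ε m) := by
  refine (h.integrable_mul (h.smul_symb hT hD) hv hε).re.congr (Eventually.of_forall fun p => ?_)
  simp only [RCLike.re_to_complex]
  rw [mul_left_comm, Complex.conj_mul']
  norm_cast

theorem affine_growth {ν lam x : ℝ} (hlam : 0 < lam) (hx : 0 ≤ x) :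
    |lam + ν ^ 2 / 2 * x ^ 2| ≤ (lam + ν ^ 2 / 2) * (1 + x) ^ 2 := by
  rw [abs_of_nonneg (by positivity)]
  nlinarith [mul_nonneg hlam.le hx, mul_nonneg hlam.le (sq_nonneg x),
    mul_nonneg (sq_nonneg ν) hx, mul_nonneg (sq_nonneg ν) (sq_nonneg x), sq_nonneg ν]

theorem inv_affine_growth {ν lam x : ℝ} (hlam : 0 < lam) :
    |1 / (lam + ν ^ 2 / 2 * x ^ 2)| ≤ 1 / lam * (1 + x) ^ 0 := by
  rw [abs_of_nonneg (by positivity), pow_zero, mul_one]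
  apply one_div_le_one_div_of_le hlam
  have : 0 ≤ ν ^ 2 / 2 * x ^ 2 := by positivity
  linarith

theorem IsSymbol.growth {lamHat lam ε ν : ℝ} {S s : ℝ → ℝ} {B : ℝ}
    (hS : IsSymbol lamHat lam ε S s B) (hlam : 0 < lam) {x : ℝ} :
    |S (ν ^ 2 / 2 * x ^ 2)| ≤ B * (1 + 1 / lam) / lam * (1 + x) ^ 0 := by
  have hB := hS.lipBdd.nonneg
  rw [pow_zero, mul_one]
  refine (hS.abs_le hlam (by positivity)).trans ?_
  have : 0 ≤ ν ^ 2 / 2 * x ^ 2 := by positivity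
  exact div_le_div_of_nonneg_left (by positivity) hlam (by linarith)

theorem IsLipBdd.measurable_primitive {s : ℝ → ℝ} {B : ℝ} (h : IsLipBdd s B) :
    Measurable fun x => ∫ y in (0 : ℝ)..x, s y :=
  (intervalIntegral.continuous_primitive (fun _ _ => h.continuous.intervalIntegrable _ _)
    0).measurable

theorem IsLipBdd.abs_primitive_le {s : ℝ → ℝ} {B : ℝ} (h : IsLipBdd s B) {x : ℝ} (hx : 0 ≤ x) :
    |∫ y in (0 : ℝ)..x, s y| ≤ B * x := by
  have := intervalIntegral.norm_integral_le_of_norm_le_const (a := 0) (b := x) (f := s) (C := B)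
    fun y _ => h.bound y
  simpa [abs_of_nonneg hx] using this

/-- The limiting symbol of `-𝓐₋ S 𝓐₊`. -/
def limitSymb (lamHat ν lam ε : ℝ) (s : ℝ → ℝ) (x : ℝ) : ℝ :=
  x * (4 / ν ^ 4 * ∫ y in (0 : ℝ)..Leps lamHat ε (lam + x), s y)

theorem measurable_limitSymb (lamHat ν lam ε : ℝ) {s : ℝ → ℝ} {B : ℝ} (h : IsLipBdd s B) :
    Measurable (limitSymb lamHat ν lam ε s) := by
  have h1 := (h.measurable_primitive.comp (measurable_Leps lamHat ε)).comp
    (measurable_const_add lam)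
  exact measurable_id.mul (h1.const_mul _)

theorem limitSymb_growth (lamHat : ℝ) {ν lam ε : ℝ} (hlam : 0 < lam) (hε : 0 < ε) {s : ℝ → ℝ}
    {B : ℝ} (h : IsLipBdd s B) {x : ℝ} (hx : 0 ≤ x) :
    |limitSymb lamHat ν lam ε s (ν ^ 2 / 2 * x ^ 2)| ≤
      ν ^ 2 / 2 * (4 / ν ^ 4 * (B * Leps lamHat ε lam)) * (1 + x) ^ 2 := by
  have hB := h.nonneg
  have hy : 0 ≤ ν ^ 2 / 2 * x ^ 2 := by positivity
  have h1 := h.abs_primitive_le (Leps_nonneg lamHat (ε := ε)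
    (by positivity : 0 ≤ lam + ν ^ 2 / 2 * x ^ 2))
  have h2 : Leps lamHat ε (lam + ν ^ 2 / 2 * x ^ 2) ≤ Leps lamHat ε lam :=
    Leps_anti lamHat hε hlam (by linarith)
  have h3 := Leps_nonneg lamHat (ε := ε) hlam.le
  rw [limitSymb, abs_mul (ν ^ 2 / 2 * x ^ 2), abs_mul (4 / ν ^ 4), abs_of_nonneg hy, abs_of_nonneg (by positivity : 0 ≤ 4 / ν ^ 4)]
  calc _ ≤ ν ^ 2 / 2 * (1 + x) ^ 2 * (4 / ν ^ 4 * (B * Leps lamHat ε lam)) := by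
        gcongr
        · linarith
        · exact h1.trans (by gcongr)
    _ = _ := by ring

theorem IsKernel.defect {m : ℕ} {ψ : (Fin m → Plane) → ℂ} (h : IsKernel 0 ψ)
    (hv : IsProfile v C₀) {lamHat ν lam ε : ℝ} (hν : 0 < ν) (hlam : 0 < lam) (hε : 0 < ε)
    {S s : ℝ → ℝ} {B : ℝ} (hS : IsSymbol lamHat lam ε S s B) :
    IsKernel 2 (defect v lamHat ν lam ε S s ψ) := by
  have h1 : IsKernel 0 fun p => ((S (symb ν p) : ℝ) : ℂ) * CurlGFF.creation lamHat ε ψ p :=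
    h.resolvent_creation lamHat ε hS.measurable fun x hx =>
      hS.abs_mul_le hlam (by positivity : 0 < ν ^ 2 / 2) hx
  have h2 := h.smul_symb (ν := ν) (measurable_limitSymb lamHat ν lam ε hS.lipBdd) fun x hx =>
    limitSymb_growth lamHat hlam hε hS.lipBdd hx
  exact ((h1.annih hv lamHat hε).mono (by norm_num)).add h2

theorem integral_defect_le (hv : IsProfile v C₀) {lamHat ν lam : ℝ} (B : ℝ)
    (hlamHat : 0 < lamHat) (hν : 0 < ν) (hlam : 0 < lam) (m : ℕ) : ∃ C, 0 ≤ C ∧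
    ∀ ε, 0 < ε → ε ≤ 1 / 2 → ∀ S s, IsSymbol lamHat lam ε S s B →
    ∀ ψ : (Fin m → Plane) → ℂ, IsKernel 0 ψ →
    ∫ p, 1 / (lam + symb ν p) * ‖defect v lamHat ν lam ε S s ψ p‖ ^ 2 ∂(modesMeasure v ε m) ≤
      C * coupling lamHat ε ^ 4 *
        ∫ p, (lam + symb ν p) * ‖ψ p‖ ^ 2 ∂(modesMeasure v ε m) := by
  obtain ⟨C, hC, hest⟩ := lintegral_defect_le hv B hlamHat hν hlam m
  refine ⟨C, hC, fun ε hε hε2 S s hS ψ hψ => ?_⟩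
  have h1 := (hψ.defect hv hν hlam hε hS).integrable_energy hv hε (ν := ν)
    (T := fun x => 1 / (lam + x)) (by fun_prop) fun x _ => inv_affine_growth hlam
  have h2 := hψ.integrable_energy hv hε (ν := ν) (T := fun x => lam + x) (by fun_prop)
    fun x hx => affine_growth hlam hx
  have h3 := hest ε hε hε2 S s hS ψ hψ
  have hs : ∀ p : Fin m → Plane, 0 ≤ symb ν p := symb_nonneg ν
  have hp1 : ∀ p, 0 ≤ 1 / (lam + symb ν p) * ‖defect v lamHat ν lam ε S s ψ p‖ ^ 2 := fun p => by
    have := hs p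
    positivity
  have hp2 : ∀ p, 0 ≤ (lam + symb ν p) * ‖ψ p‖ ^ 2 := fun p => by
    have := hs p
    positivity
  rw [← ofReal_integral_eq_lintegral_ofReal h1 (Eventually.of_forall hp1),
    ← ofReal_integral_eq_lintegral_ofReal h2 (Eventually.of_forall hp2),
    ← ENNReal.ofReal_mul (by positivity)] at h3
  exact (ENNReal.ofReal_le_ofReal_iff
    (mul_nonneg (by positivity) (integral_nonneg hp2))).1 h3

theorem coupling_sq_pos {lamHat ε : ℝ} (hlamHat : 0 < lamHat) (hε : 0 < ε) (hε1 : ε < 1) :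
    0 < coupling lamHat ε ^ 2 := by
  have h : Real.log ε < 0 := Real.log_neg hε hε1
  have : 0 < Real.log (1 / ε) := by rw [one_div, Real.log_inv]; linarith
  unfold coupling
  positivity

/-- The energy of `𝓐₊ ψ` against a symbol, in terms of energies of `ψ`. -/
theorem creation_energy_le (hv : IsProfile v C₀) {lamHat ν lam : ℝ} (B : ℝ)
    (hlamHat : 0 < lamHat) (hν : 0 < ν) (hlam : 0 < lam) (m : ℕ) : ∃ C, 0 ≤ C ∧
    ∀ ε, 0 < ε → ε ≤ 1 / 2 → ∀ S s, IsSymbol lamHat lam ε S s B →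
    ∀ ψ : (Fin m → Plane) → ℂ, IsKernel 0 ψ →
    |((m : ℝ) + 1) * (∫ p, S (symb ν p) * ‖creation lamHat ε ψ p‖ ^ 2
          ∂(modesMeasure v ε (m + 1))) -
        ∫ p, limitSymb lamHat ν lam ε s (symb ν p) * ‖ψ p‖ ^ 2 ∂(modesMeasure v ε m)| ≤
      C * coupling lamHat ε ^ 2 *
        ∫ p, (lam + symb ν p) * ‖ψ p‖ ^ 2 ∂(modesMeasure v ε m) := by
  obtain ⟨C, hC, hest⟩ := integral_defect_le hv B hlamHat hν hlam m
  -- Young's inequality with weight `κ²` balances the energy against the `C κ⁴` of the defect; each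
  -- half contributes at order `κ²`.
  refine ⟨(1 + C) / 2, by positivity, fun ε hε hε2 S s hS ψ hψ => ?_⟩
  set κ := coupling lamHat ε with hκ
  have hκ0 : 0 < κ ^ 2 := coupling_sq_pos hlamHat hε (by linarith)
  have hκne : κ ≠ 0 := fun h => by simp [h] at hκ0
  have hF : IsKernel 0 fun p => ((S (symb ν p) : ℝ) : ℂ) * creation lamHat ε ψ p :=
    hψ.resolvent_creation lamHat ε hS.measurable fun x hx =>
      hS.abs_mul_le hlam (by positivity : 0 < ν ^ 2 / 2) hx
  have hd := hψ.defect hv hν hlam hε hS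
  -- Adjointness turns the energy of `𝓐₊ψ` into minus the pairing of `ψ` with `𝓐₋ S 𝓐₊ ψ`, that is,
  -- the limiting energy minus the pairing with the defect.
  have hadj := creation_adjoint hψ hF hv lamHat hε
  have e1 : ∫ p, conj (creation lamHat ε ψ p) * (((S (symb ν p) : ℝ) : ℂ) * creation lamHat ε ψ p)
      ∂(modesMeasure v ε (m + 1)) = ((∫ p, S (symb ν p) * ‖creation lamHat ε ψ p‖ ^ 2
          ∂(modesMeasure v ε (m + 1)) : ℝ) : ℂ) := by
    rw [← integral_complex_ofReal]
    refine integral_congr_ae (Eventually.of_forall fun p => ?_)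
    simp only
    rw [mul_left_comm, Complex.conj_mul']
    norm_cast
  have hl := hψ.integrable_energy hv hε (ν := ν) (measurable_limitSymb lamHat ν lam ε hS.lipBdd)
    fun x hx => limitSymb_growth lamHat hlam hε hS.lipBdd hx
  have hl' : Integrable (fun p => ((limitSymb lamHat ν lam ε s (symb ν p) * ‖ψ p‖ ^ 2 : ℝ) : ℂ))
      (modesMeasure v ε m) := hl.ofReal
  have e2 : ∫ p, conj (ψ p) * annih v lamHat ε
        (fun p => ((S (symb ν p) : ℝ) : ℂ) * creation lamHat ε ψ p) p ∂(modesMeasure v ε m) =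
      (∫ p, conj (ψ p) * defect v lamHat ν lam ε S s ψ p ∂(modesMeasure v ε m)) -
        ((∫ p, limitSymb lamHat ν lam ε s (symb ν p) * ‖ψ p‖ ^ 2 ∂(modesMeasure v ε m) : ℝ) :
          ℂ) := by
    rw [← integral_complex_ofReal, ← integral_sub (hψ.integrable_mul hd hv hε) hl']
    refine integral_congr_ae (Eventually.of_forall fun p => ?_)
    have := Complex.conj_mul' (ψ p)
    simp only [defect, limitSymb, mul_add]
    push_cast
    linear_combination (-(symb ν p : ℂ) * (4 / (ν : ℂ) ^ 4 *
      ((∫ y in (0 : ℝ)..Leps lamHat ε (lam + symb ν p), s y : ℝ) : ℂ))) * this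
  rw [e1, e2] at hadj
  set X := ∫ p, S (symb ν p) * ‖creation lamHat ε ψ p‖ ^ 2 ∂(modesMeasure v ε (m + 1))
  set Y := ∫ p, limitSymb lamHat ν lam ε s (symb ν p) * ‖ψ p‖ ^ 2 ∂(modesMeasure v ε m)
  have e3 : (((((m : ℝ) + 1) * X - Y : ℝ)) : ℂ) =
      -∫ p, conj (ψ p) * defect v lamHat ν lam ε S s ψ p ∂(modesMeasure v ε m) := by
    push_cast
    linear_combination hadj
  rw [← Real.norm_eq_abs, ← Complex.norm_real, e3, norm_neg]
  have h1 := hd.integrable_energy hv hε (ν := ν)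
    (T := fun x => 1 / (lam + x)) (by fun_prop) fun x _ => inv_affine_growth hlam
  have h2 := hψ.integrable_energy hv hε (ν := ν) (T := fun x => lam + x) (by fun_prop)
    fun x hx => affine_growth hlam hx
  refine (norm_integral_le_of_norm_le
    ((h2.const_mul (κ ^ 2 / 2)).add (h1.const_mul (1 / (2 * κ ^ 2))))
    (Eventually.of_forall fun p => ?_)).trans ?_
  · have hs : 0 < lam + symb ν p := by linarith [symb_nonneg ν p]
    rw [norm_mul, RCLike.norm_conj, Pi.add_apply]
    set a := ‖ψ p‖
    set b := ‖defect v lamHat ν lam ε S s ψ p‖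
    set y := lam + symb ν p
    have : κ ^ 2 / 2 * (y * a ^ 2) + 1 / (2 * κ ^ 2) * (1 / y * b ^ 2) - a * b =
        (κ ^ 2 * y * a - b) ^ 2 / (2 * κ ^ 2 * y) := by field_simp; ring
    have h3 : 0 ≤ (κ ^ 2 * y * a - b) ^ 2 / (2 * κ ^ 2 * y) := by positivity
    linarith
  · rw [integral_add' (h2.const_mul _) (h1.const_mul _), integral_const_mul, integral_const_mul]
    have h4 := hest ε hε hε2 S s hS ψ hψ
    set Z := ∫ p, (lam + symb ν p) * ‖ψ p‖ ^ 2 ∂(modesMeasure v ε m)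
    calc _ ≤ κ ^ 2 / 2 * Z + 1 / (2 * κ ^ 2) * (C * κ ^ 4 * Z) := by gcongr
      _ = _ := by field_simp

end

/-! ### Calculus of bounded Lipschitz functions -/

theorem IsLipBdd.mono {s : ℝ → ℝ} {B B' : ℝ} (h : IsLipBdd s B) (hB : B ≤ B') : IsLipBdd s B' :=
  ⟨fun y => (h.bound y).trans hB,
    fun y z => (h.lip y z).trans (mul_le_mul_of_nonneg_right hB (abs_nonneg _))⟩

theorem isLipBdd_const (c : ℝ) : IsLipBdd (fun _ => c) |c| :=
  ⟨fun _ => le_rfl, fun y z => by simpa using mul_nonneg (abs_nonneg c) (abs_nonneg (y - z))⟩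

theorem IsLipBdd.mul {s t : ℝ → ℝ} {B B' : ℝ} (h : IsLipBdd s B) (h' : IsLipBdd t B') :
    IsLipBdd (fun x => s x * t x) (2 * (B * B')) := by
  have hB := h.nonneg
  have hB' := h'.nonneg
  constructor
  · intro y
    rw [abs_mul]
    have := mul_le_mul (h.bound y) (h'.bound y) (abs_nonneg _) hB
    nlinarith [mul_nonneg hB hB']
  · intro y z
    have e : s y * t y - s z * t z = s y * (t y - t z) + (s y - s z) * t z := by ring
    have h1 := mul_le_mul (h.bound y) (h'.lip y z) (abs_nonneg _) hB
    have h2 := mul_le_mul (h.lip y z) (h'.bound z) (abs_nonneg _)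
      (mul_nonneg hB (abs_nonneg _))
    rw [e]
    refine (abs_add_le _ _).trans ?_
    rw [abs_mul, abs_mul]
    nlinarith

/-- The operator `s ↦ (4/ν⁴) ∫₀ˣ s`, with `x` truncated to `[0, M]`. -/
def primOp (ν M : ℝ) (s : ℝ → ℝ) (x : ℝ) : ℝ := 4 / ν ^ 4 * ∫ y in (0 : ℝ)..max 0 (min x M), s y

theorem primOp_of_mem {ν M : ℝ} {s : ℝ → ℝ} {x : ℝ} (h0 : 0 ≤ x) (hM : x ≤ M) :
    primOp ν M s x = 4 / ν ^ 4 * ∫ y in (0 : ℝ)..x, s y := by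
  rw [primOp, min_eq_left hM, max_eq_right h0]

theorem primOp_zero (ν M : ℝ) : primOp ν M (fun _ => 0) = fun _ => 0 := by
  funext x; simp [primOp]

theorem abs_clamp_sub_le (M x y : ℝ) : |max 0 (min x M) - max 0 (min y M)| ≤ |x - y| := by
  refine (abs_max_sub_max_le_max _ _ _ _).trans ?_
  rw [sub_self, abs_zero, max_eq_right (abs_nonneg _)]
  refine (abs_min_sub_min_le_max _ _ _ _).trans ?_
  rw [sub_self, abs_zero, max_eq_left (abs_nonneg _)]

/-- A primitive of a bounded function is Lipschitz but need not be bounded; truncating the argument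
to `[0, M]` keeps it in the class, so the operator can be iterated. -/
theorem IsLipBdd.primOp {s : ℝ → ℝ} {B : ℝ} (h : IsLipBdd s B) (ν : ℝ) {M : ℝ} (hM : 0 ≤ M) :
    IsLipBdd (primOp ν M s) (4 / ν ^ 4 * B * (1 + M)) := by
  have hB := h.nonneg
  have hν : 0 ≤ 4 / ν ^ 4 := by positivity
  constructor
  · intro x
    rw [CurlGFF.primOp, abs_mul, abs_of_nonneg hν, mul_assoc]
    refine mul_le_mul_of_nonneg_left ((h.abs_primitive_le (le_max_left _ _)).trans ?_) hν
    refine mul_le_mul_of_nonneg_left ?_ hB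
    exact (max_le hM (min_le_right _ _)).trans (by linarith)
  · intro x y
    rw [CurlGFF.primOp, CurlGFF.primOp, ← mul_sub, abs_mul, abs_of_nonneg hν,
      intervalIntegral.integral_interval_sub_left (h.continuous.intervalIntegrable _ _)
        (h.continuous.intervalIntegrable _ _)]
    have := intervalIntegral.norm_integral_le_of_norm_le_const (a := max 0 (min y M))
      (b := max 0 (min x M)) (f := s) (C := B) fun y _ => h.bound y
    rw [Real.norm_eq_abs] at this
    calc _ ≤ 4 / ν ^ 4 * (B * |x - y|) := by
          gcongr
          exact this.trans (mul_le_mul_of_nonneg_left (abs_clamp_sub_le M x y) hB)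
      _ ≤ 4 / ν ^ 4 * (B * |x - y|) * (1 + M) :=
          le_mul_of_one_le_right (by positivity) (by linarith)
      _ = _ := by ring

/-! ### The functions `1 + (4/ν⁴) G_k` -/

/-- `1 + (4/ν⁴) G_k`, extended to the negative half line by a constant. -/
def gam (ν : ℝ) (k : ℕ) (x : ℝ) : ℝ := 1 + 4 / ν ^ 4 * Gfun ν k (max 0 x)

theorem gam_of_nonneg (ν : ℝ) (k : ℕ) {x : ℝ} (hx : 0 ≤ x) :
    gam ν k x = 1 + 4 / ν ^ 4 * Gfun ν k x := by rw [gam, max_eq_right hx]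

theorem Gfun_succ (ν : ℝ) {k : ℕ} (hk : 1 ≤ k) {x : ℝ} (hx : 0 ≤ x) :
    Gfun ν (k + 1) x = ∫ y in (0 : ℝ)..x, 1 / gam ν k y := by
  obtain ⟨j, rfl⟩ := Nat.exists_eq_add_of_le' hk
  rw [Gfun]
  refine intervalIntegral.integral_congr fun y hy => ?_
  rw [Set.uIcc_of_le hx] at hy
  simp only [gam_of_nonneg ν (j + 1) hy.1]

theorem isLipBdd_inv_of_lip {g : ℝ → ℝ} {a : ℝ} (h1 : ∀ x, 1 ≤ g x)
    (hl : ∀ x y, |g x - g y| ≤ a * |x - y|) : IsLipBdd (fun x => 1 / g x) (1 + a) := by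
  have ha : 0 ≤ a := by
    have := (abs_nonneg _).trans (hl 1 0)
    simpa using this
  constructor
  · intro x
    rw [abs_of_nonneg (by have := h1 x; positivity)]
    exact ((div_le_one (by linarith [h1 x])).2 (h1 x)).trans (by linarith)
  · intro x y
    have hx := h1 x
    have hy := h1 y
    have e : 1 / g x - 1 / g y = (g y - g x) / (g x * g y) := by field_simp
    rw [e, abs_div, abs_of_pos (by positivity : 0 < g x * g y)]
    refine (div_le_self (abs_nonneg _) (by nlinarith)).trans ?_
    rw [abs_sub_comm]
    exact (hl x y).trans (mul_le_mul_of_nonneg_right (by linarith) (abs_nonneg _))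

/-- The two claims need each other: the Lipschitz bound gives the continuity needed to integrate
`1/γ_k`, and `γ_k ≥ 1` confines that integrand to `[0, 1]`, hence the next Lipschitz constant. -/
theorem gam_aux (ν : ℝ) (k : ℕ) :
    (∀ x, 1 ≤ gam ν k x) ∧ ∀ x y, |gam ν k x - gam ν k y| ≤ 4 / ν ^ 4 * |x - y| := by
  have hν : 0 ≤ 4 / ν ^ 4 := by positivity
  have h0 : ∀ k, (∀ x, gam ν k x = 1) →
      (∀ x, 1 ≤ gam ν k x) ∧ ∀ x y, |gam ν k x - gam ν k y| ≤ 4 / ν ^ 4 * |x - y| := by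
    intro k h
    refine ⟨fun x => (h x).ge, fun x y => ?_⟩
    rw [h, h, sub_self, abs_zero]
    positivity
  induction k with
  | zero => exact h0 0 fun x => by simp [gam, Gfun]
  | succ k ih =>
    rcases Nat.eq_zero_or_pos k with rfl | hk
    · exact h0 1 fun x => by simp [gam, Gfun]
    have hL := isLipBdd_inv_of_lip ih.1 ih.2
    have e : ∀ x, gam ν (k + 1) x = 1 + 4 / ν ^ 4 * ∫ y in (0 : ℝ)..max 0 x, 1 / gam ν k y :=
      fun x => by rw [gam, Gfun_succ ν hk (le_max_left _ _)]
    have hi : ∀ a b : ℝ, IntervalIntegrable (fun y => 1 / gam ν k y) volume a b := fun a b =>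
      hL.continuous.intervalIntegrable _ _
    constructor
    · intro x
      rw [e]
      have : 0 ≤ ∫ y in (0 : ℝ)..max 0 x, 1 / gam ν k y :=
        intervalIntegral.integral_nonneg (le_max_left _ _) fun y _ => by
          have := ih.1 y
          positivity
      nlinarith
    · intro x y
      rw [e, e, add_sub_add_left_eq_sub, ← mul_sub, abs_mul, abs_of_nonneg hν,
        intervalIntegral.integral_interval_sub_left (hi _ _) (hi _ _)]
      have := intervalIntegral.norm_integral_le_of_norm_le_const (a := max 0 y)
        (b := max 0 x) (f := fun y => 1 / gam ν k y) (C := 1) fun y _ => by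
          have := ih.1 y
          rw [Real.norm_eq_abs, abs_of_nonneg (by positivity)]
          exact (div_le_one (by linarith)).2 this
      rw [Real.norm_eq_abs, one_mul] at this
      refine mul_le_mul_of_nonneg_left (this.trans ((abs_max_sub_max_le_max _ _ _ _).trans ?_)) hν
      rw [sub_self, abs_zero, max_eq_right (abs_nonneg _)]

theorem one_le_gam (ν : ℝ) (k : ℕ) (x : ℝ) : 1 ≤ gam ν k x := (gam_aux ν k).1 x

theorem isLipBdd_inv_gam (ν : ℝ) (k : ℕ) : IsLipBdd (fun x => 1 / gam ν k x) (1 + 4 / ν ^ 4) :=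
  isLipBdd_inv_of_lip (gam_aux ν k).1 (gam_aux ν k).2

theorem gam_succ (ν : ℝ) {k : ℕ} (hk : 1 ≤ k) {x : ℝ} (hx : 0 ≤ x) :
    gam ν (k + 1) x = 1 + 4 / ν ^ 4 * ∫ y in (0 : ℝ)..x, 1 / gam ν k y := by
  rw [gam_of_nonneg ν _ hx, Gfun_succ ν hk hx]

theorem continuous_gam (ν : ℝ) (k : ℕ) : Continuous (gam ν k) := by
  have h : gam ν k = fun x => (1 / gam ν k x)⁻¹ := by
    funext x; simp
  rw [h]
  refine (isLipBdd_inv_gam ν k).continuous.inv₀ fun x => ?_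
  have := one_le_gam ν k x
  positivity

/-! ### Symbols of the resolvents -/

/-- The symbol of the resolvent, as a measurable function on the line. -/
def resPos (lamHat ν lam ε : ℝ) (k : ℕ) (x : ℝ) : ℝ :=
  1 / (lam + x * gam ν k (Leps lamHat ε (lam + x)))

theorem resSymb_eq_resPos (lamHat ν : ℝ) {lam : ℝ} (hlam : 0 < lam) (ε : ℝ) (k : ℕ) {x : ℝ}
    (hx : 0 ≤ x) : resSymb lamHat ν lam ε k x = resPos lamHat ν lam ε k x := by
  rw [resSymb, resPos, gam_of_nonneg ν k (Leps_nonneg lamHat (by linarith))]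

theorem measurable_resPos (lamHat ν lam ε : ℝ) (k : ℕ) : Measurable (resPos lamHat ν lam ε k) := by
  have h1 := ((continuous_gam ν k).measurable.comp (measurable_Leps lamHat ε)).comp
    (measurable_const_add lam)
  exact ((measurable_id.mul h1).const_add lam).const_div 1

section Resolvent

variable {lamHat ν lam ε : ℝ} {k : ℕ} {x : ℝ}

theorem resPos_nonneg (hlam : 0 < lam) (hx : 0 ≤ x) : 0 ≤ resPos lamHat ν lam ε k x := by
  have := one_le_gam ν k (Leps lamHat ε (lam + x))
  unfold resPos; positivity

theorem resPos_le (hlam : 0 < lam) (hx : 0 ≤ x) :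
    resPos lamHat ν lam ε k x ≤ 1 / (lam + x) := by
  have := one_le_gam ν k (Leps lamHat ε (lam + x))
  unfold resPos
  apply one_div_le_one_div_of_le (by positivity)
  nlinarith

/-- The denominators `λ + x g` and `g (λ + x)` differ by `λ (g - 1)`, so moving `g` in front of `λ`
costs one order. -/
theorem abs_resPos_sub_le (hlam : 0 < lam) (hx : 0 ≤ x) :
    |resPos lamHat ν lam ε k x - 1 / gam ν k (Leps lamHat ε (lam + x)) / (lam + x)| ≤
      lam / (lam + x) ^ 2 := by
  unfold resPos
  set g := gam ν k (Leps lamHat ε (lam + x))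
  have hg : 1 ≤ g := one_le_gam _ _ _
  have hy : 0 < lam + x := by positivity
  have hy' : 0 < lam + x * g := by positivity
  have e : 1 / (lam + x * g) - 1 / g / (lam + x) =
      lam * ((g - 1) / (g * (lam + x) * (lam + x * g))) := by field_simp; ring
  rw [e, abs_of_nonneg (mul_nonneg hlam.le (div_nonneg (by linarith) (by positivity))),
    div_eq_mul_one_div lam]
  refine mul_le_mul_of_nonneg_left ?_ hlam.le
  rw [div_le_div_iff₀ (by positivity) (by positivity)]
  nlinarith [mul_nonneg (mul_nonneg (by linarith : 0 ≤ g) hy.le) (mul_nonneg hx (by linarith :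
    0 ≤ g - 1)), mul_pos hy hy]

theorem isSymbol_resPos (hlam : 0 < lam) (ν : ℝ) (k : ℕ) (ε : ℝ) :
    IsSymbol lamHat lam ε (resPos lamHat ν lam ε k) (fun x => 1 / gam ν k x)
      (1 + 4 / ν ^ 4 + lam) where
  measurable := measurable_resPos _ _ _ _ _
  lipBdd := (isLipBdd_inv_gam ν k).mono (by linarith)
  close x hx := (abs_resPos_sub_le hlam hx).trans (by
    have : 0 ≤ 4 / ν ^ 4 := by positivity
    gcongr
    linarith)

theorem isSymbol_one_div (hlam : 0 < lam) (ε : ℝ) :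
    IsSymbol lamHat lam ε (fun x => 1 / (lam + x)) (fun _ => 1) 1 where
  measurable := by fun_prop
  lipBdd := by simpa using isLipBdd_const 1
  close x hx := by
    rw [sub_self, abs_zero]
    positivity

/-- A symbol of order `-2` is pure error term, with leading profile zero; this is why the plain
norms vanish in the limit. -/
theorem isSymbol_resPos_sq (hlam : 0 < lam) (ν : ℝ) (k : ℕ) (ε : ℝ) :
    IsSymbol lamHat lam ε (fun x => resPos lamHat ν lam ε k x ^ 2) (fun _ => 0) 1 where
  measurable := (measurable_resPos _ _ _ _ _).pow_const 2
  lipBdd := by simpa using (isLipBdd_const 0).mono (by simp : |(0 : ℝ)| ≤ 1)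
  close x hx := by
    rw [zero_div, sub_zero, abs_of_nonneg (sq_nonneg _)]
    have := pow_le_pow_left₀ (resPos_nonneg hlam hx) (resPos_le (lamHat := lamHat) (ν := ν)
      (ε := ε) (k := k) hlam hx) 2
    rwa [div_pow, one_pow] at this

/-- The limiting symbol of `(λ - 𝓛₀) h(L^ε(λ - 𝓛₀)) R²`, where `R` is a resolvent. -/
def sqOp (ν : ℝ) (k : ℕ) (h : ℝ → ℝ) (x : ℝ) : ℝ := h x * (1 / gam ν k x * (1 / gam ν k x))

theorem isLipBdd_sqOp {h : ℝ → ℝ} {B : ℝ} (hh : IsLipBdd h B) (ν : ℝ) (k : ℕ) :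
    IsLipBdd (sqOp ν k h) (2 * (B * (2 * ((1 + 4 / ν ^ 4) * (1 + 4 / ν ^ 4))))) :=
  hh.mul ((isLipBdd_inv_gam ν k).mul (isLipBdd_inv_gam ν k))

theorem isSymbol_weighted_resPos_sq (hlam : 0 < lam) (ν : ℝ) (k : ℕ) {h : ℝ → ℝ} {B : ℝ}
    (hh : IsLipBdd h B) (ε : ℝ) :
    IsSymbol lamHat lam ε
      (fun x => (lam + x) * h (Leps lamHat ε (lam + x)) * resPos lamHat ν lam ε k x ^ 2)
      (sqOp ν k h)
      (2 * (B * (2 * ((1 + 4 / ν ^ 4) * (1 + 4 / ν ^ 4)))) + B * (2 * lam)) where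
  measurable := by
    have h1 := (hh.continuous.measurable.comp (measurable_Leps lamHat ε)).comp
      (measurable_const_add lam)
    exact ((measurable_const_add lam).mul h1).mul ((measurable_resPos _ _ _ _ _).pow_const 2)
  lipBdd := (isLipBdd_sqOp hh ν k).mono (by
    have := hh.nonneg
    have : 0 ≤ B * (2 * lam) := by positivity
    linarith)
  close x hx := by
    have hB := hh.nonneg
    have h1 := abs_resPos_sub_le (lamHat := lamHat) (ν := ν) (ε := ε) (k := k) hlam hx
    have h2 := resPos_nonneg (lamHat := lamHat) (ν := ν) (ε := ε) (k := k) hlam hx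
    have h3 := resPos_le (lamHat := lamHat) (ν := ν) (ε := ε) (k := k) hlam hx
    have hb := hh.bound (Leps lamHat ε (lam + x))
    unfold sqOp
    have hg := one_le_gam ν k (Leps lamHat ε (lam + x))
    set L := Leps lamHat ε (lam + x)
    set R := resPos lamHat ν lam ε k x
    set u := 1 / gam ν k L with hu
    have hu0 : 0 ≤ u := by positivity
    have hu1 : u ≤ 1 := (div_le_one (by linarith)).2 hg
    have hy : 0 < lam + x := by positivity
    set y := lam + x
    -- Difference of squares: the first factor is the error of the resolvent, the second is at most
    -- `2`. This is the origin of the summand `B * (2 * lam)`.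
    have e : y * h L * R ^ 2 - h L * (u * u) / y = h L * ((R - u / y) * (y * R + u)) := by
      field_simp; ring
    have h4 : y * R + u ≤ 2 := by
      have : y * R ≤ y * (1 / y) := mul_le_mul_of_nonneg_left h3 hy.le
      rw [mul_one_div_cancel hy.ne'] at this
      linarith
    rw [e, abs_mul, abs_mul, abs_of_nonneg (by positivity : 0 ≤ y * R + u)]
    calc _ ≤ B * (lam / y ^ 2 * 2) := by gcongr
      _ = B * (2 * lam) / y ^ 2 := by ring
      _ ≤ _ := by
        gcongr
        have : 0 ≤ 2 * (B * (2 * ((1 + 4 / ν ^ 4) * (1 + 4 / ν ^ 4)))) := by positivity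
        linarith

end Resolvent

/-! ### Scalar limits -/

theorem tendsto_log_inv_atTop : Tendsto (fun ε : ℝ => Real.log (1 / ε)) (𝓝[>] 0) atTop := by
  refine Real.tendsto_log_atTop.comp ?_
  exact tendsto_inv_nhdsGT_zero.congr fun x => (one_div x).symm

theorem tendsto_coupling_sq (lamHat : ℝ) :
    Tendsto (fun ε => coupling lamHat ε ^ 2) (𝓝[>] 0) (𝓝 0) := by
  have h : Tendsto (fun ε : ℝ => lamHat ^ 2 / Real.log (1 / ε)) (𝓝[>] 0) (𝓝 0) :=
    tendsto_log_inv_atTop.const_div_atTop _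
  refine h.congr' ?_
  filter_upwards [tendsto_log_inv_atTop.eventually_ge_atTop 0] with ε hε
  rw [coupling, div_pow, Real.sq_sqrt hε]

theorem eventually_small : ∀ᶠ ε : ℝ in 𝓝[>] 0, 0 < ε ∧ ε < 1 / 2 :=
  Ioo_mem_nhdsGT (by norm_num)

/-- `log (1 + 1/(ε²λ)) = log (ε² + 1/λ) + 2 log (1/ε)`, and the second term cancels `|log ε²|`. -/
theorem tendsto_Leps (lamHat : ℝ) {lam : ℝ} (hlam : 0 < lam) :
    Tendsto (fun ε => Leps lamHat ε lam) (𝓝[>] 0) (𝓝 (Real.pi * lamHat ^ 2)) := by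
  have h1 : Tendsto (fun ε : ℝ => Real.log (ε ^ 2 + 1 / lam)) (𝓝[>] 0) (𝓝 (Real.log (1 / lam))) := by
    have : ContinuousAt (fun ε : ℝ => Real.log (ε ^ 2 + 1 / lam)) 0 := by
      refine ContinuousAt.log (by fun_prop) ?_
      have : 0 < 1 / lam := by positivity
      simpa using hlam.ne'
    have h := this.tendsto.mono_left (nhdsWithin_le_nhds (s := Set.Ioi 0))
    simpa using h
  have h2 : Tendsto (fun ε : ℝ => 2 * Real.log (1 / ε)) (𝓝[>] 0) atTop :=
    tendsto_log_inv_atTop.const_mul_atTop (by norm_num)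
  have h3 := ((h1.div_atTop h2).const_add 1).const_mul (Real.pi * lamHat ^ 2)
  rw [add_zero, mul_one] at h3
  refine h3.congr' ?_
  filter_upwards [eventually_small] with ε hε
  have hl : Real.log ε < 0 := Real.log_neg hε.1 (by linarith [hε.2])
  have hε0 := hε.1
  have e : 1 + 1 / (ε ^ 2 * lam) = (ε ^ 2 + 1 / lam) / ε ^ 2 := by field_simp
  have e2 : |Real.log (ε ^ 2)| = -(2 * Real.log ε) := by
    rw [Real.log_pow, abs_of_neg] <;> push_cast <;> linarith
  rw [Leps, e2, e, Real.log_div (x := ε ^ 2 + 1 / lam) (by positivity) (by positivity),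
    Real.log_pow, one_div ε, Real.log_inv]
  push_cast
  have : Real.log ε ≠ 0 := hl.ne
  field_simp
  ring

/-! ### Limits of energies -/

/-- The energies of a family of kernels converge, in the limit `ε → 0`, to those described by the
functional `ℓ`, and the norms converge to zero. -/
structure HasEnergyLimit (v : Plane → ℝ) (lamHat ν lam : ℝ) {m : ℕ}
    (ψ : ℝ → (Fin m → Plane) → ℂ) (ℓ : (ℝ → ℝ) → ℝ) : Prop where
  kernel : ∀ ε, 0 < ε → ε < 1 → IsKernel 0 (ψ ε)
  limit : ∀ h B, IsLipBdd h B → Tendsto (fun ε => (m ! : ℝ) *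
    ∫ p, (lam + symb ν p) * h (Leps lamHat ε (lam + symb ν p)) * ‖ψ ε p‖ ^ 2
      ∂(modesMeasure v ε m)) (𝓝[>] 0) (𝓝 (ℓ h))
  mass : Tendsto (fun ε => (m ! : ℝ) * ∫ p, ‖ψ ε p‖ ^ 2 ∂(modesMeasure v ε m)) (𝓝[>] 0) (𝓝 0)

/-- The energies of a family of kernels against symbols of order `-1` converge as `ε → 0`. -/
structure HasSourceLimit (v : Plane → ℝ) (lamHat ν lam M : ℝ) {m : ℕ}
    (X : ℝ → (Fin m → Plane) → ℂ) (ℓ : (ℝ → ℝ) → ℝ) : Prop where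
  kernel : ∀ ε, 0 < ε → ε < 1 → ∀ S s B, IsSymbol lamHat lam ε S s B →
    IsKernel 0 fun p => ((S (symb ν p) : ℝ) : ℂ) * X ε p
  limit : ∀ (S : ℝ → ℝ → ℝ) s B, (∀ ε, IsSymbol lamHat lam ε (S ε) s B) → Tendsto (fun ε =>
    (m ! : ℝ) * ∫ p, S ε (symb ν p) * ‖X ε p‖ ^ 2 ∂(modesMeasure v ε m)) (𝓝[>] 0)
      (𝓝 (ℓ (primOp ν M s)))

section Limits

variable {v : Plane → ℝ} {C₀ lamHat ν lam M : ℝ} {m : ℕ}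

/-- Testing the energy of `R X` with `h` is testing `X` with `(λ+x) h R²`, a symbol of order `-1`
with profile `h/γ_k²`. Carrying every `h` along, and not only `h = 1`, is what lets the induction
over chaoses close. -/
theorem HasSourceLimit.resolvent {X : ℝ → (Fin m → Plane) → ℂ} {ℓ : (ℝ → ℝ) → ℝ}
    (hX : HasSourceLimit v lamHat ν lam M X ℓ) (hlam : 0 < lam) (h0 : ℓ (fun _ => 0) = 0) (k : ℕ) :
    HasEnergyLimit v lamHat ν lam
      (fun ε p => ((resPos lamHat ν lam ε k (symb ν p) : ℝ) : ℂ) * X ε p)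
      (fun h => ℓ (primOp ν M (sqOp ν k h))) where
  kernel ε hε hε1 := hX.kernel ε hε hε1 _ _ _ (isSymbol_resPos hlam ν k ε)
  limit h B hh := by
    refine (hX.limit _ _ _ fun ε => isSymbol_weighted_resPos_sq hlam ν k hh ε).congr fun ε => ?_
    congr 2
    funext p
    rw [norm_mul, Complex.norm_real, mul_pow, Real.norm_eq_abs, sq_abs]
    ring
  mass := by
    have := hX.limit _ _ _ fun ε => isSymbol_resPos_sq hlam ν k ε
    rw [primOp_zero, h0] at this
    refine this.congr fun ε => ?_
    congr 2
    funext p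
    rw [norm_mul, Complex.norm_real, mul_pow, Real.norm_eq_abs, sq_abs]

theorem HasEnergyLimit.energy {ψ : ℝ → (Fin m → Plane) → ℂ} {ℓ : (ℝ → ℝ) → ℝ}
    (hψ : HasEnergyLimit v lamHat ν lam ψ ℓ) : Tendsto (fun ε => (m ! : ℝ) *
      ∫ p, (lam + symb ν p) * ‖ψ ε p‖ ^ 2 ∂(modesMeasure v ε m)) (𝓝[>] 0) (𝓝 (ℓ fun _ => 1)) := by
  simpa using hψ.limit _ _ (isLipBdd_const 1)

theorem eventually_Leps_le (hM : Real.pi * lamHat ^ 2 < M) (hlam : 0 < lam) :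
    ∀ᶠ ε in 𝓝[>] 0, ∀ x, 0 ≤ x → Leps lamHat ε (lam + x) ≤ M := by
  filter_upwards [(tendsto_Leps lamHat hlam).eventually_lt_const hM, eventually_small] with ε h hε x hx
  exact (Leps_anti lamHat hε.1 hlam (by linarith)).trans h.le

/-- Write `x h = (λ + x) h - λ h`: the first part is an admissible energy, the second is controlled
by the vanishing mass. For small `ε` the values of `L^ε` stay below `M`, so the truncation in
`primOp` is not felt. -/
theorem HasEnergyLimit.limitSymb {ψ : ℝ → (Fin m → Plane) → ℂ} {ℓ : (ℝ → ℝ) → ℝ}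
    (hψ : HasEnergyLimit v lamHat ν lam ψ ℓ) (hv : IsProfile v C₀) (hlam : 0 < lam)
    (hM0 : 0 ≤ M) (hM : Real.pi * lamHat ^ 2 < M) {s : ℝ → ℝ} {B : ℝ} (hs : IsLipBdd s B) :
    Tendsto (fun ε => (m ! : ℝ) * ∫ p, CurlGFF.limitSymb lamHat ν lam ε s (symb ν p) * ‖ψ ε p‖ ^ 2
      ∂(modesMeasure v ε m)) (𝓝[>] 0) (𝓝 (ℓ (primOp ν M s))) := by
  have hh := hs.primOp ν hM0
  set h := primOp ν M s with hdef
  set B' := 4 / ν ^ 4 * B * (1 + M)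
  have hB' := hh.nonneg
  have hz : Tendsto (fun ε => (m ! : ℝ) * ∫ p, lam * h (Leps lamHat ε (lam + symb ν p)) *
      ‖ψ ε p‖ ^ 2 ∂(modesMeasure v ε m)) (𝓝[>] 0) (𝓝 0) := by
    have h1 := hψ.mass.const_mul (lam * B')
    rw [mul_zero] at h1
    refine squeeze_zero_norm' ?_ h1
    filter_upwards [eventually_small] with ε hε
    have hk := hψ.kernel ε hε.1 (by linarith [hε.2])
    rw [norm_mul, Real.norm_of_nonneg (by positivity), mul_left_comm]
    refine mul_le_mul_of_nonneg_left ?_ (by positivity)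
    rw [← integral_const_mul]
    refine norm_integral_le_of_norm_le ((hk.integrable_sq hv hε.1).const_mul _)
      (Eventually.of_forall fun p => ?_)
    rw [norm_mul, norm_mul, Real.norm_of_nonneg hlam.le, Real.norm_of_nonneg (sq_nonneg _)]
    gcongr
    exact hh.bound _
  have h2 := (hψ.limit h B' hh).sub hz
  rw [sub_zero] at h2
  refine h2.congr' ?_
  filter_upwards [eventually_small, eventually_Leps_le hM hlam] with ε hε hL
  have hk := hψ.kernel ε hε.1 (by linarith [hε.2])
  have hm : Measurable fun x => h (Leps lamHat ε (lam + x)) :=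
    (hh.continuous.measurable.comp (measurable_Leps lamHat ε)).comp (measurable_const_add lam)
  have i1 := hk.integrable_energy hv hε.1 (ν := ν)
    (T := fun x => (lam + x) * h (Leps lamHat ε (lam + x))) ((measurable_const_add lam).mul hm)
    (l := 2) (D := (lam + ν ^ 2 / 2) * B') fun x hx => by
      rw [abs_mul, mul_right_comm]
      exact mul_le_mul (affine_growth hlam hx) (hh.bound _) (abs_nonneg _) (by positivity)
  have i2 := hk.integrable_energy hv hε.1 (ν := ν)
    (T := fun x => lam * h (Leps lamHat ε (lam + x))) (hm.const_mul lam)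
    (l := 0) (D := lam * B') fun x hx => by
      rw [abs_mul, abs_of_pos hlam, pow_zero, mul_one]
      exact mul_le_mul_of_nonneg_left (hh.bound _) hlam.le
  rw [← mul_sub, ← integral_sub i1 i2]
  congr 2
  funext p
  have hp := symb_nonneg ν p
  rw [CurlGFF.limitSymb, ← primOp_of_mem (Leps_nonneg lamHat (by linarith)) (hL _ hp), ← hdef]
  ring

/-- The factor `m + 1` in `creation_energy_le` is the step from `m!` to `(m+1)!`; its error is `κ²`
times a convergent energy. -/
theorem HasEnergyLimit.creation {ψ : ℝ → (Fin m → Plane) → ℂ} {ℓ : (ℝ → ℝ) → ℝ}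
    (hψ : HasEnergyLimit v lamHat ν lam ψ ℓ) (hv : IsProfile v C₀) (hlamHat : 0 < lamHat)
    (hν : 0 < ν) (hlam : 0 < lam) (hM0 : 0 ≤ M) (hM : Real.pi * lamHat ^ 2 < M) :
    HasSourceLimit v lamHat ν lam M (fun ε => CurlGFF.creation lamHat ε (ψ ε)) ℓ where
  kernel ε hε hε1 S s B hS :=
    (hψ.kernel ε hε hε1).resolvent_creation lamHat ε hS.measurable fun x hx =>
      hS.abs_mul_le hlam (by positivity : 0 < ν ^ 2 / 2) hx
  limit S s B hS := by
    obtain ⟨C, hC, hest⟩ := creation_energy_le hv B hlamHat hν hlam m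
    have h1 := hψ.limitSymb hv hlam hM0 hM (hS 1).lipBdd
    have h2 := ((tendsto_coupling_sq lamHat).const_mul C).mul hψ.energy
    rw [mul_zero, zero_mul] at h2
    refine h1.congr_dist (squeeze_zero' (Eventually.of_forall fun _ => dist_nonneg) ?_ h2)
    filter_upwards [eventually_small] with ε hε
    have h3 := hest ε hε.1 hε.2.le (S ε) s (hS ε) (ψ ε) (hψ.kernel ε hε.1 (by linarith [hε.2]))
    rw [dist_comm, Real.dist_eq, Nat.factorial_succ]
    push_cast
    rw [mul_comm ((m : ℝ) + 1), mul_assoc, ← mul_sub, abs_mul,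
      abs_of_nonneg (by positivity : (0 : ℝ) ≤ m !), mul_left_comm]
    exact mul_le_mul_of_nonneg_left h3 (by positivity)

/-! ### The drift -/

theorem integral_modesMeasure_one {E : Type*} [NormedAddCommGroup E] [NormedSpace ℝ E]
    (v : Plane → ℝ) (ε : ℝ) (f : Plane → E) :
    ∫ p : Fin 1 → Plane, f (p 0) ∂(modesMeasure v ε 1) = ∫ q, f q ∂(modeMeasure v ε) :=
  (measurePreserving_funUnique (modeMeasure v ε) (Fin 1)).integral_comp
    (MeasurableEquiv.funUnique (Fin 1) Plane).measurableEmbedding f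

/-- The unit vector `e` such that `perp q i = cross q e`. -/
def driftAxis (i : Fin 2) : Plane := EuclideanSpace.single i 1

theorem perp_eq_cross (q : Plane) (i : Fin 2) : perp q i = cross q (driftAxis i) := by
  fin_cases i <;> simp [perp, cross, driftAxis]

theorem norm_driftAxis (i : Fin 2) : ‖driftAxis i‖ = 1 := by simp [driftAxis]

theorem norm_driftKernel (lamHat ε : ℝ) (i : Fin 2) (q : Plane) :
    ‖driftKernel lamHat ε i q‖ = |coupling lamHat ε| * |cross q (driftAxis i)| := by
  simp [driftKernel, perp_eq_cross]

/-- The squared kernel is `κ² (q×e)²`, so this is the diagonal estimate at total momentum zero,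
where `L^ε(λ) → πλ̂²`. -/
theorem hasSourceLimit_drift (hv : IsProfile v C₀) (hlamHat : 0 < lamHat)
    (hν : 0 < ν) (hlam : 0 < lam) (hM : Real.pi * lamHat ^ 2 < M) (i : Fin 2) :
    HasSourceLimit v lamHat ν lam M (m := 1) (fun ε p => driftKernel lamHat ε i (p 0))
      (fun h => ν ^ 2 / 2 * h (Real.pi * lamHat ^ 2)) where
  kernel ε hε hε1 S s B hS := by
    have hB := hS.lipBdd.nonneg
    have h0 : IsKernel 0 fun p : Fin 1 → Plane => driftKernel lamHat ε i (p 0) := by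
      refine ⟨?_, fun σ p => ?_, |coupling lamHat ε|, abs_nonneg _, fun p => ?_⟩
      · simp only [driftKernel, perp_eq_cross]
        have : Measurable fun p : Fin 1 → Plane => cross (p 0) (driftAxis i) :=
          Measurable.cross (measurable_pi_apply 0) measurable_const
        fun_prop
      · rw [Subsingleton.elim σ 1]
        rfl
      · rw [norm_driftKernel]
        have := abs_cross_le (p 0) (driftAxis i)
        rw [norm_driftAxis, mul_one] at this
        simpa using mul_le_mul_of_nonneg_left this (abs_nonneg _)
    exact h0.smul_symb hS.measurable fun x hx => hS.growth hlam
  limit S s B hS := by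
    have hc : 0 < ν ^ 2 / 2 := by positivity
    obtain ⟨C, hC, hest⟩ := diag_estimate hv (B := B) hlamHat hlam hc
    have hs := (hS 1).lipBdd
    have hp : Continuous fun x => ∫ y in (0 : ℝ)..x, s y :=
      intervalIntegral.continuous_primitive (fun _ _ => hs.continuous.intervalIntegrable _ _) 0
    have h1 := ((hp.tendsto _).comp (tendsto_Leps lamHat hlam)).const_mul (1 / (ν ^ 2 / 2))
    have e : ν ^ 2 / 2 * primOp ν M s (Real.pi * lamHat ^ 2) =
        1 / (ν ^ 2 / 2) * ∫ y in (0 : ℝ)..Real.pi * lamHat ^ 2, s y := by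
      rw [primOp_of_mem (by positivity) hM.le]
      field_simp
      norm_num
    have h2 := (tendsto_coupling_sq lamHat).const_mul C
    rw [mul_zero] at h2
    rw [e]
    refine h1.congr_dist (squeeze_zero' (Eventually.of_forall fun _ => dist_nonneg) ?_ h2)
    filter_upwards [eventually_small] with ε hε
    have h3 := hest ε hε.1 hε.2.le (S ε) s (hS ε) (driftAxis i) (norm_driftAxis i) 0 le_rfl
    rw [dist_comm, Real.dist_eq]
    convert h3 using 3
    · rw [Nat.factorial_one, Nat.cast_one, one_mul]
      simp only [symb, Fin.sum_univ_one]
      rw [integral_modesMeasure_one v ε fun q => S ε (ν ^ 2 / 2 * ‖q‖ ^ 2) *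
        ‖driftKernel lamHat ε i q‖ ^ 2, integral_modeMeasure hv, ← integral_const_mul]
      congr 1
      funext q
      rw [norm_driftKernel, mul_pow, sq_abs, sq_abs, zero_smul, zero_add, smul_eq_mul, modeWeight]
      ring
    · simp

/-! ### Limits of the components of the approximate solution -/

/-- The limit of the energies of the component in the `j`-th chaos. -/
def ell (ν M z : ℝ) (n : ℕ) : ℕ → (ℝ → ℝ) → ℝ
  | 0 => fun h => ν ^ 2 / 2 * h z
  | j + 1 => fun h => ell ν M z n j (primOp ν M (sqOp ν (n - j) h))

theorem ell_zero (ν M z : ℝ) (n j : ℕ) : ell ν M z n j (fun _ => 0) = 0 := by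
  induction j with
  | zero => simp [ell]
  | succ j ih =>
    have : sqOp ν (n - j) (fun _ => 0) = fun _ => 0 := by funext x; simp [sqOp]
    simp only [ell, this, primOp_zero, ih]

theorem bComp_one_eq (hlam : 0 < lam) (ε : ℝ) (n : ℕ) (i : Fin 2) :
    bComp lamHat ν lam ε n i 1 = fun p =>
      ((resPos lamHat ν lam ε n (symb ν p) : ℝ) : ℂ) * driftKernel lamHat ε i (p 0) := by
  funext p
  simp only [bComp, resSymb_eq_resPos lamHat ν hlam ε n (symb_nonneg ν p)]

theorem bComp_succ_eq (hlam : 0 < lam) (ε : ℝ) (n : ℕ) (i : Fin 2) (j : ℕ) :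
    bComp lamHat ν lam ε n i (j + 2) = fun p =>
      ((resPos lamHat ν lam ε (n - (j + 1)) (symb ν p) : ℝ) : ℂ) *
        creation lamHat ε (bComp lamHat ν lam ε n i (j + 1)) p := by
  funext p
  have : n + 1 - (j + 2) = n - (j + 1) := by omega
  simp only [bComp, this, resSymb_eq_resPos lamHat ν hlam ε _ (symb_nonneg ν p)]

theorem hasEnergyLimit_bComp (hv : IsProfile v C₀) (hlamHat : 0 < lamHat)
    (hν : 0 < ν) (hlam : 0 < lam) (hM : Real.pi * lamHat ^ 2 < M) (n : ℕ) (i : Fin 2) (j : ℕ) :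
    HasEnergyLimit v lamHat ν lam (fun ε => bComp lamHat ν lam ε n i (j + 1))
      (ell ν M (Real.pi * lamHat ^ 2) n (j + 1)) := by
  have hM0 : 0 ≤ M := le_trans (by positivity) hM.le
  induction j with
  | zero =>
    simp only [bComp_one_eq hlam]
    exact (hasSourceLimit_drift hv hlamHat hν hlam hM i).resolvent hlam (by simp) n
  | succ j ih =>
    simp only [bComp_succ_eq hlam]
    exact (ih.creation hv hlamHat hν hlam hM0 hM).resolvent hlam (ell_zero _ _ _ _ _) _

end Limits

/-! ### The limit of large order -/

section Order

variable {ν M : ℝ}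

/-- Each integration raises the power by one and gains a factor of the factorial; all convergence in
`n` comes from here. -/
theorem abs_integral_le_pow {f : ℝ → ℝ} (hf : Continuous f) {a c x : ℝ} (ha : 0 ≤ a) (hx : 0 ≤ x)
    (n : ℕ) (h : ∀ y, 0 ≤ y → y ≤ x → |f y| ≤ c * ((a * y) ^ n / n !)) :
    |a * ∫ y in (0 : ℝ)..x, f y| ≤ c * ((a * x) ^ (n + 1) / (n + 1)!) := by
  have h1 : |∫ y in (0 : ℝ)..x, f y| ≤ ∫ y in (0 : ℝ)..x, c * ((a * y) ^ n / n !) := by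
    refine (intervalIntegral.abs_integral_le_integral_abs hx).trans ?_
    refine intervalIntegral.integral_mono_on hx (hf.abs.intervalIntegrable _ _)
      (Continuous.intervalIntegrable (by fun_prop) _ _) fun y hy => h y hy.1 hy.2
  have h2 : ∫ y in (0 : ℝ)..x, c * ((a * y) ^ n / n !) =
      c * (a ^ n / n ! * (x ^ (n + 1) / (n + 1))) := by
    rw [intervalIntegral.integral_const_mul]
    congr 1
    rw [show (fun y : ℝ => (a * y) ^ n / (n ! : ℝ)) = fun y => a ^ n / n ! * y ^ n by
      funext y; rw [mul_pow]; ring, intervalIntegral.integral_const_mul, integral_pow]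
    simp
  rw [abs_mul, abs_of_nonneg ha]
  refine (mul_le_mul_of_nonneg_left (h1.trans_eq h2) ha).trans_eq ?_
  rw [Nat.factorial_succ]
  push_cast
  rw [mul_pow]
  field_simp
  ring

/-- The limit of the functions `1 + (4/ν⁴) G_k` as `k → ∞`. -/
def gamLim (ν x : ℝ) : ℝ := √(1 + 2 * (4 / ν ^ 4) * max 0 x)

theorem one_le_gamLim (ν x : ℝ) : 1 ≤ gamLim ν x := by
  rw [gamLim, Real.one_le_sqrt]
  have : 0 ≤ 4 / ν ^ 4 := by positivity
  have := mul_nonneg this (le_max_left 0 x)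
  linarith

theorem continuous_gamLim (ν : ℝ) : Continuous (gamLim ν) := by unfold gamLim; fun_prop

/-- The fixed point of the recursion for `gam`: from `γ² = 1 + 2(4/ν⁴)x` follows `γ' = (4/ν⁴)/γ`.
The derivative is taken at interior points only, because the truncation has a kink at `0`. -/
theorem gamLim_eq (ν : ℝ) {x : ℝ} (hx : 0 ≤ x) :
    gamLim ν x = 1 + 4 / ν ^ 4 * ∫ y in (0 : ℝ)..x, 1 / gamLim ν y := by
  have hν : 0 ≤ 4 / ν ^ 4 := by positivity
  have h : ∫ y in (0 : ℝ)..x, 4 / ν ^ 4 * (1 / gamLim ν y) = gamLim ν x - gamLim ν 0 := by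
    refine intervalIntegral.integral_eq_sub_of_hasDerivAt_of_le hx
      (continuous_gamLim ν).continuousOn (fun y hy => ?_) ?_
    · have h1 : HasDerivAt (fun y : ℝ => 1 + 2 * (4 / ν ^ 4) * y) (2 * (4 / ν ^ 4)) y := by
        simpa using ((hasDerivAt_id y).const_mul (2 * (4 / ν ^ 4))).const_add 1
      have hpos : 0 < 1 + 2 * (4 / ν ^ 4) * y := by
        have := mul_nonneg hν hy.1.le
        linarith
      have h2 := h1.sqrt hpos.ne'
      have e : gamLim ν =ᶠ[𝓝 y] fun y => √(1 + 2 * (4 / ν ^ 4) * y) := by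
        filter_upwards [Ioi_mem_nhds hy.1] with t ht
        rw [gamLim, max_eq_right (le_of_lt ht)]
      convert h2.congr_of_eventuallyEq e using 1
      rw [gamLim, max_eq_right hy.1.le]
      have := Real.sqrt_pos.2 hpos
      field_simp
    · refine Continuous.intervalIntegrable (continuous_const.mul
        (continuous_const.div (continuous_gamLim ν) fun y => ?_)) _ _
      have := one_le_gamLim ν y
      positivity
  rw [intervalIntegral.integral_const_mul] at h
  rw [h]
  simp [gamLim]

theorem continuous_inv_gamLim (ν : ℝ) : Continuous fun y => 1 / gamLim ν y :=
  continuous_const.div (continuous_gamLim ν) fun y => by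
    have := one_le_gamLim ν y
    positivity

theorem abs_inv_sub_inv_le {a b : ℝ} (ha : 1 ≤ a) (hb : 1 ≤ b) : |1 / a - 1 / b| ≤ |a - b| := by
  have e : 1 / a - 1 / b = (b - a) / (a * b) := by field_simp
  rw [e, abs_div, abs_of_pos (by positivity : 0 < a * b), abs_sub_comm a b]
  exact div_le_self (abs_nonneg _) (by nlinarith)

/-- Picard iteration: `t ↦ 1/t` is 1-Lipschitz on `[1, ∞)`, so the error is integrated once per
step. -/
theorem abs_gam_sub_gamLim_le (ν : ℝ) (k : ℕ) {x : ℝ} (hx : 0 ≤ x) :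
    |gam ν (k + 1) x - gamLim ν x| ≤ (4 / ν ^ 4 * x) ^ (k + 1) / (k + 1)! := by
  have hν : 0 ≤ 4 / ν ^ 4 := by positivity
  induction k generalizing x with
  | zero =>
    have h1 : gam ν (0 + 1) x = 1 := by simp [gam, Gfun]
    have h2 := abs_integral_le_pow (continuous_inv_gamLim ν) (c := 1) hν hx 0 fun y _ _ => by
      have := one_le_gamLim ν y
      rw [abs_of_nonneg (by positivity)]
      simpa using inv_le_one_of_one_le₀ this
    rw [h1, gamLim_eq ν hx, sub_add_cancel_left, abs_neg]
    simpa using h2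
  | succ k ih =>
    have h2 := abs_integral_le_pow ((isLipBdd_inv_gam ν (k + 1)).continuous.fun_sub
      (continuous_inv_gamLim ν)) (c := 1) hν hx (k + 1) fun y hy _ => by
        rw [one_mul]
        exact (abs_inv_sub_inv_le (one_le_gam _ _ _) (one_le_gamLim _ _)).trans (ih hy)
    rw [one_mul, intervalIntegral.integral_sub
      ((isLipBdd_inv_gam ν (k + 1)).continuous.intervalIntegrable _ _)
      ((continuous_inv_gamLim ν).intervalIntegrable _ _)] at h2
    rw [gamLim_eq ν hx, gam_succ ν (by omega) hx, add_sub_add_left_eq_sub, ← mul_sub]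
    exact h2

/-- Products of the operators that describe the passage from a chaos to the next one. -/
def orderOp (ν M : ℝ) : ℕ → ℕ → (ℝ → ℝ) → ℝ → ℝ
  | _, 0, h => h
  | n, j + 1, h => primOp ν M (sqOp ν n (orderOp ν M (n - 1) j h))

/-- `orderOp` peels off the outermost operator, which suits the recursion in `n`; `ell` peels off
the innermost one. Here the two are reconciled. -/
theorem orderOp_succ' (ν M : ℝ) (n j : ℕ) (h : ℝ → ℝ) :
    orderOp ν M n (j + 1) h = orderOp ν M n j (primOp ν M (sqOp ν (n - j) h)) := by
  induction j generalizing n with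
  | zero => rfl
  | succ j ih =>
    rw [orderOp, ih, orderOp, show n - 1 - j = n - (j + 1) by omega]

theorem ell_eq_orderOp (ν M z : ℝ) (n j : ℕ) (h : ℝ → ℝ) :
    ell ν M z n j h = ν ^ 2 / 2 * orderOp ν M n j h z := by
  induction j generalizing h with
  | zero => rfl
  | succ j ih => rw [orderOp_succ', ← ih, ell]

theorem exists_isLipBdd_orderOp (hM : 0 ≤ M) {h : ℝ → ℝ} {B : ℝ} (hh : IsLipBdd h B) (n j : ℕ) :
    ∃ B', IsLipBdd (orderOp ν M n j h) B' := by
  induction j generalizing n with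
  | zero => exact ⟨B, hh⟩
  | succ j ih =>
    obtain ⟨B', hB'⟩ := ih (n - 1)
    exact ⟨_, (isLipBdd_sqOp hB' ν n).primOp ν hM⟩

theorem continuous_orderOp (hM : 0 ≤ M) {h : ℝ → ℝ} {B : ℝ} (hh : IsLipBdd h B) (n j : ℕ) :
    Continuous (orderOp ν M n j h) :=
  (exists_isLipBdd_orderOp hM hh n j).choose_spec.continuous

theorem continuous_sqOp {h : ℝ → ℝ} (hh : Continuous h) (ν : ℝ) (k : ℕ) :
    Continuous (sqOp ν k h) :=
  hh.mul ((isLipBdd_inv_gam ν k).continuous.mul (isLipBdd_inv_gam ν k).continuous)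

theorem inv_gam_nonneg (ν : ℝ) (k : ℕ) (y : ℝ) : 0 ≤ 1 / gam ν k y := by
  have := one_le_gam ν k y
  positivity

theorem inv_gam_le_one (ν : ℝ) (k : ℕ) (y : ℝ) : 1 / gam ν k y ≤ 1 := by
  have := one_le_gam ν k y
  exact (div_le_one (by linarith)).2 this

theorem abs_sqOp_le (ν : ℝ) (k : ℕ) (h : ℝ → ℝ) (y : ℝ) : |sqOp ν k h y| ≤ |h y| := by
  have h0 := inv_gam_nonneg ν k y
  have h1 := inv_gam_le_one ν k y
  rw [sqOp, abs_mul]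
  refine mul_le_of_le_one_right (abs_nonneg _) ?_
  rw [abs_of_nonneg (mul_nonneg h0 h0)]
  exact mul_le_one₀ h1 h0 h1

/-- Discarding the factors `1/γ² ≤ 1` leaves plain iterated integrals. -/
theorem abs_orderOp_le (hM : 0 ≤ M) {h : ℝ → ℝ} {B : ℝ} (hh : IsLipBdd h B)
    (hp : ∀ y, 0 ≤ y → y ≤ M → |h y| ≤ 4 / ν ^ 4 * y) (n j : ℕ) {x : ℝ} (h0 : 0 ≤ x) (hx : x ≤ M) :
    |orderOp ν M n j h x| ≤ (4 / ν ^ 4 * x) ^ (j + 1) / (j + 1)! := by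
  induction j generalizing n x with
  | zero => simpa [orderOp] using hp x h0 hx
  | succ j ih =>
    rw [orderOp, primOp_of_mem h0 hx, ← one_mul (_ / ((j + 1 + 1)! : ℝ))]
    refine abs_integral_le_pow (a := 4 / ν ^ 4) (continuous_sqOp (continuous_orderOp hM hh _ _) ν n)
      (by positivity) h0 (j + 1) fun y hy0 hy => ?_
    rw [one_mul]
    exact (abs_sqOp_le _ _ _ _).trans (ih _ hy0 (hy.trans hx))

/-- The sum over all chaoses. -/
def orderSum (ν M : ℝ) (n : ℕ) (x : ℝ) : ℝ :=
  ∑ j ∈ Finset.range (n + 1), orderOp ν M n j (fun _ => 1) x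

theorem continuous_orderSum (hM : 0 ≤ M) (n : ℕ) : Continuous (orderSum ν M n) :=
  continuous_finsetSum _ fun j _ => continuous_orderOp hM (isLipBdd_const 1) n j

theorem orderSum_succ (hM : 0 ≤ M) (n : ℕ) {x : ℝ} (h0 : 0 ≤ x) (hx : x ≤ M) :
    orderSum ν M (n + 1) x =
      1 + 4 / ν ^ 4 * ∫ y in (0 : ℝ)..x, sqOp ν (n + 1) (orderSum ν M n) y := by
  have e : sqOp ν (n + 1) (orderSum ν M n) = fun y => ∑ j ∈ Finset.range (n + 1),
      sqOp ν (n + 1) (orderOp ν M n j fun _ => 1) y := by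
    funext y
    simp only [sqOp, orderSum, Finset.sum_mul]
  rw [e, intervalIntegral.integral_finsetSum fun j _ => (continuous_sqOp
    (continuous_orderOp hM (isLipBdd_const 1) n j) ν (n + 1)).intervalIntegrable _ _,
    Finset.mul_sum, orderSum, Finset.sum_range_succ', add_comm]
  refine congrArg₂ _ rfl (Finset.sum_congr rfl fun j _ => ?_)
  rw [orderOp, primOp_of_mem h0 hx, Nat.add_sub_cancel]

/-- Since `b/b² = 1/b`, the recursion for the sum over chaoses has the same fixed point as the one
for `gam`; this is its stability near that point. -/
theorem abs_sq_ratio_sub_le {a b w : ℝ} (ha : 1 ≤ a) (hb : 1 ≤ b) :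
    |w * (1 / a * (1 / a)) - 1 / b| ≤ |w - b| + 2 * |a - b| := by
  have e : w * (1 / a * (1 / a)) - 1 / b =
      (w - b) * (1 / (a * a)) + (b - a) * (1 / (a * a) + 1 / (a * b)) := by
    field_simp; ring
  have h1 : 1 / (a * a) ≤ 1 := (div_le_one (by positivity)).2 (by nlinarith)
  have h2 : 1 / (a * b) ≤ 1 := (div_le_one (by positivity)).2 (by nlinarith)
  rw [e]
  refine (abs_add_le _ _).trans (add_le_add ?_ ?_)
  · rw [abs_mul, abs_of_nonneg (by positivity : 0 ≤ 1 / (a * a))]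
    exact mul_le_of_le_one_right (abs_nonneg _) h1
  · rw [abs_mul, abs_of_nonneg (by positivity : 0 ≤ 1 / (a * a) + 1 / (a * b)), abs_sub_comm,
      mul_comm]
    exact mul_le_mul_of_nonneg_right (by linarith) (abs_nonneg _)

theorem abs_orderSum_sub_le (hM : 0 ≤ M) (n : ℕ) {x : ℝ} (h0 : 0 ≤ x) (hx : x ≤ M) :
    |orderSum ν M n x - gamLim ν x| ≤
      (2 * n + 1) * ((4 / ν ^ 4 * x) ^ (n + 1) / (n + 1)!) := by
  induction n generalizing x with
  | zero =>
    have h1 := abs_gam_sub_gamLim_le ν 0 h0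
    have h2 : gam ν (0 + 1) x = 1 := by simp [gam, Gfun]
    rw [h2] at h1
    simpa [orderSum, orderOp] using h1
  | succ n ih =>
    have hc := continuous_sqOp (continuous_orderSum (ν := ν) hM n) ν (n + 1)
    -- `2n + 1` is the inductive error of the sum and `2` that of `gam`, which enters squared.
    have h2 := abs_integral_le_pow (hc.fun_sub (continuous_inv_gamLim ν)) (c := 2 * n + 1 + 2)
      (by positivity : 0 ≤ 4 / ν ^ 4) h0 (n + 1) fun y hy0 hy => by
        have h3 := ih hy0 (hy.trans hx)
        have h4 := abs_gam_sub_gamLim_le ν n hy0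
        have h5 := abs_sq_ratio_sub_le (w := orderSum ν M n y) (one_le_gam ν (n + 1) y)
          (one_le_gamLim ν y)
        have h6 : sqOp ν (n + 1) (orderSum ν M n) y =
          orderSum ν M n y * (1 / gam ν (n + 1) y * (1 / gam ν (n + 1) y)) := rfl
        rw [h6]
        linarith
    rw [intervalIntegral.integral_sub (hc.intervalIntegrable _ _)
      ((continuous_inv_gamLim ν).intervalIntegrable _ _)] at h2
    rw [gamLim_eq ν h0, orderSum_succ hM n h0 hx, add_sub_add_left_eq_sub, ← mul_sub]
    refine h2.trans_eq ?_
    push_cast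
    ring

theorem tendsto_pow_succ_div_factorial (a : ℝ) :
    Tendsto (fun n : ℕ => a ^ (n + 1) / (n + 1)!) atTop (𝓝 0) :=
  (tendsto_add_atTop_iff_nat 1).2 (FloorSemiring.tendsto_pow_div_factorial_atTop a)

theorem tendsto_orderSum (hM : 0 ≤ M) {x : ℝ} (h0 : 0 ≤ x) (hx : x ≤ M) :
    Tendsto (fun n => orderSum ν M n x) atTop (𝓝 (gamLim ν x)) := by
  rw [tendsto_iff_dist_tendsto_zero]
  set a := 4 / ν ^ 4 * x with ha
  -- Uses `(2n+1) aⁿ⁺¹/(n+1)! = 2a · aⁿ/n! - aⁿ⁺¹/(n+1)!`.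
  have h1 := ((FloorSemiring.tendsto_pow_div_factorial_atTop a).const_mul (2 * a)).sub
    (tendsto_pow_succ_div_factorial a)
  rw [mul_zero, sub_zero] at h1
  refine squeeze_zero (fun n => dist_nonneg) (fun n => ?_) h1
  rw [Real.dist_eq]
  refine (abs_orderSum_sub_le hM n h0 hx).trans_eq ?_
  rw [← ha, Nat.factorial_succ]
  push_cast
  field_simp
  ring

theorem effCoeff_sq (lamHat : ℝ) {ν : ℝ} (hν : 0 < ν) :
    effCoeff lamHat ν ^ 2 / 4 =
      ν ^ 2 / 2 * (gamLim ν (Real.pi * lamHat ^ 2) - 1) := by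
  have hp : 0 ≤ Real.pi * lamHat ^ 2 := by positivity
  have h1 : √(2 * Real.pi * lamHat ^ 2 + ν ^ 4 / 4) =
      ν ^ 2 / 2 * gamLim ν (Real.pi * lamHat ^ 2) := by
    rw [gamLim, max_eq_right hp, ← Real.sqrt_sq (by positivity : 0 ≤ ν ^ 2 / 2),
      ← Real.sqrt_mul (by positivity)]
    congr 1
    field_simp
    ring
  have h2 := one_le_gamLim ν (Real.pi * lamHat ^ 2)
  have h3 : 0 ≤ ν ^ 2 / 2 * (gamLim ν (Real.pi * lamHat ^ 2) - 1) :=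
    mul_nonneg (by positivity) (by linarith)
  rw [effCoeff, Real.sq_sqrt, h1]
  · ring
  · rw [h1]
    linarith

theorem tendsto_sum_ell (lamHat : ℝ) (hν : 0 < ν) (hM : Real.pi * lamHat ^ 2 < M) :
    Tendsto (fun n => ∑ j ∈ Finset.range n, ell ν M (Real.pi * lamHat ^ 2) n (j + 1) fun _ => 1)
      atTop (𝓝 (effCoeff lamHat ν ^ 2 / 4)) := by
  have hp : 0 ≤ Real.pi * lamHat ^ 2 := by positivity
  rw [effCoeff_sq lamHat hν]
  -- The summand `1` with `j = 0` in `orderSum` belongs to no chaos and is removed.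
  refine (((tendsto_orderSum (hp.trans hM.le) hp hM.le).sub_const 1).const_mul
    (ν ^ 2 / 2)).congr fun n => ?_
  rw [orderSum, Finset.sum_range_succ', orderOp, add_sub_cancel_right, Finset.mul_sum]
  exact Finset.sum_congr rfl fun j _ => (ell_eq_orderOp _ _ _ _ _ _).symm

theorem tendsto_ell_last (lamHat ν : ℝ) (hM : Real.pi * lamHat ^ 2 < M) :
    Tendsto (fun n => ell ν M (Real.pi * lamHat ^ 2) n n (primOp ν M fun _ => 1)) atTop (𝓝 0) := by
  have hp : 0 ≤ Real.pi * lamHat ^ 2 := by positivity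
  have hM0 := hp.trans hM.le
  have h1 := (tendsto_pow_succ_div_factorial (4 / ν ^ 4 * (Real.pi * lamHat ^ 2))).const_mul
    (ν ^ 2 / 2)
  rw [mul_zero] at h1
  refine squeeze_zero_norm (fun n => ?_) h1
  rw [ell_eq_orderOp, norm_mul, Real.norm_of_nonneg (by positivity : 0 ≤ ν ^ 2 / 2)]
  refine mul_le_mul_of_nonneg_left (abs_orderOp_le hM0 ((isLipBdd_const 1).primOp ν hM0)
    (fun y hy0 hy => ?_) n n hp hM.le) (by positivity)
  rw [primOp_of_mem hy0 hy]
  rw [intervalIntegral.integral_const, sub_zero, smul_eq_mul, mul_one,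
    abs_of_nonneg (by positivity)]

end Order

/-! ### Finite Fock vectors -/

section Fock

variable {ρ : 𝓢(Plane, ℝ)} {ε : ℝ}

theorem lintegral_fockMeasure (hρ : IsMollifier ρ) (hε : 0 < ε) {k m : ℕ}
    {ψ : (Fin m → Plane) → ℂ} (h : IsKernel k ψ) :
    ∫⁻ p, ‖ψ p‖ₑ ^ 2 ∂(fockMeasure ρ ε m) =
      ENNReal.ofReal ((m ! : ℝ) * ∫ p, ‖ψ p‖ ^ 2 ∂(modesMeasure (specProfile ρ) ε m)) := by
  obtain ⟨C₀, hv⟩ := hρ.isProfile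
  rw [fockMeasure_eq hρ hε, lintegral_smul_measure, ENNReal.ofReal_mul (by positivity),
    ofReal_integral_eq_lintegral_ofReal (h.integrable_sq hv hε)
      (Eventually.of_forall fun p => sq_nonneg _), smul_eq_mul]
  congr 2
  funext p
  rw [ENNReal.ofReal_pow (norm_nonneg _), ofReal_norm]

/-- The squared norm of a Fock vector with components in finitely many chaoses. -/
def energySum (v : Plane → ℝ) (ε : ℝ) (N : ℕ) (ψ : FockVec) : ℝ :=
  ∑ m ∈ Finset.range N, (m ! : ℝ) * ∫ p, ‖ψ m p‖ ^ 2 ∂(modesMeasure v ε m)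

theorem fockNorm_eq (hρ : IsMollifier ρ) (hε : 0 < ε) {ψ : FockVec} {k : ℕ}
    (h : ∀ m, IsKernel k (ψ m)) {N : ℕ} (h0 : ∀ m, N ≤ m → ψ m = 0) :
    fockNorm ρ ε ψ = ENNReal.ofReal (energySum (specProfile ρ) ε N ψ) ^ (1 / 2 : ℝ) := by
  rw [fockNorm, tsum_eq_sum (s := Finset.range N), energySum, ENNReal.ofReal_sum_of_nonneg]
  · exact congrArg (· ^ (1 / 2 : ℝ)) (Finset.sum_congr rfl fun m _ =>
      lintegral_fockMeasure hρ hε (h m))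
  · exact fun m _ => mul_nonneg (by positivity) (integral_nonneg fun p => sq_nonneg _)
  · intro m hm
    rw [h0 m (by simpa using hm)]
    simp

theorem memFock_of_isKernel (hρ : IsMollifier ρ) (hε : 0 < ε) {ψ : FockVec} {k : ℕ}
    (h : ∀ m, IsKernel k (ψ m)) {N : ℕ} (h0 : ∀ m, N ≤ m → ψ m = 0) : MemFock ρ ε ψ where
  aestronglyMeasurable m := (h m).measurable.aestronglyMeasurable
  symmetric m σ := Eventually.of_forall fun p => (h m).symm σ p
  norm_lt_top := by
    rw [fockNorm_eq hρ hε h h0]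
    exact ENNReal.rpow_lt_top_of_nonneg (by norm_num) ENNReal.ofReal_ne_top

end Fock

/-! ### Membership in the Fock space -/

section Membership

variable {lamHat ν lam ε : ℝ} {n : ℕ} {i : Fin 2}

theorem isKernel_bApprox {v : Plane → ℝ} {C₀ : ℝ} (hv : IsProfile v C₀) (hlamHat : 0 < lamHat)
    (hν : 0 < ν) (hlam : 0 < lam) (hε : 0 < ε) (hε1 : ε < 1) (n : ℕ) (i : Fin 2) (m : ℕ) :
    IsKernel 0 (bApprox lamHat ν lam ε n i m) := by
  by_cases h : m ≤ n
  · rw [bApprox, if_pos h]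
    cases m with
    | zero => exact IsKernel.zero 0 0
    | succ j =>
      exact (hasEnergyLimit_bComp hv hlamHat hν hlam (lt_add_one _) n i j).kernel ε hε hε1
  · rw [bApprox, if_neg h]
    exact IsKernel.zero 0 m

theorem bApprox_of_lt {m : ℕ} (h : n < m) : bApprox lamHat ν lam ε n i m = 0 :=
  if_neg (not_le.2 h)

theorem bApprox_of_le {m : ℕ} (h : m ≤ n) :
    bApprox lamHat ν lam ε n i m = bComp lamHat ν lam ε n i m := if_pos h

theorem sqrt_growth {ν lam x : ℝ} (hlam : 0 < lam) (hx : 0 ≤ x) :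
    |√(lam + ν ^ 2 / 2 * x ^ 2)| ≤ (lam + ν ^ 2 / 2 + 1) * (1 + x) ^ 2 := by
  have h1 := affine_growth (ν := ν) hlam hx
  have h2 : 0 ≤ lam + ν ^ 2 / 2 * x ^ 2 := by positivity
  rw [abs_of_nonneg h2] at h1
  rw [abs_of_nonneg (Real.sqrt_nonneg _)]
  have h3 : √(lam + ν ^ 2 / 2 * x ^ 2) ≤ lam + ν ^ 2 / 2 * x ^ 2 + 1 := by
    rw [Real.sqrt_le_left (by positivity)]
    nlinarith
  nlinarith

theorem inv_sqrt_growth {ν lam x : ℝ} (hlam : 0 < lam) :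
    |1 / √(lam + ν ^ 2 / 2 * x ^ 2)| ≤ 1 / √lam * (1 + x) ^ 0 := by
  rw [abs_of_nonneg (by positivity), pow_zero, mul_one]
  have : 0 ≤ ν ^ 2 / 2 * x ^ 2 := by positivity
  exact one_div_le_one_div_of_le (Real.sqrt_pos.2 hlam) (Real.sqrt_le_sqrt (by linarith))

theorem isKernel_sqrtRes (hlam : 0 < lam) {ψ : FockVec} {k : ℕ} (h : ∀ m, IsKernel k (ψ m)) (m : ℕ) :
    IsKernel (k + 2) (sqrtRes ν lam ψ m) :=
  (h m).smul_symb (T := fun x => √(lam + x)) (by fun_prop) fun _ hx => sqrt_growth hlam hx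

theorem isKernel_invSqrtRes (hlam : 0 < lam) {ψ : FockVec} {k : ℕ} (h : ∀ m, IsKernel k (ψ m))
    (m : ℕ) : IsKernel k (invSqrtRes ν lam ψ m) :=
  (h m).smul_symb (T := fun x => 1 / √(lam + x)) (by fun_prop) fun _ _ => inv_sqrt_growth hlam

theorem funL0_eq_zero {g : ℝ → ℝ} {ψ : FockVec} {m : ℕ} (h : ψ m = 0) : funL0 ν g ψ m = 0 := by
  funext p
  simp [funL0, h]

theorem creation_zero {m : ℕ} : creation lamHat ε (0 : (Fin m → Plane) → ℂ) = 0 := by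
  funext p
  simp [creation]

theorem annihilation_zero {ρ : Plane → ℝ} {m : ℕ} :
    annihilation ρ lamHat ε (0 : (Fin (m + 1) → Plane) → ℂ) = 0 := by
  funext p
  simp [annihilation]

theorem opL_apply {ρ : Plane → ℝ} (ψ : FockVec) (m : ℕ) (p : Fin m → Plane) :
    opL ρ lamHat ν ε ψ m p = ((-symb ν p : ℝ) : ℂ) * ψ m p + opAplus lamHat ε ψ m p +
      annihilation ρ lamHat ε (ψ (m + 1)) p := rfl

theorem isKernel_opL {ρ : 𝓢(Plane, ℝ)} (hρ : IsMollifier ρ) (hε : 0 < ε) {ψ : FockVec}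
    (h : ∀ m, IsKernel 0 (ψ m)) (m : ℕ) : IsKernel 2 (opL ρ lamHat ν ε ψ m) := by
  obtain ⟨C₀, hv⟩ := hρ.isProfile
  have h1 : IsKernel 2 fun p => ((-symb ν p : ℝ) : ℂ) * ψ m p :=
    (h m).smul_symb (ν := ν) (l := 2) (T := fun x => -x) (D := ν ^ 2 / 2) measurable_neg fun x hx => by
      rw [abs_neg, abs_of_nonneg (by positivity)]
      gcongr
      linarith
  have h2 : IsKernel 2 (opAplus lamHat ε ψ m) := by
    cases m with
    | zero => exact IsKernel.zero 2 0
    | succ m => exact ((h m).creation lamHat ε).mono (by norm_num)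
  have h3 : IsKernel 2 (annihilation ρ lamHat ε (ψ (m + 1))) := by
    rw [annihilation_eq_annih hρ lamHat hε]
    exact ((h (m + 1)).annih hv lamHat hε).mono (by norm_num)
  exact (h1.add h2).add h3

theorem opL_eq_zero {ρ : Plane → ℝ} {ψ : FockVec} {N : ℕ} (h0 : ∀ m, N ≤ m → ψ m = 0) (m : ℕ)
    (hm : N + 1 ≤ m) : opL ρ lamHat ν ε ψ m = 0 := by
  obtain ⟨j, rfl⟩ := Nat.exists_eq_add_of_le' (show 1 ≤ m by omega)
  funext p
  rw [opL_apply, h0 (j + 1) (by omega), h0 (j + 1 + 1) (by omega), annihilation_zero, opAplus,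
    h0 j (by omega), creation_zero]
  simp

end Membership

/-! ### The residual -/

section Residual

variable {ρ : 𝓢(Plane, ℝ)} {lamHat ν lam ε : ℝ} {n : ℕ} {i : Fin 2}

theorem resSymb_mul_cancel (hlam : 0 < lam) (k : ℕ) {x : ℝ} (hx : 0 ≤ x) :
    (lam + x * (1 + 4 / ν ^ 4 * Gfun ν k (Leps lamHat ε (lam + x)))) *
      resSymb lamHat ν lam ε k x = 1 := by
  have hL := Leps_nonneg lamHat (ε := ε) (by linarith : 0 ≤ lam + x)
  have h := one_le_gam ν k (Leps lamHat ε (lam + x))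
  rw [gam_of_nonneg ν k hL] at h
  rw [resSymb, mul_one_div_cancel]
  nlinarith [mul_nonneg hx (by linarith : 0 ≤ 4 / ν ^ 4 * Gfun ν k (Leps lamHat ε (lam + x)))]

/-- The defining equation of the components with the resolvent inverted. The drift feeds the first
chaos only, and `𝓐₊ b` the higher ones. -/
theorem source_eq (hlam : 0 < lam) {j : ℕ} (hj : j + 1 ≤ n) (p : Fin (j + 1) → Plane) :
    drift lamHat ε i (j + 1) p + opAplus lamHat ε (bApprox lamHat ν lam ε n i) (j + 1) p =
      ((lam + symb ν p * (1 + 4 / ν ^ 4 * Gfun ν (n - j) (Leps lamHat ε (lam + symb ν p))) : ℝ) :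
        ℂ) * bComp lamHat ν lam ε n i (j + 1) p := by
  have hc := resSymb_mul_cancel (lamHat := lamHat) (ν := ν) (ε := ε) hlam (n - j) (symb_nonneg ν p)
  rw [opAplus, bApprox_of_le (by omega)]
  cases j with
  | zero =>
    have h0 : bComp lamHat ν lam ε n i 0 = 0 := rfl
    rw [h0, creation_zero]
    simp only [drift, bComp, Nat.sub_zero] at hc ⊢
    rw [← mul_assoc, ← Complex.ofReal_mul, hc]
    simp
  | succ j =>
    have : n + 1 - (j + 2) = n - (j + 1) := by omega
    simp only [drift, bComp, this]
    rw [← mul_assoc, ← Complex.ofReal_mul, hc]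
    simp

theorem residualErr_apply (m : ℕ) (p : Fin m → Plane) :
    residualErr ρ lamHat ν lam ε n i m p =
      drift lamHat ε i m p + opAplus lamHat ε (bApprox lamHat ν lam ε n i) m p -
        ((lam + symb ν p : ℝ) : ℂ) * bApprox lamHat ν lam ε n i m p +
        annihilation ρ lamHat ε (bApprox lamHat ν lam ε n i (m + 1)) p := by
  have : residualErr ρ lamHat ν lam ε n i m p = drift lamHat ε i m p -
      ((lam : ℂ) * bApprox lamHat ν lam ε n i m p -
        opL ρ lamHat ν ε (bApprox lamHat ν lam ε n i) m p) := rfl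
  rw [this, opL_apply]
  push_cast
  ring

theorem residualErr_zero : residualErr ρ lamHat ν lam ε n i 0 = 0 := by
  funext p
  have h0 : bApprox lamHat ν lam ε n i 0 = 0 := bApprox_of_le (Nat.zero_le n)
  rw [residualErr_apply, h0]
  simp [drift, opAplus, annihilation, cross_zero_right]

theorem residualErr_succ (hlam : 0 < lam) {j : ℕ} (hj : j + 1 ≤ n) (p : Fin (j + 1) → Plane) :
    residualErr ρ lamHat ν lam ε n i (j + 1) p =
      annihilation ρ lamHat ε (bApprox lamHat ν lam ε n i (j + 2)) p +
      ((symb ν p * (4 / ν ^ 4 * Gfun ν (n - j) (Leps lamHat ε (lam + symb ν p))) : ℝ) : ℂ) *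
        bComp lamHat ν lam ε n i (j + 1) p := by
  rw [residualErr_apply, source_eq hlam hj, bApprox_of_le hj]
  push_cast
  ring

/-- What remains is `𝓐₋ b_{j+2}` plus the correction with `G_{n-j}`. As `b_{j+2} = R 𝓐₊ b_{j+1}` and
`G_{n-j}` is the primitive of `1/γ_{n-j-1}`, the profile of `R`, the two cancel up to the defect. -/
theorem residualErr_of_lt (hρ : IsMollifier ρ) (hlam : 0 < lam) (hε : 0 < ε) {j : ℕ}
    (hj : j + 1 < n) : residualErr ρ lamHat ν lam ε n i (j + 1) =
      defect (specProfile ρ) lamHat ν lam ε (resPos lamHat ν lam ε (n - (j + 1)))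
        (fun x => 1 / gam ν (n - (j + 1)) x) (bComp lamHat ν lam ε n i (j + 1)) := by
  funext p
  have hL := Leps_nonneg lamHat (ε := ε) (by linarith [symb_nonneg ν p] : 0 ≤ lam + symb ν p)
  rw [residualErr_succ hlam hj.le, defect, bApprox_of_le (by omega), bComp_succ_eq hlam,
    annihilation_eq_annih hρ lamHat hε, ← Gfun_succ ν (by omega) hL,
    show n - (j + 1) + 1 = n - j by omega]

theorem residualErr_last (hlam : 0 < lam) (j : ℕ) :
    residualErr ρ lamHat ν lam ε (j + 1) i (j + 1) = 0 := by
  funext p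
  rw [residualErr_succ hlam le_rfl, bApprox_of_lt (by omega), annihilation_zero,
    show j + 1 - j = 1 by omega]
  simp [Gfun]

/-- The truncation error: the only part of the residual that survives `ε → 0` and needs `n → ∞`. -/
theorem residualErr_top (j : ℕ) : residualErr ρ lamHat ν lam ε (j + 1) i (j + 2) =
    creation lamHat ε (bComp lamHat ν lam ε (j + 1) i (j + 1)) := by
  funext p
  rw [residualErr_apply, bApprox_of_lt (by omega), bApprox_of_lt (by omega), annihilation_zero,
    opAplus, bApprox_of_le le_rfl]
  simp [drift]

theorem residualErr_of_gt (hn : 1 ≤ n) {m : ℕ} (hm : n + 2 ≤ m) :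
    residualErr ρ lamHat ν lam ε n i m = 0 := by
  obtain ⟨j, rfl⟩ := Nat.exists_eq_add_of_le' (show 2 ≤ m by omega)
  funext p
  rw [residualErr_apply, bApprox_of_lt (by omega), bApprox_of_lt (by omega), annihilation_zero,
    opAplus, bApprox_of_lt (by omega), creation_zero]
  simp [drift]

theorem isKernel_residualErr (hρ : IsMollifier ρ) (hlamHat : 0 < lamHat) (hν : 0 < ν)
    (hlam : 0 < lam) (hε : 0 < ε) (hε1 : ε < 1) (hn : 1 ≤ n) (i : Fin 2) (m : ℕ) :
    IsKernel 2 (residualErr ρ lamHat ν lam ε n i m) := by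
  obtain ⟨C₀, hv⟩ := hρ.isProfile
  have hb : ∀ j, IsKernel 0 (bComp lamHat ν lam ε n i (j + 1)) := fun j =>
    (hasEnergyLimit_bComp hv hlamHat hν hlam (lt_add_one _) n i j).kernel ε hε hε1
  rcases m with _ | j
  · rw [residualErr_zero]
    exact IsKernel.zero 2 0
  rcases lt_trichotomy (j + 1) n with hj | rfl | hj
  · rw [residualErr_of_lt hρ hlam hε hj]
    exact (hb j).defect hv hν hlam hε (isSymbol_resPos hlam ν _ ε)
  · rw [residualErr_last hlam]
    exact IsKernel.zero _ _
  rcases (Nat.succ_le_of_lt hj).eq_or_lt with hj' | hj'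
  · obtain ⟨l, rfl⟩ := Nat.exists_eq_add_of_le' hn
    obtain rfl : j = l + 1 := by omega
    rw [residualErr_top]
    exact ((hb l).creation lamHat ε).mono (by norm_num)
  · rw [residualErr_of_gt hn (by omega)]
    exact IsKernel.zero _ _

end Residual

/-! ### Reflection -/

section Reflection

variable {ρ : 𝓢(Plane, ℝ)} {lamHat ν lam ε : ℝ}

theorem measurePreserving_flip_modeMeasure (hρ : IsMollifier ρ) (ε : ℝ) :
    MeasurePreserving flip (modeMeasure (specProfile ρ) ε) (modeMeasure (specProfile ρ) ε) := by
  obtain ⟨C₀, hv⟩ := hρ.isProfile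
  have hf : Measurable flip := flip.continuous.measurable
  have hw : ∀ q, modeWeight (specProfile ρ) ε (flip q) = modeWeight (specProfile ρ) ε q := by
    intro q
    rw [modeWeight, ← map_smul, hρ.specProfile_comp_isometry, LinearIsometryEquiv.norm_map, modeWeight]
  refine ⟨hf, ?_⟩
  ext s hs
  rw [Measure.map_apply hf hs, modeMeasure, withDensity_apply _ (hf hs), withDensity_apply _ hs,
    ← flip.measurePreserving.setLIntegral_comp_preimage hs
      (hv.measurable_modeWeight ε).ennreal_ofReal]
  simp only [hw]

theorem measurePreserving_flip_modesMeasure (hρ : IsMollifier ρ) (ε : ℝ) (m : ℕ) :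
    MeasurePreserving (fun (p : Fin m → Plane) i => flip (p i)) (modesMeasure (specProfile ρ) ε m)
      (modesMeasure (specProfile ρ) ε m) :=
  measurePreserving_pi _ _ fun _ => measurePreserving_flip_modeMeasure hρ ε

theorem sum_flip {m : ℕ} (p : Fin m → Plane) : ∑ i, flip (p i) = flip (∑ i, p i) :=
  (map_sum flip p Finset.univ).symm

theorem symb_flip {m : ℕ} (p : Fin m → Plane) : symb ν (fun i => flip (p i)) = symb ν p := by
  rw [symb, symb, sum_flip, LinearIsometryEquiv.norm_map]

/-- A reflection reverses the signed area, so each `𝓐₊` switches the parity; both components of `b`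
switch together and their relative parity stays odd. -/
theorem creation_flip {m : ℕ} {ψ : (Fin m → Plane) → ℂ} {c : ℂ}
    (h : ∀ p, ψ (fun i => flip (p i)) = c * ψ p) (p : Fin (m + 1) → Plane) :
    creation lamHat ε ψ (fun i => flip (p i)) = -c * creation lamHat ε ψ p := by
  have hs : ∑ i, ((cross (flip (p i)) (flip (∑ j, p j)) : ℝ) : ℂ) *
      ψ (fun j => flip (p (i.succAbove j))) =
      -c * ∑ i, ((cross (p i) (∑ j, p j) : ℝ) : ℂ) * ψ (fun j => p (i.succAbove j)) := by
    rw [Finset.mul_sum]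
    refine Finset.sum_congr rfl fun i _ => ?_
    rw [cross_flip, h fun j => p (i.succAbove j)]
    push_cast
    ring
  rw [creation, creation, sum_flip, hs]
  ring

/-- The parity of `V_i` under the reflection. -/
def axisSign (i : Fin 2) : ℂ := if i = 0 then 1 else -1

theorem bComp_flip (i : Fin 2) (n j : ℕ) (p : Fin (j + 1) → Plane) :
    bComp lamHat ν lam ε n i (j + 1) (fun k => flip (p k)) =
      (-1) ^ j * axisSign i * bComp lamHat ν lam ε n i (j + 1) p := by
  induction j with
  | zero =>
    simp only [bComp, symb_flip, driftKernel]
    fin_cases i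
    · simp [axisSign, perp_flip_zero]
    · simp [axisSign, perp_flip_one]
  | succ j ih =>
    simp only [bComp, symb_flip]
    rw [creation_flip ih]
    ring

theorem integral_inner_bApprox (hρ : IsMollifier ρ) (hε : 0 < ε) (n m : ℕ) :
    ∫ p, conj (sqrtRes ν lam (bApprox lamHat ν lam ε n 0) m p) *
      sqrtRes ν lam (bApprox lamHat ν lam ε n 1) m p ∂(fockMeasure ρ ε m) = 0 := by
  rcases m with _ | j
  · have h : bApprox lamHat ν lam ε n 0 0 = 0 := bApprox_of_le (Nat.zero_le n)
    rw [sqrtRes, funL0_eq_zero h]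
    simp
  by_cases hj : j + 1 ≤ n
  swap
  · rw [sqrtRes, funL0_eq_zero (bApprox_of_lt (by omega))]
    simp
  rw [fockMeasure_eq hρ hε, integral_smul_measure]
  set F : (Fin (j + 1) → Plane) → ℂ := fun p =>
    conj (sqrtRes ν lam (bApprox lamHat ν lam ε n 0) (j + 1) p) *
      sqrtRes ν lam (bApprox lamHat ν lam ε n 1) (j + 1) p with hF
  have h1 : ∀ p, F (fun i => flip (p i)) = -F p := by
    intro p
    simp only [hF, sqrtRes, funL0, bApprox_of_le hj, bComp_flip, symb_flip, axisSign, map_mul,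
      map_pow, map_neg, map_one, if_true, one_ne_zero, if_false]
    have h : ((-1 : ℂ) ^ j) ^ 2 = 1 := by rw [← pow_mul, mul_comm, pow_mul]; simp
    linear_combination (-(conj ((√(lam + symb ν p) : ℝ) : ℂ) *
      conj (bComp lamHat ν lam ε n 0 (j + 1) p) * (((√(lam + symb ν p) : ℝ) : ℂ) *
        bComp lamHat ν lam ε n 1 (j + 1) p))) * h
  have h2 := (measurePreserving_flip_modesMeasure hρ ε (j + 1)).integral_comp
    (MeasurableEquiv.piCongrRight fun _ : Fin (j + 1) =>
      flip.toHomeomorph.toMeasurableEquiv).measurableEmbedding F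
  -- The integrand is odd under a measure-preserving map, so its integral equals its own negative.
  simp only [h1, integral_neg] at h2
  rw [neg_eq_self.1 h2, smul_zero]

theorem fockInner_bApprox (hρ : IsMollifier ρ) (hε : 0 < ε) (n : ℕ) :
    fockInner ρ ε (sqrtRes ν lam (bApprox lamHat ν lam ε n 0))
      (sqrtRes ν lam (bApprox lamHat ν lam ε n 1)) = 0 := by
  simp only [fockInner, integral_inner_bApprox hρ hε, tsum_zero]

end Reflection

/-! ### Limits of the norms -/

section Norms

variable {ρ : 𝓢(Plane, ℝ)} {lamHat ν lam : ℝ}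

theorem tendsto_sqrt_ofReal {E : ℝ → ℝ} {a : ℝ} {l : Filter ℝ} (h : Tendsto E l (𝓝 a)) :
    Tendsto (fun ε => ENNReal.ofReal (E ε) ^ (1 / 2 : ℝ)) l
      (𝓝 (ENNReal.ofReal a ^ (1 / 2 : ℝ))) :=
  ((ENNReal.continuous_rpow_const).tendsto _).comp (ENNReal.tendsto_ofReal h)

theorem tendsto_energySum {ψ : ℝ → FockVec} {v : Plane → ℝ} {N : ℕ} {l : ℕ → ℝ}
    (h : ∀ m, m < N → Tendsto (fun ε => (m ! : ℝ) * ∫ p, ‖ψ ε m p‖ ^ 2 ∂(modesMeasure v ε m))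
      (𝓝[>] 0) (𝓝 (l m))) :
    Tendsto (fun ε => energySum v ε N (ψ ε)) (𝓝[>] 0) (𝓝 (∑ m ∈ Finset.range N, l m)) :=
  tendsto_finsetSum _ fun m hm => h m (Finset.mem_range.1 hm)

theorem tendsto_energy_zero {ψ : ℝ → FockVec} {v : Plane → ℝ} {m : ℕ}
    (h : ∀ᶠ ε in 𝓝[>] 0, ψ ε m = 0) :
    Tendsto (fun ε => (m ! : ℝ) * ∫ p, ‖ψ ε m p‖ ^ 2 ∂(modesMeasure v ε m)) (𝓝[>] 0) (𝓝 0) := by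
  refine tendsto_const_nhds.congr' ?_
  filter_upwards [h] with ε hε
  simp [hε]

theorem tendsto_fockNorm_bApprox (hρ : IsMollifier ρ) (hlamHat : 0 < lamHat) (hν : 0 < ν)
    (hlam : 0 < lam) (n : ℕ) (i : Fin 2) :
    Tendsto (fun ε => fockNorm ρ ε (bApprox lamHat ν lam ε n i)) (𝓝[>] 0) (𝓝 0) := by
  obtain ⟨C₀, hv⟩ := hρ.isProfile
  have h1 : Tendsto (fun ε => energySum (specProfile ρ) ε (n + 1) (bApprox lamHat ν lam ε n i))
      (𝓝[>] 0) (𝓝 (∑ m ∈ Finset.range (n + 1), 0)) := by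
    refine tendsto_energySum fun m hm => ?_
    rcases m with _ | j
    · exact tendsto_energy_zero (Eventually.of_forall fun ε => bApprox_of_le (Nat.zero_le n))
    · simp only [bApprox_of_le (Nat.le_of_lt_succ hm)]
      exact (hasEnergyLimit_bComp hv hlamHat hν hlam (lt_add_one _) n i j).mass
  rw [Finset.sum_const_zero] at h1
  have h2 := tendsto_sqrt_ofReal h1
  rw [ENNReal.ofReal_zero, ENNReal.zero_rpow_of_pos (by norm_num)] at h2
  refine h2.congr' ?_
  filter_upwards [eventually_small] with ε hε
  exact (fockNorm_eq hρ hε.1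
    (isKernel_bApprox hv hlamHat hν hlam hε.1 (by linarith [hε.2]) n i)
    fun m hm => bApprox_of_lt (by omega)).symm

theorem norm_sqrtRes_sq (hlam : 0 < lam) (ψ : FockVec) (m : ℕ) (p : Fin m → Plane) :
    ‖sqrtRes ν lam ψ m p‖ ^ 2 = (lam + symb ν p) * ‖ψ m p‖ ^ 2 := by
  have := symb_nonneg ν p
  rw [sqrtRes, funL0, norm_mul, Complex.norm_real, mul_pow, Real.norm_eq_abs, sq_abs,
    Real.sq_sqrt (by linarith)]

theorem norm_invSqrtRes_sq (hlam : 0 < lam) (ψ : FockVec) (m : ℕ) (p : Fin m → Plane) :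
    ‖invSqrtRes ν lam ψ m p‖ ^ 2 = 1 / (lam + symb ν p) * ‖ψ m p‖ ^ 2 := by
  have := symb_nonneg ν p
  rw [invSqrtRes, funL0, norm_mul, Complex.norm_real, mul_pow, Real.norm_eq_abs, sq_abs, div_pow,
    Real.sq_sqrt (by linarith), one_pow]

theorem tendsto_fockNorm_sqrtRes (hρ : IsMollifier ρ) (hlamHat : 0 < lamHat) (hν : 0 < ν)
    (hlam : 0 < lam) {M : ℝ} (hM : Real.pi * lamHat ^ 2 < M) (n : ℕ) (i : Fin 2) :
    Tendsto (fun ε => fockNorm ρ ε (sqrtRes ν lam (bApprox lamHat ν lam ε n i)) ^ 2) (𝓝[>] 0)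
      (𝓝 (ENNReal.ofReal (∑ j ∈ Finset.range n,
        ell ν M (Real.pi * lamHat ^ 2) n (j + 1) fun _ => 1))) := by
  obtain ⟨C₀, hv⟩ := hρ.isProfile
  set l : ℕ → ℝ := fun m => match m with
    | 0 => 0
    | j + 1 => ell ν M (Real.pi * lamHat ^ 2) n (j + 1) fun _ => 1 with hl
  have h1 : Tendsto (fun ε => energySum (specProfile ρ) ε (n + 1)
      (sqrtRes ν lam (bApprox lamHat ν lam ε n i)))
      (𝓝[>] 0) (𝓝 (∑ m ∈ Finset.range (n + 1), l m)) := by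
    refine tendsto_energySum fun m hm => ?_
    rcases m with _ | j
    · exact tendsto_energy_zero (Eventually.of_forall fun ε =>
        funL0_eq_zero (bApprox_of_le (Nat.zero_le n)))
    · simp only [norm_sqrtRes_sq hlam, bApprox_of_le (Nat.le_of_lt_succ hm)]
      exact (hasEnergyLimit_bComp hv hlamHat hν hlam hM n i j).energy
  rw [Finset.sum_range_succ', hl, add_zero] at h1
  refine (ENNReal.tendsto_ofReal h1).congr' ?_
  filter_upwards [eventually_small] with ε hε
  rw [fockNorm_eq hρ hε.1 (isKernel_sqrtRes hlam (isKernel_bApprox hv hlamHat hν hlam hε.1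
    (by linarith [hε.2]) n i)) (N := n + 1) fun m hm => funL0_eq_zero (bApprox_of_lt (by omega)),
    ← ENNReal.rpow_natCast, ← ENNReal.rpow_mul]
  norm_num

/-- The squared dual norm of the defect is at most `C κ⁴` times an energy that converges. -/
theorem tendsto_residual_component (hρ : IsMollifier ρ) (hlamHat : 0 < lamHat) (hν : 0 < ν)
    (hlam : 0 < lam) {n : ℕ} (i : Fin 2) {j : ℕ} (hj : j + 1 < n) :
    Tendsto (fun ε => ((j + 1)! : ℝ) * ∫ p, ‖invSqrtRes ν lam
      (residualErr ρ lamHat ν lam ε n i) (j + 1) p‖ ^ 2 ∂(modesMeasure (specProfile ρ) ε (j + 1)))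
      (𝓝[>] 0) (𝓝 0) := by
  obtain ⟨C₀, hv⟩ := hρ.isProfile
  have hb := hasEnergyLimit_bComp hv hlamHat hν hlam (lt_add_one _) n i j
  obtain ⟨C, hC, hest⟩ := integral_defect_le hv (1 + 4 / ν ^ 4 + lam) hlamHat hν hlam (j + 1)
  have h1 := (((tendsto_coupling_sq lamHat).pow 2).const_mul C).mul hb.energy
  rw [zero_pow two_ne_zero, mul_zero, zero_mul] at h1
  refine squeeze_zero' (Eventually.of_forall fun ε => mul_nonneg (by positivity)
    (integral_nonneg fun p => sq_nonneg _)) ?_ h1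
  filter_upwards [eventually_small] with ε hε
  have h2 := hest ε hε.1 hε.2.le _ _ (isSymbol_resPos hlam ν (n - (j + 1)) ε)
    (bComp lamHat ν lam ε n i (j + 1)) (hb.kernel ε hε.1 (by linarith [hε.2]))
  simp only [norm_invSqrtRes_sq hlam, residualErr_of_lt hρ hlam hε.1 hj]
  rw [mul_left_comm, ← pow_mul]
  exact mul_le_mul_of_nonneg_left h2 (by positivity)

theorem tendsto_fockNorm_residual (hρ : IsMollifier ρ) (hlamHat : 0 < lamHat) (hν : 0 < ν)
    (hlam : 0 < lam) {M : ℝ} (hM : Real.pi * lamHat ^ 2 < M) {n : ℕ} (hn : 1 ≤ n) (i : Fin 2) :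
    Tendsto (fun ε => fockNorm ρ ε (invSqrtRes ν lam (residualErr ρ lamHat ν lam ε n i))) (𝓝[>] 0)
      (𝓝 (ENNReal.ofReal (ell ν M (Real.pi * lamHat ^ 2) n n (primOp ν M fun _ => 1)) ^
        (1 / 2 : ℝ))) := by
  obtain ⟨C₀, hv⟩ := hρ.isProfile
  have hM0 : 0 ≤ M := le_trans (by positivity) hM.le
  have h1 : Tendsto (fun ε => energySum (specProfile ρ) ε (n + 2)
      (invSqrtRes ν lam (residualErr ρ lamHat ν lam ε n i))) (𝓝[>] 0)
      (𝓝 (∑ m ∈ Finset.range (n + 2), if m = n + 1 then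
        ell ν M (Real.pi * lamHat ^ 2) n n (primOp ν M fun _ => 1) else 0)) := by
    refine tendsto_energySum fun m hm => ?_
    obtain ⟨l, rfl⟩ := Nat.exists_eq_add_of_le' hn
    rcases m with _ | j
    · rw [if_neg (by omega)]
      exact tendsto_energy_zero (Eventually.of_forall fun ε => funL0_eq_zero residualErr_zero)
    rcases lt_trichotomy (j + 1) (l + 1) with hj | hj | hj
    · rw [if_neg (by omega)]
      exact tendsto_residual_component hρ hlamHat hν hlam i hj
    · obtain rfl : j = l := by omega
      rw [if_neg (by omega)]
      exact tendsto_energy_zero (Eventually.of_forall fun ε =>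
        funL0_eq_zero (residualErr_last hlam j))
    · obtain rfl : j = l + 1 := by omega
      rw [if_pos rfl]
      -- Here the source `𝓐₊ b_n` is tested with the bare resolvent symbol `1/(λ+x)`, whose profile
      -- is the constant `1`.
      simp only [norm_invSqrtRes_sq hlam, residualErr_top]
      exact ((hasEnergyLimit_bComp hv hlamHat hν hlam hM (l + 1) i l).creation hv hlamHat hν hlam
        hM0 hM).limit _ _ _ fun ε => isSymbol_one_div hlam ε
  rw [Finset.sum_ite_eq' , if_pos (by simp)] at h1
  refine (tendsto_sqrt_ofReal h1).congr' ?_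
  filter_upwards [eventually_small] with ε hε
  exact (fockNorm_eq hρ hε.1 (isKernel_invSqrtRes hlam (isKernel_residualErr hρ hlamHat hν hlam
    hε.1 (by linarith [hε.2]) hn i)) fun m hm => funL0_eq_zero (residualErr_of_gt hn hm)).symm

end Norms

end CurlGFF

end

/-! ### Assembly of the theorem -/

open CurlGFF
theorem theorem5p2 (ρ : 𝓢(Plane, ℝ)) (hρ : IsMollifier ρ) (lamHat ν lam : ℝ)
    (hlamHat : 0 < lamHat) (hν : 0 < ν) (hlam : 0 < lam) :
    -- the functionals are well defined
    (∀ ε : ℝ, 0 < ε → ε < 1 → ∀ n : ℕ, 1 ≤ n → ∀ i : Fin 2,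
      MemFock ρ ε (bApprox lamHat ν lam ε n i) ∧
      MemFock ρ ε (sqrtRes ν lam (bApprox lamHat ν lam ε n i)) ∧
      MemFock ρ ε (opL ρ lamHat ν ε (bApprox lamHat ν lam ε n i))) ∧
    (∀ i : Fin 2,
      HasIteratedLimit (fun ε n => fockNorm ρ ε (bApprox lamHat ν lam ε n i)) 0 ∧
      HasIteratedLimit
        (fun ε n => fockNorm ρ ε (invSqrtRes ν lam (residualErr ρ lamHat ν lam ε n i))) 0 ∧
      HasIteratedLimit
        (fun ε n => fockNorm ρ ε (sqrtRes ν lam (bApprox lamHat ν lam ε n i)) ^ 2)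
        (ENNReal.ofReal (effCoeff lamHat ν ^ 2 / 4))) ∧
    HasIteratedLimit
      (fun ε n => fockInner ρ ε (sqrtRes ν lam (bApprox lamHat ν lam ε n 0))
        (sqrtRes ν lam (bApprox lamHat ν lam ε n 1))) 0 := by
  obtain ⟨C₀, hv⟩ := hρ.isProfile
  -- The truncation level is `M = πλ̂² + 1`; any `M` above the limit of `L^ε(λ)` would do.
  have hM := lt_add_one (Real.pi * lamHat ^ 2)
  refine ⟨fun ε hε hε1 n hn i => ?_, fun i => ⟨⟨fun _ => 0, fun n _ =>
    tendsto_fockNorm_bApprox hρ hlamHat hν hlam n i, tendsto_const_nhds⟩, ⟨_, fun n hn =>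
    tendsto_fockNorm_residual hρ hlamHat hν hlam hM hn i, ?_⟩, ⟨_, fun n _ =>
    tendsto_fockNorm_sqrtRes hρ hlamHat hν hlam hM n i,
    ENNReal.tendsto_ofReal (tendsto_sum_ell lamHat hν hM)⟩⟩, fun _ => 0, fun n _ => ?_,
    tendsto_const_nhds⟩
  · have hb := isKernel_bApprox hv hlamHat hν hlam hε hε1 n i
    have h0 : ∀ m, n + 1 ≤ m → bApprox lamHat ν lam ε n i m = 0 := fun m hm =>
      bApprox_of_lt (by omega)
    exact ⟨memFock_of_isKernel hρ hε hb h0, memFock_of_isKernel hρ hε (isKernel_sqrtRes hlam hb)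
      (N := n + 1) fun m hm => funL0_eq_zero (h0 m hm),
      memFock_of_isKernel hρ hε (isKernel_opL hρ hε hb) (opL_eq_zero h0)⟩
  · have h := ((ENNReal.continuous_rpow_const (y := 1 / 2)).tendsto _).comp
      (ENNReal.tendsto_ofReal (tendsto_ell_last lamHat ν hM))
    rwa [ENNReal.ofReal_zero, ENNReal.zero_rpow_of_pos (by norm_num)] at h
  · refine tendsto_const_nhds.congr' ?_
    filter_upwards [eventually_small] with ε hε
    exact (fockInner_bApprox hρ hε.1 n).symm
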